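/- **Setting.** Let $m,n\ge 1$ and let $A=[a_1,\dots,a_n]\in\mathbb Z^{m\times n}$ have encoding length $L=\sum_{i,j}\bigl(1+\lceil\log_2(|a_{ij}|+1)\rceil\bigr)$. Put $\hat a_j=a_j/\|a_j\|_2$ (with $\hat 0=0$), $\hat A=[\hat a_1,\dots,\hat a_n]$, and for $S\subseteq[n]$ let $A_S,\hat A_S$ be the submatrices of columns indexed by $S$. Let $$\Delta_A=\max\Bigl\{\prod_{j\in B}\|a_j\|_2 : B\subseteq[n],\ |B|=\operatorname{rk}(A_B)\Bigr\},\qquad \theta=\theta_A=\frac1{m^2\Delta_A^2},\qquad \varepsilon=\frac1{11m}.$$ For a positive definite $Q$ write $\langle v,w\rangle_Q=v^{\mathsf T}Qw$ and $\|v\|_Q=\sqrt{\langle v,v\rangle_Q}$. Let $\Pi$ denote the orthogonal projection matrix onto $\ker(\hat A_S)\subseteq\mathbb R^S$ for the current set $S$. **The (amortized) Maximum Support Kernel Algorithm.** Start with $S=[n]$, $T=\emptyset$, $Q=I_m$, $x_j=1$ for all $j\in[n]$, and $y=\hat Ax$. While $S\ne\emptyset$ and $\Pi x\not>0$, do the following.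 1. Choose $k\in\arg\min_{j\in S}\langle\hat a_j,y\rangle_Q/\|\hat a_j\|_Q$ (the quotient is read as $0$ if $a_j=0$). 2. If $\langle\hat a_k,y\rangle_Q<-\varepsilon\|\hat a_k\|_Q\|y\|_Q$, then, with $c=\langle\hat a_k,y\rangle_Q/\|\hat a_k\|_Q^2$, replace $x$ by $x-c\,e_k$ and $y$ by $y-c\,\hat a_k$. 3. Otherwise: - replace $Q$ by $\frac1{(1+3\varepsilon)^2}\Bigl(Q+\frac{3\,Qyy^{\mathsf T}Q}{\|y\|_Q^2}\Bigr)$; - add to $T$ all $k\in S\setminus T$ with $\|\hat a_k\|_Q>\theta^{-1}$; - if now $\operatorname{rk}(A_{S\setminus T})<\operatorname{rk}(A_S)$, discard these columns: set $S:=S\setminus T$, $T:=\emptyset$, reset $x_j:=1$ for $j\in S$ and $y:=\hat A_Sx$, and recompute $\Pi$ (the matrix $Q$ is kept). On exit return $\bar x\in\mathbb R^n$ with $\bar x_j=(\Pi x)_j/\|a_j\|_2$ for $j\in S$ with $a_j\neq0$, $\bar x_j=(\Pi x)_j$ for $j\in S$ with $a_j=0$, and $\bar x_j=0$ for $j\notin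 S$ (so $\bar x=0$ if $S=\emptyset$). **Theorem 4.6.** There is a universal constant $C$ such that the following holds for all $m,n\ge1$ and all $A\in\mathbb Z^{m\times n}$ of encoding length $L$. (i) Every run of the algorithm, however ties in step 1 are broken, terminates after at most $C\,(m^3n+mn^2)L$ iterations, and the vector $\bar x$ that it returns is a solution of $Ax=0$, $x\ge0$ of maximum support, that is, $A\bar x=0$, $\bar x\ge0$, and $\operatorname{supp}(x')\subseteq\operatorname{supp}(\bar x)$ for every $x'\ge0$ with $Ax'=0$. (ii) The algorithm finds this solution in $O\bigl((m^3n+mn^2)L\bigr)$ arithmetic operations: an explicit implementation of it over the real numbers, in which each $+,-,\times,\div$, square root, comparison of two numbers and loading of an integer constant counts as one operation, carries out such a run from the input $A$ to the output $\bar x$ with at most $C\,(m^3n+mn^2)L$ operations in total. This includes the computation of $\theta$, of the projection matrices and of the ranks. -/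

import Mathlib

namespace KernelAlg

open Matrix

/-! # Basic quantities attached to an integer matrix -/

/-- The Euclidean norm of the `j`-th column of `A`. -/
noncomputable def colNorm {m n : ℕ} (A : Matrix (Fin m) (Fin n) ℤ) (j : Fin n) : ℝ :=
  √(∑ i, (A i j : ℝ) ^ 2)

/-- The matrix of normalized columns `â_j = a_j / ‖a_j‖`, with `â_j = 0` if `a_j = 0`. -/
noncomputable def unitCols {m n : ℕ} (A : Matrix (Fin m) (Fin n) ℤ) :
    Matrix (Fin m) (Fin n) ℝ :=
  Matrix.of fun i j => (A i j : ℝ) / colNorm A j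

/-- The rank of the submatrix `A_S` formed by the columns indexed by `S`. -/
noncomputable def colRank {m n : ℕ} (A : Matrix (Fin m) (Fin n) ℤ) (S : Finset (Fin n)) : ℕ :=
  ((A.map (Int.cast : ℤ → ℝ)).submatrix id (Subtype.val : S → Fin n)).rank

/-- `Δ_A`: the maximum (of a finite nonempty set) of `∏_{j ∈ B} ‖a_j‖` over all sets `B` of
linearly independent columns. -/
noncomputable def delta {m n : ℕ} (A : Matrix (Fin m) (Fin n) ℤ) : ℝ :=
  sSup {r : ℝ | ∃ B : Finset (Fin n), B.card = colRank A B ∧ r = ∏ j ∈ B, colNorm A j}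

/-- `θ_A = 1 / (m² Δ_A²)`. -/
noncomputable def theta {m n : ℕ} (A : Matrix (Fin m) (Fin n) ℤ) : ℝ :=
  1 / ((m : ℝ) ^ 2 * delta A ^ 2)

/-- The encoding length of an integer matrix: an integer `a` takes one bit for the sign and
`⌈log₂ (|a| + 1)⌉` bits for the absolute value. -/
def encodingLength {m n : ℕ} (A : Matrix (Fin m) (Fin n) ℤ) : ℕ :=
  ∑ i, ∑ j, (1 + Nat.clog 2 ((A i j).natAbs + 1))

/-- `ε = 1 / (11 m)`. -/
noncomputable def eps (m : ℕ) : ℝ := 1 / (11 * (m : ℝ))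

/-- The scalar product `⟨v, w⟩_Q = vᵀ Q w`. -/
def qInner {m : ℕ} (Q : Matrix (Fin m) (Fin m) ℝ) (v w : Fin m → ℝ) : ℝ := v ⬝ᵥ (Q *ᵥ w)

/-- The norm `‖v‖_Q`. -/
noncomputable def qNorm {m : ℕ} (Q : Matrix (Fin m) (Fin m) ℝ) (v : Fin m → ℝ) : ℝ :=
  √(qInner Q v v)

/-- The kernel of `Â_S`, as a subspace of `ℝⁿ` (vectors on `S` are extended by zero). -/
def kernelOn {m n : ℕ} (A : Matrix (Fin m) (Fin n) ℤ) (S : Finset (Fin n)) :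
    Submodule ℝ (EuclideanSpace ℝ (Fin n)) where
  carrier := {v | unitCols A *ᵥ v.ofLp = 0 ∧ ∀ j, j ∉ S → v j = 0}
  zero_mem' := by simp
  add_mem' := by
    rintro u v ⟨hu, hu'⟩ ⟨hv, hv'⟩
    refine ⟨by simp [mulVec_add, hu, hv], fun j hj => by simp [hu' j hj, hv' j hj]⟩
  smul_mem' := by
    rintro c v ⟨hv, hv'⟩
    refine ⟨by simp [mulVec_smul, hv], fun j hj => by simp [hv' j hj]⟩

/-- `Π x`, where `Π` is the orthogonal projection onto the kernel of `Â_S`. -/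
noncomputable def kernelProj {m n : ℕ} (A : Matrix (Fin m) (Fin n) ℤ) (S : Finset (Fin n))
    (x : Fin n → ℝ) : Fin n → ℝ :=
  ((kernelOn A S).starProjection (WithLp.toLp 2 x)).ofLp

/-- `x` is a solution of `A x = 0`, `x ≥ 0` whose support contains that of every solution. -/
def IsMaxSupportSolution {m n : ℕ} (A : Matrix (Fin m) (Fin n) ℤ) (x : Fin n → ℝ) : Prop :=
  A.map (Int.cast : ℤ → ℝ) *ᵥ x = 0 ∧ 0 ≤ x ∧
    ∀ x' : Fin n → ℝ, A.map (Int.cast : ℤ → ℝ) *ᵥ x' = 0 → 0 ≤ x' →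
      Function.support x' ⊆ Function.support x

/-! # The Maximum Support Kernel Algorithm as a mathematical procedure -/

/-- The variables of the algorithm. The type `R` of numbers is a parameter because the counted
program further below must not know anything about it. -/
structure State (R : Type) (m n : ℕ) where
  x : Fin n → R
  y : Fin m → R
  S : Finset (Fin n)
  T : Finset (Fin n)
  Q : Matrix (Fin m) (Fin m) R

/-- The vector that is `1` on `S` and `0` elsewhere. -/
noncomputable def onesOn {n : ℕ} (S : Finset (Fin n)) : Fin n → ℝ :=
  fun j => if j ∈ S then 1 else 0

noncomputable def start {m n : ℕ} (A : Matrix (Fin m) (Fin n) ℤ) : State ℝ m n where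
  x := onesOn Finset.univ
  y := unitCols A *ᵥ onesOn Finset.univ
  S := Finset.univ
  T := ∅
  Q := 1

/-- The exit condition of the main loop: `S = ∅` or `Π x > 0` (on the coordinates in `S`). -/
def Done {m n : ℕ} (A : Matrix (Fin m) (Fin n) ℤ) (s : State ℝ m n) : Prop :=
  s.S = ∅ ∨ ∀ j ∈ s.S, 0 < kernelProj A s.S s.x j

/-- The vector returned in state `s`. The column of a zero column needs no rescaling back. -/
noncomputable def output {m n : ℕ} (A : Matrix (Fin m) (Fin n) ℤ) (s : State ℝ m n) :
    Fin n → ℝ :=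
  fun j => if j ∈ s.S then
    (if colNorm A j = 0 then kernelProj A s.S s.x j else kernelProj A s.S s.x j / colNorm A j)
    else 0

/-- The quotient `⟨â_j, y⟩_Q / ‖â_j‖_Q` (read as `0` for a zero column). -/
noncomputable def cosine {m n : ℕ} (A : Matrix (Fin m) (Fin n) ℤ) (s : State ℝ m n)
    (j : Fin n) : ℝ :=
  qInner s.Q ((unitCols A).col j) s.y / qNorm s.Q ((unitCols A).col j)

/-- `k` is a minimizer of `cosine` over `S`. -/
def IsArgmin {m n : ℕ} (A : Matrix (Fin m) (Fin n) ℤ) (s : State ℝ m n) (k : Fin n) : Prop :=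
  k ∈ s.S ∧ ∀ j ∈ s.S, cosine A s k ≤ cosine A s j

/-- The test that decides between an update and a rescaling. -/
def IsSteep {m n : ℕ} (A : Matrix (Fin m) (Fin n) ℤ) (s : State ℝ m n) (k : Fin n) : Prop :=
  qInner s.Q ((unitCols A).col k) s.y <
    -eps m * qNorm s.Q ((unitCols A).col k) * qNorm s.Q s.y

/-- The step length `⟨â_k, y⟩_Q / ‖â_k‖_Q²`. -/
noncomputable def stepLength {m n : ℕ} (A : Matrix (Fin m) (Fin n) ℤ) (s : State ℝ m n)
    (k : Fin n) : ℝ :=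
  qInner s.Q ((unitCols A).col k) s.y / qNorm s.Q ((unitCols A).col k) ^ 2

/-- The Dunagan-Vempala update along column `k`. -/
noncomputable def dvUpdate {m n : ℕ} (A : Matrix (Fin m) (Fin n) ℤ) (s : State ℝ m n)
    (k : Fin n) : State ℝ m n :=
  { s with
    x := s.x - stepLength A s k • Pi.single k 1
    y := s.y - stepLength A s k • (unitCols A).col k }

/-- The rescaled matrix `(Q + 3 Q y yᵀ Q / ‖y‖_Q²) / (1 + 3 ε)²`. -/
noncomputable def rescaledQ {m : ℕ} (Q : Matrix (Fin m) (Fin m) ℝ) (y : Fin m → ℝ) :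
    Matrix (Fin m) (Fin m) ℝ :=
  (1 / (1 + 3 * eps m) ^ 2) •
    (Q + (3 / qNorm Q y ^ 2) • vecMulVec (Q *ᵥ y) (y ᵥ* Q))

open Classical in
/-- Rescale `Q`, then add to `T` the columns that have become longer than `θ_A⁻¹`. -/
noncomputable def rescaleUpdate {m n : ℕ} (A : Matrix (Fin m) (Fin n) ℤ) (s : State ℝ m n) :
    State ℝ m n :=
  { s with
    Q := rescaledQ s.Q s.y
    T := s.T ∪ (s.S \ s.T).filter
      fun k => (theta A)⁻¹ < qNorm (rescaledQ s.Q s.y) ((unitCols A).col k) }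

/-- Delete the columns in `T` and restart from the all-ones vector, keeping `Q`. -/
noncomputable def remove {m n : ℕ} (A : Matrix (Fin m) (Fin n) ℤ) (s : State ℝ m n) :
    State ℝ m n :=
  { s with
    x := onesOn (s.S \ s.T)
    y := unitCols A *ᵥ onesOn (s.S \ s.T)
    S := s.S \ s.T
    T := ∅ }

/-- One iteration of the main loop. -/
inductive Step {m n : ℕ} (A : Matrix (Fin m) (Fin n) ℤ) (s : State ℝ m n) : State ℝ m n → Prop
  | dv (k : Fin n) (hk : IsArgmin A s k) (hs : IsSteep A s k) : Step A s (dvUpdate A s k)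
  | rescale (k : Fin n) (hk : IsArgmin A s k) (hs : ¬ IsSteep A s k)
      (hr : ¬ colRank A ((rescaleUpdate A s).S \ (rescaleUpdate A s).T) <
        colRank A (rescaleUpdate A s).S) :
      Step A s (rescaleUpdate A s)
  | rescaleRemove (k : Fin n) (hk : IsArgmin A s k) (hs : ¬ IsSteep A s k)
      (hr : colRank A ((rescaleUpdate A s).S \ (rescaleUpdate A s).T) <
        colRank A (rescaleUpdate A s).S) :
      Step A s (remove A (rescaleUpdate A s))

/-- `Run A N s`: some run of the algorithm is in state `s` after `N` iterations. Runs differ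
only in how ties between minimizers are broken. -/
inductive Run {m n : ℕ} (A : Matrix (Fin m) (Fin n) ℤ) : ℕ → State ℝ m n → Prop
  | start : Run A 0 (start A)
  | next {N : ℕ} {s s' : State ℝ m n} (h : Run A N s) (hd : ¬ Done A s) (hs : Step A s s') :
      Run A (N + 1) s'

/-! # A model of computation that counts arithmetic operations -/

inductive ArithOp
  | add | sub | mul | div

/-- A computation over the numbers `R` with a result in `α`: a tree whose inner nodes are
elementary operations. Programs are written for an unspecified type `R`, so the nodes below are
the only way in which they can produce or inspect numbers. -/
inductive Comp (R : Type) (α : Type) : Type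
  | ret (a : α) : Comp R α
  | nat (c : ℕ) (k : R → Comp R α) : Comp R α
  | arith (o : ArithOp) (a b : R) (k : R → Comp R α) : Comp R α
  | sqrt (a : R) (k : R → Comp R α) : Comp R α
  | lt (a b : R) (k : Bool → Comp R α) : Comp R α

namespace Comp

variable {R α β : Type}

/-- Sequential composition. -/
def andThen : Comp R α → (α → Comp R β) → Comp R β
  | ret a, f => f a
  | nat c k, f => nat c fun r => (k r).andThen f
  | arith o a b k, f => arith o a b fun r => (k r).andThen f
  | sqrt a k, f => sqrt a fun r => (k r).andThen f
  | lt a b k, f => lt a b fun r => (k r).andThen f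

instance : Monad (Comp R) where
  pure := ret
  bind := andThen

end Comp

noncomputable def ArithOp.eval : ArithOp → ℝ → ℝ → ℝ
  | add, a, b => a + b
  | sub, a, b => a - b
  | mul, a, b => a * b
  | div, a, b => a / b

open Classical in
/-- Execution over the real numbers: the result, and the number of operations performed. Every
arithmetic operation, square root, comparison and constant costs one. -/
noncomputable def Comp.exec {α : Type} : Comp ℝ α → α × ℕ
  | .ret a => (a, 0)
  | .nat c k => ((k c).exec.1, (k c).exec.2 + 1)
  | .arith o a b k => ((k (o.eval a b)).exec.1, (k (o.eval a b)).exec.2 + 1)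
  | .sqrt a k => ((k √a).exec.1, (k √a).exec.2 + 1)
  | .lt a b k => ((k (decide (a < b))).exec.1, (k (decide (a < b))).exec.2 + 1)

section Program

variable {R : Type} {m n d e : ℕ}

def natC (c : ℕ) : Comp R R := .nat c .ret
def addC (a b : R) : Comp R R := .arith .add a b .ret
def subC (a b : R) : Comp R R := .arith .sub a b .ret
def mulC (a b : R) : Comp R R := .arith .mul a b .ret
def divC (a b : R) : Comp R R := .arith .div a b .ret
def sqrtC (a : R) : Comp R R := .sqrt a .ret
def ltC (a b : R) : Comp R Bool := .lt a b .ret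

/-! ## Linear algebra -/

/-- Compute a vector entry by entry. -/
def tab {α : Type} : {d : ℕ} → (Fin d → Comp R α) → Comp R (Fin d → α)
  | 0, _ => pure Fin.elim0
  | _ + 1, f => do
    let a ← f 0
    let v ← tab fun i => f i.succ
    pure (Fin.cons a v : Fin _ → α)

/-- Compute a matrix entry by entry. -/
def tabMat (f : Fin d → Fin e → Comp R R) : Comp R (Matrix (Fin d) (Fin e) R) := do
  let M ← tab fun i => tab (f i)
  pure (Matrix.of M)

def dotC : {d : ℕ} → (Fin d → R) → (Fin d → R) → Comp R R
  | 0, _, _ => natC 0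
  | _ + 1, u, v => do
    let p ← mulC (u 0) (v 0)
    let s ← dotC (fun i => u i.succ) (fun i => v i.succ)
    addC p s

def mulVecC (M : Matrix (Fin d) (Fin e) R) (v : Fin e → R) : Comp R (Fin d → R) :=
  tab fun i => dotC (M i) v

/-- `v - c u` -/
def subScaled (v : Fin d → R) (c : R) (u : Fin d → R) : Comp R (Fin d → R) :=
  tab fun i => do
    let t ← mulC c (u i)
    subC (v i) t

/-- Replace the columns outside `S` by zero. -/
def keepCols (S : Finset (Fin n)) (M : Matrix (Fin m) (Fin n) R) :
    Comp R (Matrix (Fin m) (Fin n) R) := do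
  let o ← natC 0
  pure (Matrix.of fun i j => if j ∈ S then M i j else o)

/-- The component of `v` orthogonal to the pairwise orthogonal nonzero vectors in the list. -/
def residual : List (Fin d → R) → (Fin d → R) → Comp R (Fin d → R)
  | [], v => pure v
  | b :: bs, v => do
    let p ← dotC b v
    let q ← dotC b b
    let c ← divC p q
    let v ← subScaled v c b
    residual bs v

def isNonzero (v : Fin d → R) : Comp R Bool := do
  let o ← natC 0
  let s ← dotC v v
  ltC o s

/-- Gram-Schmidt orthogonalization (without normalization, zero vectors dropped). -/
def gramSchmidt : List (Fin d → R) → List (Fin d → R) → Comp R (List (Fin d → R))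
  | [], B => pure B
  | v :: vs, B => do
    let r ← residual B v
    if ← isNonzero r then gramSchmidt vs (r :: B) else gramSchmidt vs B

/-- The rank of a matrix, by orthogonalizing its rows. -/
def rankC (M : Matrix (Fin m) (Fin n) R) : Comp R ℕ := do
  let B ← gramSchmidt (List.ofFn M) []
  pure B.length

/-- Subtract from the `n × n` matrix `P` the projections onto the lines of the given vectors. -/
def subProjections : List (Fin n → R) → Matrix (Fin n) (Fin n) R →
    Comp R (Matrix (Fin n) (Fin n) R)
  | [], P => pure P
  | b :: bs, P => do
    let q ← dotC b b
    let P ← tabMat fun i j => do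
      let t ← mulC (b i) (b j)
      let t ← divC t q
      subC (P i j) t
    subProjections bs P

/-- The matrix of the orthogonal projection onto the kernel of `M`. -/
def kernelProjC (M : Matrix (Fin m) (Fin n) R) : Comp R (Matrix (Fin n) (Fin n) R) := do
  let B ← gramSchmidt (List.ofFn M) []
  let o ← natC 0
  let u ← natC 1
  subProjections B (Matrix.of fun i j => if i = j then u else o)

/-! ## The threshold `θ_A⁻¹` -/

/-- Insert `j` into a list that is sorted by decreasing key. -/
def insertDesc (key : Fin n → R) (j : Fin n) : List (Fin n) → Comp R (List (Fin n))
  | [] => pure [j]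
  | i :: is => do
    if ← ltC (key i) (key j) then pure (j :: i :: is)
    else do
      let l ← insertDesc key j is
      pure (i :: l)

def sortDesc (key : Fin n → R) : List (Fin n) → Comp R (List (Fin n))
  | [] => pure []
  | j :: js => do
    let l ← sortDesc key js
    insertDesc key j l

/-- The greedy algorithm: go through the columns in the given order, keep each column that is
independent of the columns kept so far, and multiply up the keys of the kept columns. -/
def greedy (A : Matrix (Fin m) (Fin n) R) (key : Fin n → R) :
    List (Fin n) → List (Fin m → R) → R → Comp R R
  | [], _, c => pure c
  | j :: js, B, c => do
    let r ← residual B (A.col j)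
    if ← isNonzero r then do
      let c ← mulC c (key j)
      greedy A key js (r :: B) c
    else greedy A key js B c

/-- `θ_A⁻¹ = m² Δ_A²`, where `sq j = ‖a_j‖²`. -/
def thresholdC (A : Matrix (Fin m) (Fin n) R) (sq : Fin n → R) : Comp R R := do
  let l ← sortDesc sq (List.finRange n)
  let c ← natC 1
  let c ← greedy A sq l [] c
  let k ← natC m
  let k ← mulC k k
  mulC k c

/-! ## The algorithm -/

/-- What is computed once: `Â`, the norms `‖a_j‖`, `θ_A⁻¹` and `ε`. -/
structure Fixed (R : Type) (m n : ℕ) where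
  A : Matrix (Fin m) (Fin n) R
  unit : Matrix (Fin m) (Fin n) R
  norm : Fin n → R
  threshold : R
  eps : R

/-- The variables of the algorithm together with the auxiliary quantities `F = Âᵀ Q Â`,
`z = Âᵀ Q y`, the projection matrix `P = Π` for `Â_S` (on `ℝⁿ`) and `p = Π x`. -/
structure Work (R : Type) (m n : ℕ) extends State R m n where
  F : Matrix (Fin n) (Fin n) R
  z : Fin n → R
  P : Matrix (Fin n) (Fin n) R
  p : Fin n → R

def prepare (A : Matrix (Fin m) (Fin n) R) : Comp R (Fixed R m n) := do
  let sq ← tab fun j => dotC (A.col j) (A.col j)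
  let norm ← tab fun j => sqrtC (sq j)
  let threshold ← thresholdC A sq
  let o ← natC 0
  let unit ← tabMat fun i j => do
    if ← ltC o (norm j) then divC (A i j) (norm j) else pure o
  let u ← natC 1
  let c ← natC 11
  let k ← natC m
  let k ← mulC c k
  let eps ← divC u k
  pure ⟨A, unit, norm, threshold, eps⟩

/-- Start a round on the columns `S` with the given `Q` and `F = Âᵀ Q Â`. -/
def beginRound (D : Fixed R m n) (S : Finset (Fin n)) (Q : Matrix (Fin m) (Fin m) R)
    (F : Matrix (Fin n) (Fin n) R) : Comp R (Work R m n) := do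
  let o ← natC 0
  let u ← natC 1
  let x : Fin n → R := fun j => if j ∈ S then u else o
  let y ← mulVecC D.unit x
  let z ← mulVecC F x
  let M ← keepCols S D.unit
  let P ← kernelProjC M
  let p ← mulVecC P x
  pure ⟨⟨x, y, S, ∅, Q⟩, F, z, P, p⟩

def firstRound (D : Fixed R m n) : Comp R (Work R m n) := do
  let F ← tabMat fun i j => dotC (D.unit.col i) (D.unit.col j)
  let o ← natC 0
  let u ← natC 1
  beginRound D Finset.univ (Matrix.of fun i j => if i = j then u else o) F

/-- Are the entries of `p` in `S` (among the listed ones) positive? -/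
def allPos (S : Finset (Fin n)) (p : Fin n → R) : List (Fin n) → Comp R Bool
  | [] => pure true
  | j :: js =>
    if j ∈ S then do
      let o ← natC 0
      if ← ltC o (p j) then allPos S p js else pure false
    else allPos S p js

/-- The first minimizer of `q` over the listed elements of `S`. -/
def argminC (S : Finset (Fin n)) (q : Fin n → R) :
    List (Fin n) → Option (Fin n) → Comp R (Option (Fin n))
  | [], best => pure best
  | j :: js, best =>
    if j ∈ S then
      match best with
      | none => argminC S q js (some j)
      | some b => do
        if ← ltC (q j) (q b) then argminC S q js (some j) else argminC S q js (some b)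
    else argminC S q js best

/-- Add to `T` the listed columns in `S` whose `Q`-norm exceeds the threshold. -/
def longColsC (S : Finset (Fin n)) (F : Matrix (Fin n) (Fin n) R) (threshold : R) :
    List (Fin n) → Finset (Fin n) → Comp R (Finset (Fin n))
  | [], T => pure T
  | j :: js, T =>
    if j ∈ S ∧ j ∉ T then do
      let l ← sqrtC (F j j)
      if ← ltC threshold l then longColsC S F threshold js (insert j T)
      else longColsC S F threshold js T
    else longColsC S F threshold js T

def finished (w : Work R m n) : Comp R Bool :=
  if w.S = ∅ then pure true else allPos w.S w.p (List.finRange n)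

/-- The Dunagan-Vempala update along column `k`. -/
def dvC (D : Fixed R m n) (w : Work R m n) (k : Fin n) : Comp R (Work R m n) := do
  let c ← divC (w.z k) (w.F k k)
  let xk ← subC (w.x k) c
  let y ← subScaled w.y c (D.unit.col k)
  let z ← subScaled w.z c (w.F.col k)
  let p ← subScaled w.p c (w.P.col k)
  pure { w with x := Function.update w.x k xk, y := y, z := z, p := p }

/-- `(M + 3 v vᵀ / ysq) / c` -/
def rankOneUpdate (M : Matrix (Fin d) (Fin d) R) (v : Fin d → R) (ysq c : R) :
    Comp R (Matrix (Fin d) (Fin d) R) := do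
  let three ← natC 3
  let f ← divC three ysq
  tabMat fun i j => do
    let t ← mulC (v i) (v j)
    let t ← mulC f t
    let t ← addC (M i j) t
    divC t c

/-- Rescaling, detection of long columns, rank test and removal; `ysq = ‖y‖_Q²`. -/
def rescaleC (D : Fixed R m n) (w : Work R m n) (ysq : R) : Comp R (Work R m n) := do
  let one ← natC 1
  let three ← natC 3
  let c ← mulC three D.eps
  let c ← addC one c
  let c ← mulC c c
  let v ← mulVecC w.Q w.y
  let Q ← rankOneUpdate w.Q v ysq c
  let F ← rankOneUpdate w.F w.z ysq c
  let v ← mulVecC Q w.y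
  let z ← mulVecC D.unit.transpose v
  let T ← longColsC w.S F D.threshold (List.finRange n) w.T
  let M ← keepCols (w.S \ T) D.A
  let r ← rankC M
  let M' ← keepCols w.S D.A
  let r' ← rankC M'
  if r < r' then beginRound D (w.S \ T) Q F
  else pure { w with T := T, Q := Q, F := F, z := z }

/-- One iteration of the main loop. -/
def bodyC (D : Fixed R m n) (w : Work R m n) : Comp R (Work R m n) := do
  let o ← natC 0
  let len ← tab fun j => sqrtC (w.F j j)
  let q ← tab fun j => do
    if ← ltC o (len j) then divC (w.z j) (len j) else pure o
  let ysq ← dotC w.x w.z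
  let ylen ← sqrtC ysq
  match ← argminC w.S q (List.finRange n) none with
  | none => pure w
  | some k => do
    let t ← mulC D.eps (len k)
    let t ← mulC t ylen
    let t ← subC o t
    if ← ltC (w.z k) t then dvC D w k else rescaleC D w ysq

def outputC (D : Fixed R m n) (w : Work R m n) : Comp R (Fin n → R) := do
  let o ← natC 0
  tab fun j => do
    if j ∈ w.S then
      if ← ltC o (D.norm j) then divC (w.p j) (D.norm j) else pure (w.p j)
    else pure o

/-- The main loop, cut off with result `none` if it has not ended after `N` iterations. -/
def loopC (D : Fixed R m n) : ℕ → Work R m n → Comp R (Option (Fin n → R))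
  | 0, w => do
    if ← finished w then do
      let x ← outputC D w
      pure (some x)
    else pure none
  | N + 1, w => do
    if ← finished w then do
      let x ← outputC D w
      pure (some x)
    else do
      let w ← bodyC D w
      loopC D N w

/-- The counted implementation of the Maximum Support Kernel Algorithm, allowed `N` iterations
of the main loop. -/
def maxSupportKernel (A : Matrix (Fin m) (Fin n) R) (N : ℕ) : Comp R (Option (Fin n → R)) := do
  let D ← prepare A
  let w ← firstRound D
  loopC D N w

end Program

end KernelAlg

/-! Correctness rests on nonnegative relations ∑ c_j â_j = 0. When `Q` is rescaled, every column of
`S` makes an angle with `y` of cosine at least -ε, so its new norm is at most ((1+2ε)‖â_j‖_Q +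
⟨â_j,y⟩_Q/‖y‖_Q)/(1+3ε). Summed with the weights c_j the inner products cancel, so ∑ c_j ‖â_j‖_Q
never exceeds ∑ c_j (`sum_qNorm_rescaledQ_le`). A sparse relation through a given column has
coefficients bounded by Δ, by Carathéodory and Cramer. Hence a column that occurs in some relation
never becomes longer than θ⁻¹ (`qNorm_le_of_relation`). So deleting long columns is safe, and at the
exit Πx is positive on all of `S`, which contains the support of every solution.

Rescalings are counted by volume. A rescaling stretches by 2 in the direction of `y`, which lies in
the span of the columns of `S`, and divides lengths by 1+3ε. Thus the Gram determinant of any basis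
of `S` at least doubles (`two_mul_gramDet_le`). It starts at Δ⁻² or more, and by Hadamard it is at
most θ to the power -2 rk for a basis of columns outside `T`; such a basis exists as long as `T`
does not lower the rank. A deletion costs a factor 2^(10L) per lost dimension, which leaves at most
12 r L rescalings over the whole run, where r = rk A (`Inv.rescalings_le`).

Updates are counted by ‖y‖_Q². An update multiplies it by at most 1-ε², a rescaling by at most 4. If
the Euclidean norm of `y` is below 1/(mΔ), then Πx > 0 (`kernelProj_pos_of_qNorm_lt`). So before the
exit ‖y‖_Q² is at least 2^(-16L). After a deletion the restarted `y` has ‖y‖_Q² at most 2^(10L),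
that is, at most 2^(26L) times the bound accumulated so far. One bound therefore covers all rounds
together, and since there are at most r deletions, the number of updates is O(m² r L)
(`Inv.updates_le`).

The program maintains ÂᵀQÂ, ÂᵀQy, Π and Πx. An update then costs O(m+n), a rescaling O(m²n+n²), and
a new round O(m²n+mn²). The last cost is charged to the drop of rank (`loopC_spec`). -/

namespace KernelAlg

open Matrix

/-! # The scalar product of a positive definite matrix -/

section QForm

variable {m : ℕ} {Q : Matrix (Fin m) (Fin m) ℝ}

lemma qInner_add_left (Q : Matrix (Fin m) (Fin m) ℝ) (u v w : Fin m → ℝ) :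
    qInner Q (u + v) w = qInner Q u w + qInner Q v w := by
  simp [qInner, add_dotProduct]

lemma qInner_add_right (Q : Matrix (Fin m) (Fin m) ℝ) (u v w : Fin m → ℝ) :
    qInner Q u (v + w) = qInner Q u v + qInner Q u w := by
  simp [qInner, mulVec_add, dotProduct_add]

lemma qInner_smul_left (Q : Matrix (Fin m) (Fin m) ℝ) (c : ℝ) (u v : Fin m → ℝ) :
    qInner Q (c • u) v = c * qInner Q u v := by
  simp [qInner, smul_dotProduct]

lemma qInner_smul_right (Q : Matrix (Fin m) (Fin m) ℝ) (c : ℝ) (u v : Fin m → ℝ) :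
    qInner Q u (c • v) = c * qInner Q u v := by
  simp [qInner, mulVec_smul, dotProduct_smul]

lemma qInner_sum_left {ι : Type*} (s : Finset ι) (Q : Matrix (Fin m) (Fin m) ℝ)
    (v : ι → Fin m → ℝ) (w : Fin m → ℝ) :
    qInner Q (∑ i ∈ s, v i) w = ∑ i ∈ s, qInner Q (v i) w := by
  simp [qInner, sum_dotProduct]

lemma qInner_sum_right {ι : Type*} (s : Finset ι) (Q : Matrix (Fin m) (Fin m) ℝ)
    (v : ι → Fin m → ℝ) (w : Fin m → ℝ) :
    qInner Q w (∑ i ∈ s, v i) = ∑ i ∈ s, qInner Q w (v i) := by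
  simp [qInner, mulVec_sum, dotProduct_sum]

@[simp] lemma qInner_zero_left (Q : Matrix (Fin m) (Fin m) ℝ) (v : Fin m → ℝ) :
    qInner Q 0 v = 0 := by simp [qInner]

@[simp] lemma qInner_zero_right (Q : Matrix (Fin m) (Fin m) ℝ) (v : Fin m → ℝ) :
    qInner Q v 0 = 0 := by simp [qInner]

lemma qInner_one (v w : Fin m → ℝ) : qInner 1 v w = v ⬝ᵥ w := by simp [qInner]

lemma transpose_eq (hQ : Q.PosDef) : Qᵀ = Q := by
  have := hQ.isHermitian.eq
  rwa [conjTranspose_eq_transpose_of_trivial] at this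

lemma vecMul_eq_mulVec (hQ : Q.PosDef) (v : Fin m → ℝ) : v ᵥ* Q = Q *ᵥ v := by
  rw [← mulVec_transpose, transpose_eq hQ]

lemma qInner_comm (hQ : Q.PosDef) (v w : Fin m → ℝ) : qInner Q v w = qInner Q w v := by
  rw [qInner, dotProduct_mulVec, vecMul_eq_mulVec hQ, dotProduct_comm, qInner]

lemma qInner_self_pos (hQ : Q.PosDef) {v : Fin m → ℝ} (hv : v ≠ 0) : 0 < qInner Q v v := by
  simpa [qInner] using hQ.dotProduct_mulVec_pos hv

lemma qInner_self_nonneg (hQ : Q.PosDef) (v : Fin m → ℝ) : 0 ≤ qInner Q v v := by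
  rcases eq_or_ne v 0 with rfl | h
  · simp
  · exact (qInner_self_pos hQ h).le

lemma qNorm_nonneg (Q : Matrix (Fin m) (Fin m) ℝ) (v : Fin m → ℝ) : 0 ≤ qNorm Q v :=
  Real.sqrt_nonneg _

@[simp] lemma qNorm_zero (Q : Matrix (Fin m) (Fin m) ℝ) : qNorm Q 0 = 0 := by simp [qNorm]

lemma qNorm_sq (hQ : Q.PosDef) (v : Fin m → ℝ) : qNorm Q v ^ 2 = qInner Q v v :=
  Real.sq_sqrt (qInner_self_nonneg hQ v)

lemma qNorm_pos (hQ : Q.PosDef) {v : Fin m → ℝ} (hv : v ≠ 0) : 0 < qNorm Q v :=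
  Real.sqrt_pos.2 (qInner_self_pos hQ hv)

lemma abs_qInner_le (hQ : Q.PosDef) (v w : Fin m → ℝ) :
    |qInner Q v w| ≤ qNorm Q v * qNorm Q w := by
  apply abs_le_of_sq_le_sq _ (mul_nonneg (qNorm_nonneg _ _) (qNorm_nonneg _ _))
  rw [mul_pow, qNorm_sq hQ, qNorm_sq hQ]
  rcases eq_or_ne w 0 with rfl | hw
  · simp
  have hp := qInner_self_pos hQ hw
  have h := qInner_self_nonneg hQ (qInner Q w w • v + (-qInner Q v w) • w)
  simp only [qInner_add_left, qInner_add_right, qInner_smul_left, qInner_smul_right] at h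
  rw [qInner_comm hQ w v] at h
  have h2 : 0 ≤ qInner Q w w * (qInner Q v v * qInner Q w w - qInner Q v w ^ 2) := by
    linarith
  have := nonneg_of_mul_nonneg_right h2 hp
  linarith

lemma qNorm_add_le (hQ : Q.PosDef) (v w : Fin m → ℝ) :
    qNorm Q (v + w) ≤ qNorm Q v + qNorm Q w := by
  apply le_of_sq_le_sq _ (add_nonneg (qNorm_nonneg _ _) (qNorm_nonneg _ _))
  rw [add_sq, qNorm_sq hQ, qNorm_sq hQ, qNorm_sq hQ]
  simp only [qInner_add_left, qInner_add_right]
  rw [qInner_comm hQ w v]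
  have := (abs_le.1 (abs_qInner_le hQ v w)).2
  linarith

lemma qNorm_smul (Q : Matrix (Fin m) (Fin m) ℝ) (c : ℝ) (v : Fin m → ℝ) :
    qNorm Q (c • v) = |c| * qNorm Q v := by
  rw [qNorm, qInner_smul_left, qInner_smul_right, ← mul_assoc,
    Real.sqrt_mul (mul_self_nonneg c), Real.sqrt_mul_self_eq_abs, qNorm]

lemma qNorm_sum_le {ι : Type*} (hQ : Q.PosDef) (s : Finset ι) (v : ι → Fin m → ℝ) :
    qNorm Q (∑ i ∈ s, v i) ≤ ∑ i ∈ s, qNorm Q (v i) := by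
  classical
  induction s using Finset.induction_on with
  | empty => simp
  | insert i s hi ih =>
    rw [Finset.sum_insert hi, Finset.sum_insert hi]
    exact (qNorm_add_le hQ _ _).trans (by gcongr)

end QForm

/-! # Gram determinants -/

section Gram

variable {m : ℕ} {Q : Matrix (Fin m) (Fin m) ℝ} {ι : Type*}

/-- The Gram matrix of a family of vectors. -/
noncomputable def gramMat (Q : Matrix (Fin m) (Fin m) ℝ) (v : ι → Fin m → ℝ) : Matrix ι ι ℝ :=
  Matrix.of fun i j => qInner Q (v i) (v j)

lemma gramMat_apply (v : ι → Fin m → ℝ) (i j : ι) : gramMat Q v i j = qInner Q (v i) (v j) := rfl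

lemma gramMat_eq (v : ι → Fin m → ℝ) : gramMat Q v = Matrix.of v * Q * (Matrix.of v)ᵀ := by
  ext i j
  rw [gramMat_apply, qInner, Matrix.mul_assoc, Matrix.mul_apply]
  simp only [dotProduct, mulVec, Matrix.mul_apply, of_apply, transpose_apply]

variable [Fintype ι]

lemma gramMat_posDef (hQ : Q.PosDef) {v : ι → Fin m → ℝ} (hv : LinearIndependent ℝ v) :
    (gramMat Q v).PosDef := by
  rw [gramMat_eq, ← conjTranspose_eq_transpose_of_trivial]
  exact hQ.mul_mul_conjTranspose_same (vecMul_injective_iff.2 hv)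

lemma gramMat_mulVec (v : ι → Fin m → ℝ) (w : ι → ℝ) (i : ι) :
    (gramMat Q v *ᵥ w) i = qInner Q (v i) (∑ j, w j • v j) := by
  simp [mulVec, dotProduct, gramMat_apply, qInner_sum_right, qInner_smul_right, mul_comm]

variable [DecidableEq ι]

/-- The determinant of the Gram matrix. -/
noncomputable def gramDet (Q : Matrix (Fin m) (Fin m) ℝ) (v : ι → Fin m → ℝ) : ℝ :=
  (gramMat Q v).det

lemma gramDet_pos (hQ : Q.PosDef) {v : ι → Fin m → ℝ} (hv : LinearIndependent ℝ v) :
    0 < gramDet Q v := (gramMat_posDef hQ hv).det_pos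

lemma gramDet_comp_equiv {κ : Type*} [Fintype κ] [DecidableEq κ] (e : κ ≃ ι)
    (v : ι → Fin m → ℝ) : gramDet Q (v ∘ e) = gramDet Q v :=
  det_submatrix_equiv_self e (gramMat Q v)

/-- By the Schur complement the new determinant is `det G` times the squared distance of `e` from
the span of the `v i`, and this distance is a minimum over all `w`. -/
lemma gramDet_sumElim_le (hQ : Q.PosDef) {v : ι → Fin m → ℝ} (hv : LinearIndependent ℝ v)
    (e : Fin m → ℝ) (w : ι → ℝ) :
    gramDet Q (Sum.elim v fun _ : Unit => e) ≤
      gramDet Q v * qInner Q (e + ∑ i, w i • v i) (e + ∑ i, w i • v i) := by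
  have hG := gramMat_posDef hQ hv
  set G := gramMat Q v with hGdef
  have hu : IsUnit G.det := hG.det_pos.ne'.isUnit
  let := G.invertibleOfIsUnitDet hu
  set g : ι → ℝ := fun i => qInner Q (v i) e with hg
  have hblock : gramMat Q (Sum.elim v fun _ : Unit => e) =
      fromBlocks G (replicateCol Unit g) (replicateRow Unit g)
        (Matrix.of fun _ _ => qInner Q e e) := by
    ext (i | i) (j | j)
    · rfl
    · rfl
    · simp [gramMat_apply, hg, qInner_comm hQ e]
    · rfl
  have hGt : Gᵀ = G := by
    have := hG.isHermitian.eq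
    rwa [conjTranspose_eq_transpose_of_trivial] at this
  set h : ι → ℝ := G⁻¹ *ᵥ g with hh
  have hGh : G *ᵥ h = g := by
    rw [hh, mulVec_mulVec, mul_nonsing_inv _ hu, one_mulVec]
  have hdet : gramDet Q (Sum.elim v fun _ : Unit => e) = G.det * (qInner Q e e - g ⬝ᵥ h) := by
    rw [gramDet, hblock, det_fromBlocks₁₁, det_unique (n := Unit)]
    congr 1
    simp only [Matrix.sub_apply, of_apply]
    congr 1
    rw [Matrix.mul_assoc, invOf_eq_nonsing_inv, Matrix.mul_apply]
    simp only [replicateRow_apply, dotProduct, hh, mulVec, Matrix.mul_apply, replicateCol_apply]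
  rw [hdet, gramDet]
  refine mul_le_mul_of_nonneg_left ?_ hG.det_pos.le
  have hww : qInner Q (∑ i, w i • v i) (∑ i, w i • v i) = w ⬝ᵥ (G *ᵥ w) := by
    rw [qInner_sum_left]
    simp only [qInner_smul_left, dotProduct, hGdef, gramMat_mulVec]
  have hew : qInner Q (∑ i, w i • v i) e = w ⬝ᵥ g := by
    rw [qInner_sum_left]
    simp only [qInner_smul_left, dotProduct, hg]
  -- Completing the square: the minimum is attained at `-h`, and this form is the excess over it at
  -- `w`.
  have hpos : 0 ≤ (w + h) ⬝ᵥ (G *ᵥ (w + h)) := by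
    simpa using hG.posSemidef.dotProduct_mulVec_nonneg (w + h)
  have hsym : h ⬝ᵥ (G *ᵥ w) = w ⬝ᵥ g := by
    rw [dotProduct_mulVec, ← mulVec_transpose, hGt, hGh, dotProduct_comm]
  rw [mulVec_add, add_dotProduct, dotProduct_add, dotProduct_add, hGh, hsym] at hpos
  simp only [qInner_add_left, qInner_add_right]
  rw [qInner_comm hQ e (∑ i, w i • v i), hww, hew]
  rw [dotProduct_comm h g] at hpos
  linarith

end Gram

/-! ### Base times height, Hadamard's inequality and a form of Cramer's rule -/

section Minor

variable {m n : ℕ} {Q : Matrix (Fin m) (Fin m) ℝ} {u : Fin n → Fin m → ℝ}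

/-- The Gram determinant of the vectors with index in `B`. -/
noncomputable def minorDet (Q : Matrix (Fin m) (Fin m) ℝ) (u : Fin n → Fin m → ℝ)
    (B : Finset (Fin n)) : ℝ :=
  gramDet Q fun b : B => u b

lemma minorDet_pos (hQ : Q.PosDef) {B : Finset (Fin n)}
    (hB : LinearIndepOn ℝ u (B : Set (Fin n))) : 0 < minorDet Q u B :=
  gramDet_pos hQ hB

/-- The height of `u j` over the span of `B` is at most the norm of `u j` plus any combination. The
choice `w = 0` leads to Hadamard's inequality, another choice to the bound on coefficients. -/
lemma minorDet_insert_le (hQ : Q.PosDef) {B : Finset (Fin n)} {j : Fin n} (hj : j ∉ B)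
    (hB : LinearIndepOn ℝ u (B : Set (Fin n))) (w : Fin n → ℝ) :
    minorDet Q u (insert j B) ≤
      minorDet Q u B * qNorm Q (u j + ∑ i ∈ B, w i • u i) ^ 2 := by
  have h := gramDet_sumElim_le hQ (v := fun b : B => u b) hB (u j) (fun b : B => w b)
  rw [qNorm_sq hQ, minorDet, minorDet]
  rw [← Finset.sum_coe_sort B (fun i => w i • u i)]
  refine le_trans (le_of_eq ?_) h
  rw [← gramDet_comp_equiv ((Finset.subtypeInsertEquivOption hj).trans
    (Equiv.optionEquivSumPUnit.{0} _))]
  congr 1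
  funext ⟨i, hi⟩
  by_cases hij : i = j
  · subst hij
    simp [Finset.subtypeInsertEquivOption]
  · simp [Finset.subtypeInsertEquivOption, hij]

lemma minorDet_empty (Q : Matrix (Fin m) (Fin m) ℝ) (u : Fin n → Fin m → ℝ) :
    minorDet Q u ∅ = 1 := det_isEmpty

/-- Hadamard's inequality relative to `C`. For nonempty `C` it compares the volume of a basis with
the volume of the part that survives a deletion. -/
lemma minorDet_union_le (hQ : Q.PosDef) (C E : Finset (Fin n)) (hd : Disjoint C E)
    (hB : LinearIndepOn ℝ u ((C ∪ E : Finset (Fin n)) : Set (Fin n))) :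
    minorDet Q u (C ∪ E) ≤ minorDet Q u C * ∏ j ∈ E, qNorm Q (u j) ^ 2 := by
  induction E using Finset.induction_on with
  | empty => simp
  | insert j E hj ih =>
    rw [Finset.disjoint_insert_right] at hd
    rw [Finset.union_insert] at hB ⊢
    have hB' : LinearIndepOn ℝ u ((C ∪ E : Finset (Fin n)) : Set (Fin n)) :=
      hB.mono (by simp)
    have h1 := minorDet_insert_le hQ (j := j) (B := C ∪ E) (by simp [hd.1, hj]) hB' 0
    simp only [Pi.zero_apply, zero_smul, Finset.sum_const_zero, add_zero] at h1
    rw [Finset.prod_insert hj]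
    calc _ ≤ _ := h1
      _ ≤ (minorDet Q u C * ∏ j ∈ E, qNorm Q (u j) ^ 2) * qNorm Q (u j) ^ 2 := by
        gcongr
        exact ih hd.2 hB'
      _ = _ := by ring

lemma minorDet_le_prod (hQ : Q.PosDef) (B : Finset (Fin n))
    (hB : LinearIndepOn ℝ u (B : Set (Fin n))) :
    minorDet Q u B ≤ ∏ j ∈ B, qNorm Q (u j) ^ 2 := by
  have := minorDet_union_le (u := u) hQ ∅ B (by simp) (by simpa using hB)
  simpa [minorDet_empty] using this

/-- A coefficient of a combination of independent vectors of norm at most `1` is bounded by the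
norm of the combination, in terms of the Gram determinant. -/
lemma sq_coeff_mul_minorDet_le (hQ : Q.PosDef) {B : Finset (Fin n)}
    (hB : LinearIndepOn ℝ u (B : Set (Fin n))) (hu : ∀ j ∈ B, qNorm Q (u j) ≤ 1)
    (w : Fin n → ℝ) {j : Fin n} (hj : j ∈ B) :
    w j ^ 2 * minorDet Q u B ≤ qNorm Q (∑ i ∈ B, w i • u i) ^ 2 := by
  rcases eq_or_ne (w j) 0 with h0 | h0
  · simp [h0, sq_nonneg]
  have hC : LinearIndepOn ℝ u ((B.erase j : Finset (Fin n)) : Set (Fin n)) := hB.mono (by simp)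
  -- Dividing the combination by `w j` leaves `u j` plus a combination of the other vectors. This
  -- bounds the height of `u j` over them, while their volume is at most 1 by Hadamard.
  have h1 := minorDet_insert_le hQ (Finset.notMem_erase j B) hC (fun i => (w j)⁻¹ * w i)
  rw [Finset.insert_erase hj] at h1
  have h2 : minorDet Q u (B.erase j) ≤ 1 := by
    refine (minorDet_le_prod hQ _ hC).trans (Finset.prod_le_one (fun _ _ => sq_nonneg _) ?_)
    intro i hi
    exact pow_le_one₀ (qNorm_nonneg _ _) (hu i (Finset.mem_of_mem_erase hi))
  have h3 : u j + ∑ i ∈ B.erase j, ((w j)⁻¹ * w i) • u i = (w j)⁻¹ • ∑ i ∈ B, w i • u i := by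
    rw [← Finset.add_sum_erase B _ hj, smul_add, smul_smul, inv_mul_cancel₀ h0, one_smul,
      Finset.smul_sum]
    simp only [smul_smul]
  rw [h3, qNorm_smul, mul_pow, sq_abs] at h1
  have h4 : minorDet Q u B ≤ (w j)⁻¹ ^ 2 * qNorm Q (∑ i ∈ B, w i • u i) ^ 2 :=
    h1.trans (mul_le_of_le_one_left (by positivity) h2)
  have h5 : 0 < w j ^ 2 := by positivity
  calc w j ^ 2 * minorDet Q u B ≤ w j ^ 2 * ((w j)⁻¹ ^ 2 *
      qNorm Q (∑ i ∈ B, w i • u i) ^ 2) := by gcongr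
    _ = _ := by field_simp

end Minor

/-! # Rescaling -/

section Rescale

variable {m : ℕ} {Q : Matrix (Fin m) (Fin m) ℝ}

lemma eps_nonneg (m : ℕ) : 0 ≤ eps m := by unfold eps; positivity

lemma qInner_rescaledQ (hQ : Q.PosDef) (y v w : Fin m → ℝ) :
    qInner (rescaledQ Q y) v w = 1 / (1 + 3 * eps m) ^ 2 *
      (qInner Q v w + 3 / qNorm Q y ^ 2 * (qInner Q v y * qInner Q w y)) := by
  have h : (vecMulVec (Q *ᵥ y) (y ᵥ* Q)) *ᵥ w = qInner Q w y • (Q *ᵥ y) := by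
    rw [vecMulVec_mulVec, op_smul_eq_smul, vecMul_eq_mulVec hQ, dotProduct_comm]
    rfl
  rw [qInner, rescaledQ, smul_mulVec, add_mulVec, smul_mulVec, h]
  simp only [dotProduct_smul, dotProduct_add, smul_eq_mul, qInner]
  ring

lemma rescaledQ_posDef (hQ : Q.PosDef) (y : Fin m → ℝ) : (rescaledQ Q y).PosDef := by
  have he := eps_nonneg m
  refine PosDef.smul (PosDef.add_posSemidef hQ (PosSemidef.smul ?_ (by positivity))) (by positivity)
  rw [vecMul_eq_mulVec hQ]
  simpa using posSemidef_vecMulVec_self_star (Q *ᵥ y)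

/-- The rank one term is positive semidefinite, so only the division by 1+3ε can shrink a vector.
Iterated, this compares the Euclidean norm with the current `Q`-norm. -/
lemma qNorm_sq_le_rescaledQ (hQ : Q.PosDef) (y v : Fin m → ℝ) :
    qNorm Q v ^ 2 ≤ (1 + 3 * eps m) ^ 2 * qNorm (rescaledQ Q y) v ^ 2 := by
  have he := eps_nonneg m
  rw [qNorm_sq (rescaledQ_posDef hQ y), qNorm_sq hQ, qInner_rescaledQ hQ, ← mul_assoc,
    mul_one_div_cancel (by positivity), one_mul]
  have : 0 ≤ 3 / qNorm Q y ^ 2 * (qInner Q v y * qInner Q v y) :=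
    mul_nonneg (by positivity) (mul_self_nonneg _)
  linarith

lemma qNorm_rescaledQ_self (hQ : Q.PosDef) {y : Fin m → ℝ} :
    qNorm (rescaledQ Q y) y ^ 2 ≤ 4 * qNorm Q y ^ 2 := by
  have he := eps_nonneg m
  rw [qNorm_sq (rescaledQ_posDef hQ y), qInner_rescaledQ hQ, ← qNorm_sq hQ y]
  have h1 : 1 / (1 + 3 * eps m) ^ 2 ≤ 1 := by
    rw [div_le_one (by positivity)]
    nlinarith
  have h2 : 3 / qNorm Q y ^ 2 * (qNorm Q y ^ 2 * qNorm Q y ^ 2) ≤ 3 * qNorm Q y ^ 2 := by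
    rcases eq_or_ne (qNorm Q y) 0 with h | h
    · simp [h]
    · apply le_of_eq; field_simp
  calc _ ≤ 1 * (qNorm Q y ^ 2 + 3 * qNorm Q y ^ 2) := by
        gcongr
    _ = _ := by ring

/-- The vectors forming an angle of cosine at least `-ε` with `y` do not become much longer. -/
lemma qNorm_rescaledQ_le (hQ : Q.PosDef) {y v : Fin m → ℝ} (hy : y ≠ 0)
    (hv : -eps m * qNorm Q v * qNorm Q y ≤ qInner Q v y) :
    (1 + 3 * eps m) * qNorm (rescaledQ Q y) v ≤
      (1 + 2 * eps m) * qNorm Q v + qInner Q v y / qNorm Q y := by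
  have he := eps_nonneg m
  have hy' := qNorm_pos hQ hy
  have hs := qNorm_nonneg Q v
  set t := qInner Q v y / qNorm Q y with ht
  have hts : |t| ≤ qNorm Q v := by
    rw [ht, abs_div, abs_of_pos hy', div_le_iff₀ hy']
    exact abs_qInner_le hQ v y
  have htl : -eps m * qNorm Q v ≤ t := by
    rw [ht, le_div_iff₀ hy']
    exact hv
  -- Only a negative `t` matters, and then |t| = -t is at most ε‖v‖_Q.
  have h1 : |t| ≤ t + 2 * eps m * qNorm Q v := by
    have : 0 ≤ eps m * qNorm Q v := by positivity
    rw [abs_le]; constructor <;> linarith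
  -- The square of the left side is ‖v‖² + 3t², which is at most (‖v‖ + |t|)² because |t| ≤ ‖v‖.
  have h2 : (1 + 3 * eps m) * qNorm (rescaledQ Q y) v ≤ qNorm Q v + |t| := by
    apply le_of_sq_le_sq _ (by positivity)
    rw [mul_pow, qNorm_sq (rescaledQ_posDef hQ y), qInner_rescaledQ hQ, ← mul_assoc,
      mul_one_div_cancel (by positivity), one_mul, ← qNorm_sq hQ v]
    have : 3 / qNorm Q y ^ 2 * (qInner Q v y * qInner Q v y) = 3 * |t| ^ 2 := by
      rw [sq_abs, ht]; field_simp
    rw [this]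
    nlinarith [abs_nonneg t]
  linarith

/-- By Cauchy–Schwarz the rank one term adds at most 3‖v‖². No angle condition is needed, so this
also bounds columns that cross the threshold during the rescaling. -/
lemma qNorm_rescaledQ_le_two_mul (hQ : Q.PosDef) (y v : Fin m → ℝ) :
    qNorm (rescaledQ Q y) v ≤ 2 * qNorm Q v := by
  have he := eps_nonneg m
  apply le_of_sq_le_sq _ (mul_nonneg zero_le_two (qNorm_nonneg _ _))
  rw [mul_pow, qNorm_sq (rescaledQ_posDef hQ y), qInner_rescaledQ hQ, ← qNorm_sq hQ v]
  have h1 : 1 / (1 + 3 * eps m) ^ 2 ≤ 1 := by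
    rw [div_le_one (by positivity)]
    nlinarith
  have h2 : 3 / qNorm Q y ^ 2 * (qInner Q v y * qInner Q v y) ≤ 3 * qNorm Q v ^ 2 := by
    rcases eq_or_ne (qNorm Q y) 0 with h | h
    · simp [h]; positivity
    · have h3 : qInner Q v y * qInner Q v y ≤ (qNorm Q v * qNorm Q y) ^ 2 := by
        rw [← sq, ← sq_abs]
        exact pow_le_pow_left₀ (abs_nonneg _) (abs_qInner_le hQ v y) 2
      calc _ ≤ 3 / qNorm Q y ^ 2 * (qNorm Q v * qNorm Q y) ^ 2 := by gcongr
        _ = _ := by field_simp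
  have h3 : 0 ≤ 3 / qNorm Q y ^ 2 * (qInner Q v y * qInner Q v y) :=
    mul_nonneg (by positivity) (mul_self_nonneg _)
  calc _ ≤ 1 * (qNorm Q v ^ 2 + 3 * qNorm Q v ^ 2) := by gcongr
    _ = _ := by ring

/-- The matrix determinant lemma: up to scaling, the Gram matrix G is perturbed by 3‖y‖⁻² z zᵀ with
z = G w. Since zᵀG⁻¹z = zᵀw = ‖y‖_Q², the factor is 1 + 3 = 4. -/
lemma gramDet_rescaledQ {ι : Type*} [Fintype ι] [DecidableEq ι] (hQ : Q.PosDef)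
    {v : ι → Fin m → ℝ} (hv : LinearIndependent ℝ v) {y : Fin m → ℝ} (hy : y ≠ 0) (w : ι → ℝ)
    (hw : y = ∑ i, w i • v i) :
    gramDet (rescaledQ Q y) v =
      (1 / (1 + 3 * eps m) ^ 2) ^ Fintype.card ι * (gramDet Q v * 4) := by
  have hG := gramMat_posDef hQ hv
  set G := gramMat Q v with hGdef
  have hu : IsUnit G.det := hG.det_pos.ne'.isUnit
  set z : ι → ℝ := fun i => qInner Q (v i) y with hz
  have hGw : G *ᵥ w = z := by
    funext i
    rw [hGdef, gramMat_mulVec, ← hw]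
  have hmat : gramMat (rescaledQ Q y) v = (1 / (1 + 3 * eps m) ^ 2) •
      (G + replicateCol Unit ((3 / qNorm Q y ^ 2) • z) * replicateRow Unit z) := by
    ext i j
    rw [gramMat_apply, qInner_rescaledQ hQ]
    simp [hGdef, gramMat_apply, Matrix.mul_apply, hz]
  have hzw : z ⬝ᵥ w = qNorm Q y ^ 2 := by
    have : w ⬝ᵥ z = qInner Q (∑ i, w i • v i) y := by
      rw [qInner_sum_left]
      simp only [qInner_smul_left, dotProduct, hz]
    rw [dotProduct_comm, this, ← hw, qNorm_sq hQ]
  have hy' := qNorm_pos hQ hy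
  rw [gramDet, hmat, det_smul, det_add_replicateCol_mul_replicateRow hu]
  congr 2
  have h1 : G⁻¹ * replicateCol Unit ((3 / qNorm Q y ^ 2) • z) =
      replicateCol Unit ((3 / qNorm Q y ^ 2) • w) := by
    rw [← replicateCol_mulVec, mulVec_smul, ← hGw, mulVec_mulVec, nonsing_inv_mul _ hu,
      one_mulVec]
  rw [Matrix.mul_assoc, h1, det_unique]
  have h2 : (replicateRow Unit z * replicateCol Unit ((3 / qNorm Q y ^ 2) • w) :
      Matrix Unit Unit ℝ) default default = 3 / qNorm Q y ^ 2 * (z ⬝ᵥ w) := by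
    rw [← smul_eq_mul, ← dotProduct_smul]
    rfl
  rw [Matrix.add_apply, h2, hzw, one_apply_eq]
  field_simp
  norm_num

/-- The exponent in 1 + t ≤ exp t adds up to 6εm = 6/11 < log 2. -/
lemma one_add_eps_pow_le (hm : 1 ≤ m) : ((1 + 3 * eps m) ^ 2) ^ m ≤ 2 := by
  have hm' : (0 : ℝ) < m := by exact_mod_cast hm
  have he := eps_nonneg m
  have h1 : 1 + 3 * eps m ≤ Real.exp (3 * eps m) := by
    linarith [Real.add_one_le_exp (3 * eps m)]
  calc ((1 + 3 * eps m) ^ 2) ^ m ≤ (Real.exp (3 * eps m) ^ 2) ^ m := by gcongr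
    _ = Real.exp (6 / 11) := by
      rw [← pow_mul, ← Real.exp_nat_mul]
      congr 1
      unfold eps
      push_cast
      field_simp
      norm_num
    _ ≤ Real.exp (Real.log 2) := by
      apply Real.exp_le_exp.2
      linarith [Real.log_two_gt_d9]
    _ = 2 := Real.exp_log (by norm_num)

/-- The stretch along `y` gains a factor 4. The division by 1+3ε loses at most a factor 2, because
there are at most `m` independent vectors. -/
lemma two_mul_gramDet_le {ι : Type*} [Fintype ι] [DecidableEq ι] (hm : 1 ≤ m) (hQ : Q.PosDef)
    {v : ι → Fin m → ℝ} (hv : LinearIndependent ℝ v) {y : Fin m → ℝ} (hy : y ≠ 0)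
    (hyv : y ∈ Submodule.span ℝ (Set.range v)) :
    2 * gramDet Q v ≤ gramDet (rescaledQ Q y) v := by
  obtain ⟨w, hw⟩ := (Submodule.mem_span_range_iff_exists_fun ℝ).1 hyv
  rw [gramDet_rescaledQ hQ hv hy w hw.symm]
  have he := eps_nonneg m
  have hc : Fintype.card ι ≤ m := by
    simpa using hv.fintype_card_le_finrank
  have h1 : ((1 + 3 * eps m) ^ 2) ^ Fintype.card ι ≤ 2 :=
    (pow_le_pow_right₀ (by nlinarith) hc).trans (one_add_eps_pow_le hm)
  have h2 : 1 / 2 ≤ (1 / (1 + 3 * eps m) ^ 2) ^ Fintype.card ι := by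
    rw [div_pow, one_pow]
    exact one_div_le_one_div_of_le (by positivity) h1
  have h3 := gramDet_pos hQ hv
  calc 2 * gramDet Q v = 1 / 2 * (gramDet Q v * 4) := by ring
    _ ≤ _ := by gcongr

end Rescale

/-! # Columns, bases and the quantity `Δ` -/

section Columns

variable {m n : ℕ} (A : Matrix (Fin m) (Fin n) ℤ)

/-- The columns of `A` as real vectors. -/
def realCol (j : Fin n) : Fin m → ℝ := fun i => A i j

/-- The normalized columns. -/
noncomputable def unitCol (j : Fin n) : Fin m → ℝ := (unitCols A).col j

lemma colNorm_nonneg (j : Fin n) : 0 ≤ colNorm A j := Real.sqrt_nonneg _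

lemma colNorm_sq (j : Fin n) : colNorm A j ^ 2 = ∑ i, (A i j : ℝ) ^ 2 :=
  Real.sq_sqrt (Finset.sum_nonneg fun _ _ => sq_nonneg _)

lemma colNorm_sq_eq_qInner (j : Fin n) :
    colNorm A j ^ 2 = qInner 1 (realCol A j) (realCol A j) := by
  rw [colNorm_sq, qInner_one]
  simp [dotProduct, realCol, sq]

lemma colNorm_eq_zero_iff (j : Fin n) : colNorm A j = 0 ↔ realCol A j = 0 := by
  rw [← sq_eq_zero_iff, colNorm_sq_eq_qInner, qInner_one]
  exact dotProduct_self_eq_zero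

lemma unitCol_eq (j : Fin n) : unitCol A j = (colNorm A j)⁻¹ • realCol A j := by
  funext i
  simp [unitCol, unitCols, realCol, div_eq_inv_mul]

lemma colNorm_smul_unitCol (j : Fin n) : colNorm A j • unitCol A j = realCol A j := by
  rw [unitCol_eq]
  rcases eq_or_ne (colNorm A j) 0 with h | h
  · rw [h, (colNorm_eq_zero_iff A j).1 h]; simp
  · rw [smul_smul, mul_inv_cancel₀ h, one_smul]

lemma unitCol_eq_zero_iff (j : Fin n) : unitCol A j = 0 ↔ colNorm A j = 0 := by
  refine ⟨fun h => ?_, fun h => by rw [unitCol_eq, h]; simp⟩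
  rw [colNorm_eq_zero_iff, ← colNorm_smul_unitCol, h, smul_zero]

lemma qNorm_one_unitCol_le (j : Fin n) : qNorm 1 (unitCol A j) ≤ 1 := by
  apply le_of_sq_le_sq _ zero_le_one
  rw [qNorm_sq PosDef.one, unitCol_eq, qInner_smul_left, qInner_smul_right,
    ← colNorm_sq_eq_qInner]
  rcases eq_or_ne (colNorm A j) 0 with h | h
  · simp [h]
  · apply le_of_eq; field_simp

lemma unitCols_mulVec (x : Fin n → ℝ) : unitCols A *ᵥ x = ∑ j, x j • unitCol A j := by
  rw [mulVec_eq_sum]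
  exact Finset.sum_congr rfl fun j _ => by rw [op_smul_eq_smul]; rfl

lemma one_le_colNorm {j : Fin n} (hj : unitCol A j ≠ 0) : 1 ≤ colNorm A j := by
  have h0 : colNorm A j ≠ 0 := fun h => hj ((unitCol_eq_zero_iff A j).2 h)
  have h1 : (0 : ℝ) < (∑ i, A i j ^ 2 : ℤ) := by
    push_cast
    rw [← colNorm_sq]
    have := colNorm_nonneg A j
    positivity
  have h2 : (1 : ℝ) ≤ (∑ i, A i j ^ 2 : ℤ) := by exact_mod_cast h1
  push_cast at h2
  rw [← colNorm_sq] at h2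
  exact (one_le_sq_iff₀ (colNorm_nonneg A j)).1 h2

/-- The space spanned by the columns in `S`. -/
noncomputable def colSpan (S : Finset (Fin n)) : Submodule ℝ (Fin m → ℝ) :=
  Submodule.span ℝ (unitCol A '' S)

lemma colSpan_eq_real (S : Finset (Fin n)) :
    colSpan A S = Submodule.span ℝ (realCol A '' S) := by
  apply le_antisymm <;> rw [colSpan, Submodule.span_le] <;> rintro _ ⟨j, hj, rfl⟩
  · rw [unitCol_eq]
    exact Submodule.smul_mem _ _ (Submodule.subset_span ⟨j, hj, rfl⟩)
  · rw [← colNorm_smul_unitCol]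
    exact Submodule.smul_mem _ _ (Submodule.subset_span ⟨j, hj, rfl⟩)

lemma colRank_eq (S : Finset (Fin n)) : colRank A S = Module.finrank ℝ (colSpan A S) := by
  rw [colRank, rank_eq_finrank_span_cols, colSpan_eq_real]
  have : Set.range ((A.map (Int.cast : ℤ → ℝ)).submatrix id (Subtype.val : S → Fin n)).col =
      realCol A '' S := ?_
  · rw [this]
  ext v
  simp only [Set.mem_range, Set.mem_image]
  constructor
  · rintro ⟨⟨j, hj⟩, rfl⟩
    exact ⟨j, hj, rfl⟩
  · rintro ⟨j, hj, rfl⟩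
    exact ⟨⟨j, hj⟩, rfl⟩

lemma colSpan_mono {S T : Finset (Fin n)} (h : S ⊆ T) : colSpan A S ≤ colSpan A T :=
  Submodule.span_mono (Set.image_mono (by exact_mod_cast h))

lemma colRank_mono {S T : Finset (Fin n)} (h : S ⊆ T) : colRank A S ≤ colRank A T := by
  rw [colRank_eq, colRank_eq]
  exact Submodule.finrank_mono (colSpan_mono A h)

lemma colRank_le_rows (S : Finset (Fin n)) : colRank A S ≤ m := by
  rw [colRank_eq]
  exact (Submodule.finrank_le _).trans (by simp)

lemma colRank_le_card (S : Finset (Fin n)) : colRank A S ≤ S.card := by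
  have h := finrank_range_le_card (R := ℝ) fun j : S => unitCol A j
  rw [Fintype.card_coe, Set.finrank] at h
  rw [colRank_eq, colSpan, Set.image_eq_range]
  exact h

lemma colRank_eq_card {B : Finset (Fin n)} (hB : LinearIndepOn ℝ (unitCol A) (B : Set (Fin n))) :
    B.card = colRank A B := by
  have h := finrank_span_eq_card (R := ℝ) hB
  rw [colRank_eq, colSpan, Set.image_eq_range]
  exact (Fintype.card_coe B).symm.trans h.symm

lemma linearIndepOn_iff_card {B : Finset (Fin n)} :
    B.card = colRank A B ↔ LinearIndepOn ℝ (unitCol A) (B : Set (Fin n)) := by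
  refine ⟨fun h => ?_, colRank_eq_card A⟩
  have h2 := linearIndependent_iff_card_eq_finrank_span (R := ℝ)
    (b := fun j : (B : Set (Fin n)) => unitCol A j)
  refine h2.2 ?_
  rw [Set.finrank, ← Set.image_eq_range]
  rw [colRank_eq, colSpan] at h
  exact (Fintype.card_coe B).trans h

lemma exists_basis {C S : Finset (Fin n)} (hCS : C ⊆ S)
    (hC : LinearIndepOn ℝ (unitCol A) (C : Set (Fin n))) :
    ∃ B : Finset (Fin n), C ⊆ B ∧ B ⊆ S ∧ LinearIndepOn ℝ (unitCol A) (B : Set (Fin n)) ∧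
      colSpan A B = colSpan A S := by
  classical
  have hCS' : (C : Set (Fin n)) ⊆ S := by exact_mod_cast hCS
  refine ⟨(hC.extend hCS').toFinset, ?_, ?_, ?_, ?_⟩
  · intro j hj
    rw [Set.mem_toFinset]
    exact hC.subset_extend hCS' hj
  · intro j hj
    rw [Set.mem_toFinset] at hj
    exact hC.extend_subset hCS' hj
  · simpa using hC.linearIndepOn_extend hCS'
  · rw [colSpan, colSpan, Set.coe_toFinset, hC.span_image_extend_eq_span_image hCS']

lemma delta_set_finite : {r : ℝ | ∃ B : Finset (Fin n), B.card = colRank A B ∧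
    r = ∏ j ∈ B, colNorm A j}.Finite :=
  (Set.finite_range fun B : Finset (Fin n) => ∏ j ∈ B, colNorm A j).subset
    fun _ ⟨B, _, hB⟩ => ⟨B, hB.symm⟩

lemma prod_le_delta {B : Finset (Fin n)} (hB : LinearIndepOn ℝ (unitCol A) (B : Set (Fin n))) :
    ∏ j ∈ B, colNorm A j ≤ delta A :=
  le_csSup (delta_set_finite A).bddAbove ⟨B, colRank_eq_card A hB, rfl⟩

lemma one_le_delta : 1 ≤ delta A := by
  simpa using prod_le_delta A (B := ∅) (by simp)

lemma exists_delta_eq : ∃ B : Finset (Fin n), LinearIndepOn ℝ (unitCol A) (B : Set (Fin n)) ∧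
    delta A = ∏ j ∈ B, colNorm A j := by
  obtain ⟨B, hB, h⟩ := Set.Nonempty.csSup_mem
    (s := {r : ℝ | ∃ B : Finset (Fin n), B.card = colRank A B ∧ r = ∏ j ∈ B, colNorm A j})
    ⟨_, ∅, colRank_eq_card A (by simp), rfl⟩ (delta_set_finite A)
  exact ⟨B, (linearIndepOn_iff_card A).1 hB, h⟩

/-- The Gram determinant of independent normalized columns is at least `Δ⁻²`. -/
lemma one_le_delta_sq_mul_minorDet {B : Finset (Fin n)}
    (hB : LinearIndepOn ℝ (unitCol A) (B : Set (Fin n))) :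
    1 ≤ delta A ^ 2 * minorDet 1 (unitCol A) B := by
  have hpos := minorDet_pos (Q := 1) PosDef.one hB
  have hprod : (0 : ℝ) < ∏ j ∈ B, colNorm A j := by
    refine Finset.prod_pos fun j hj => ?_
    have : unitCol A j ≠ 0 := hB.ne_zero (i := j) hj
    linarith [one_le_colNorm A this]
  have h1 : (∏ j ∈ B, colNorm A j) ^ 2 * minorDet 1 (unitCol A) B =
      gramDet 1 fun j : B => realCol A j := by
    have : gramMat 1 (fun j : B => realCol A j) = Matrix.of fun i j : B => colNorm A i *
        Matrix.of (fun i j : B => colNorm A j * gramMat 1 (fun j : B => unitCol A j) i j) i j := by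
      ext i j
      rw [gramMat_apply, ← colNorm_smul_unitCol, ← colNorm_smul_unitCol, qInner_smul_left,
        qInner_smul_right]
      rfl
    rw [gramDet, this, det_mul_column, det_mul_row, minorDet, gramDet,
      Finset.prod_coe_sort B (fun j => colNorm A j)]
    ring
  -- The Gram determinant of the integer columns is an integer; being positive, it is at least 1.
  have h2 : gramDet 1 (fun j : B => realCol A j) =
      (((Matrix.of fun i j : B => ∑ k, A k i * A k j).det : ℤ) : ℝ) := by
    rw [gramDet, ← eq_intCast (Int.castRingHom ℝ), RingHom.map_det]
    congr 1
    ext i j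
    simp [gramMat_apply, qInner_one, dotProduct, realCol]
  have h3 : (1 : ℝ) ≤ gramDet 1 fun j : B => realCol A j := by
    have : (0 : ℝ) < gramDet 1 fun j : B => realCol A j := by
      rw [← h1]; positivity
    rw [h2] at this ⊢
    exact_mod_cast this
  calc (1 : ℝ) ≤ _ := h3
    _ = (∏ j ∈ B, colNorm A j) ^ 2 * minorDet 1 (unitCol A) B := h1.symm
    _ ≤ _ := by gcongr; exact prod_le_delta A hB

/-- Coefficients with respect to independent normalized columns are bounded by `Δ`. -/
lemma abs_coeff_le {B : Finset (Fin n)} (hB : LinearIndepOn ℝ (unitCol A) (B : Set (Fin n)))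
    (w : Fin n → ℝ) {j : Fin n} (hj : j ∈ B) :
    |w j| ≤ delta A * qNorm 1 (∑ i ∈ B, w i • unitCol A i) := by
  have h := sq_coeff_mul_minorDet_le (Q := 1) PosDef.one hB
    (fun j _ => qNorm_one_unitCol_le A j) w hj
  have h2 := one_le_delta_sq_mul_minorDet A hB
  have hd := one_le_delta A
  apply abs_le_of_sq_le_sq _ (mul_nonneg (by linarith) (qNorm_nonneg _ _))
  rw [mul_pow]
  calc w j ^ 2 ≤ w j ^ 2 * (delta A ^ 2 * minorDet 1 (unitCol A) B) :=
        le_mul_of_one_le_right (sq_nonneg _) h2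
    _ = delta A ^ 2 * (w j ^ 2 * minorDet 1 (unitCol A) B) := by ring
    _ ≤ _ := by gcongr

/-! # The encoding length -/

lemma mul_le_encodingLength : m * n ≤ encodingLength A := by
  calc m * n = ∑ _i : Fin m, ∑ _j : Fin n, 1 := by simp
    _ ≤ _ := Finset.sum_le_sum fun _ _ => Finset.sum_le_sum fun _ _ => by omega

lemma sum_le_prod_one_add {ι : Type*} (s : Finset ι) (f : ι → ℝ) (hf : ∀ i, 0 ≤ f i) :
    1 + ∑ i ∈ s, f i ≤ ∏ i ∈ s, (1 + f i) := by
  classical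
  induction s using Finset.induction_on with
  | empty => simp
  | insert i s hi ih =>
    rw [Finset.sum_insert hi, Finset.prod_insert hi]
    have h1 : 0 ≤ ∑ i ∈ s, f i := Finset.sum_nonneg fun _ _ => hf _
    nlinarith [hf i, mul_nonneg (hf i) h1, mul_le_mul_of_nonneg_left ih (hf i)]

/-- The Euclidean norm is at most the sum of absolute values, hence at most ∏ (1 + |a_ij|), and each
factor is at most 2 to the number of bits of its entry. -/
lemma colNorm_le_pow (j : Fin n) :
    colNorm A j ≤ 2 ^ ∑ i, (1 + Nat.clog 2 ((A i j).natAbs + 1)) := by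
  have h0 : ∀ i, (0 : ℝ) ≤ |(A i j : ℝ)| := fun _ => abs_nonneg _
  have h1 : colNorm A j ≤ ∑ i, |(A i j : ℝ)| := by
    apply le_of_sq_le_sq _ (Finset.sum_nonneg fun _ _ => abs_nonneg _)
    rw [colNorm_sq]
    calc ∑ i, (A i j : ℝ) ^ 2 = ∑ i, |(A i j : ℝ)| ^ 2 := by simp
      _ ≤ _ := Finset.sum_sq_le_sq_sum_of_nonneg fun i _ => h0 i
  calc colNorm A j ≤ 1 + ∑ i, |(A i j : ℝ)| := by linarith
    _ ≤ ∏ i, (1 + |(A i j : ℝ)|) := sum_le_prod_one_add _ _ h0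
    _ ≤ ∏ i, (2 : ℝ) ^ (1 + Nat.clog 2 ((A i j).natAbs + 1)) := by
      refine Finset.prod_le_prod (fun i _ => by positivity) fun i _ => ?_
      have h2 : (A i j).natAbs + 1 ≤ 2 ^ Nat.clog 2 ((A i j).natAbs + 1) :=
        Nat.le_pow_clog (by norm_num) _
      have h3 : (((A i j).natAbs + 1 : ℕ) : ℝ) ≤ 2 ^ Nat.clog 2 ((A i j).natAbs + 1) := by
        exact_mod_cast h2
      have h4 : (((A i j).natAbs : ℕ) : ℝ) = |(A i j : ℝ)| := by
        rw [Nat.cast_natAbs, Int.cast_abs]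
      push_cast at h3
      rw [h4] at h3
      rw [pow_add]
      have : (0 : ℝ) < 2 ^ Nat.clog 2 ((A i j).natAbs + 1) := by positivity
      linarith
    _ = _ := Finset.prod_pow_eq_pow_sum _ _ _

lemma delta_le_pow : delta A ≤ 2 ^ encodingLength A := by
  obtain ⟨B, -, h⟩ := exists_delta_eq A
  rw [h, encodingLength, Finset.sum_comm]
  calc ∏ j ∈ B, colNorm A j ≤ ∏ j ∈ B, (2 : ℝ) ^ ∑ i, (1 + Nat.clog 2 ((A i j).natAbs + 1)) :=
        Finset.prod_le_prod (fun j _ => colNorm_nonneg A j) fun j _ => colNorm_le_pow A j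
    _ = 2 ^ ∑ j ∈ B, ∑ i, (1 + Nat.clog 2 ((A i j).natAbs + 1)) :=
        Finset.prod_pow_eq_pow_sum _ _ _
    _ ≤ _ := by
      apply pow_le_pow_right₀ one_le_two
      exact Finset.sum_le_sum_of_subset (Finset.subset_univ B)

lemma theta_inv_eq : (theta A)⁻¹ = (m : ℝ) ^ 2 * delta A ^ 2 := by
  rw [theta, one_div, inv_inv]

end Columns

/-! # Nonnegative relations between the columns -/

section Relations

variable {m n : ℕ} (A : Matrix (Fin m) (Fin n) ℤ)

/-- A nonnegative linear relation between the normalized columns. -/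
def IsRelation (c : Fin n → ℝ) : Prop := 0 ≤ c ∧ ∑ j, c j • unitCol A j = 0

/-- Induction on a bound `N` for the size of the support. A dependence among the support columns
other than `k` is subtracted until a coefficient vanishes. Keeping `k` out of the dependence
preserves `c k = 1`. -/
lemma exists_sparse_relation_aux {k : Fin n} (N : ℕ) : ∀ c : Fin n → ℝ, IsRelation A c →
    c k = 1 → (Finset.univ.filter fun j => c j ≠ 0).card ≤ N →
    ∃ c' : Fin n → ℝ, IsRelation A c' ∧ c' k = 1 ∧
      LinearIndepOn ℝ (unitCol A)
        ((Finset.univ.filter fun j => j ≠ k ∧ c' j ≠ 0 : Finset (Fin n)) : Set (Fin n)) := by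
  induction N with
  | zero =>
    intro c _ hk hN
    exfalso
    have : k ∈ Finset.univ.filter fun j => c j ≠ 0 := by simp [hk]
    rw [Finset.card_eq_zero.1 (Nat.le_zero.1 hN)] at this
    simp at this
  | succ N ih =>
    intro c hc hk hN
    set E := Finset.univ.filter fun j => j ≠ k ∧ c j ≠ 0 with hE
    by_cases hli : LinearIndepOn ℝ (unitCol A) (E : Set (Fin n))
    · exact ⟨c, hc, hk, hli⟩
    -- After a change of sign, if necessary, the dependence has a positive coefficient.
    obtain ⟨v, hv, i₁, hi₁, hne⟩ : ∃ v : Fin n → ℝ, ∑ i ∈ E, v i • unitCol A i = 0 ∧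
        ∃ i ∈ E, 0 < v i := by
      rw [linearIndepOn_finset_iff] at hli
      push Not at hli
      obtain ⟨v, hv, i, hi, hne⟩ := hli
      rcases lt_or_gt_of_ne hne with h | h
      · refine ⟨-v, ?_, i, hi, by simpa using h⟩
        simp [hv]
      · exact ⟨v, hv, i, hi, h⟩
    -- The ratio test: the largest multiple of `v` that can be subtracted without making a
    -- coefficient negative.
    obtain ⟨i₀, hi₀, hmin⟩ := (E.filter fun i => 0 < v i).exists_min_image (fun i => c i / v i)
      ⟨i₁, by simp [hi₁, hne]⟩
    rw [Finset.mem_filter] at hi₀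
    obtain ⟨hi₀E, hvi₀⟩ := hi₀
    set t := c i₀ / v i₀ with ht
    have ht0 : 0 ≤ t := div_nonneg (hc.1 i₀) hvi₀.le
    set c' : Fin n → ℝ := fun j => if j ∈ E then c j - t * v j else c j with hc'
    have hkE : k ∉ E := by simp [hE]
    have hzero : c' i₀ = 0 := by
      simp only [hc', hi₀E, if_true, ht]
      field_simp
      simp
    refine ih c' ⟨fun j => ?_, ?_⟩ (by simp [hc', hkE, hk]) ?_
    · simp only [hc', Pi.zero_apply]
      split_ifs with hj
      · rcases le_or_gt (v j) 0 with h | h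
        · nlinarith [hc.1 j, mul_nonneg ht0 (neg_nonneg.2 h), show (0 : ℝ) ≤ c j from hc.1 j]
        · have := hmin j (Finset.mem_filter.2 ⟨hj, h⟩)
          rw [le_div_iff₀ h] at this
          linarith
      · exact hc.1 j
    · have : ∀ j, c' j • unitCol A j =
          c j • unitCol A j - t • (if j ∈ E then v j • unitCol A j else 0) := by
        intro j
        simp only [hc']
        split_ifs
        · rw [sub_smul, mul_smul]
        · simp
      simp only [this]
      rw [Finset.sum_sub_distrib, hc.2, ← Finset.smul_sum, Finset.sum_ite_mem,
        Finset.univ_inter, hv]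
      simp
    · have hlt : (Finset.univ.filter fun j => c' j ≠ 0) ⊂ Finset.univ.filter fun j => c j ≠ 0 := by
        rw [Finset.ssubset_iff_of_subset]
        · refine ⟨i₀, ?_, by simp [hzero]⟩
          have := hi₀E
          simp only [hE, Finset.mem_filter] at this
          simp [this.2.2]
        · intro j hj
          simp only [Finset.mem_filter, Finset.mem_univ, true_and] at hj ⊢
          by_cases hjE : j ∈ E
          · simp only [hE, Finset.mem_filter] at hjE
            exact hjE.2.2
          · simpa [hc', hjE] using hj
      have := Finset.card_lt_card hlt
      omega

/-- Carathéodory's theorem for relations that involve a given column. -/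
lemma exists_sparse_relation {k : Fin n} {c : Fin n → ℝ} (hc : IsRelation A c) (hk : 0 < c k) :
    ∃ c' : Fin n → ℝ, IsRelation A c' ∧ c' k = 1 ∧
      LinearIndepOn ℝ (unitCol A)
        ((Finset.univ.filter fun j => j ≠ k ∧ c' j ≠ 0 : Finset (Fin n)) : Set (Fin n)) := by
  refine exists_sparse_relation_aux A _ ((c k)⁻¹ • c) ⟨?_, ?_⟩ ?_ le_rfl
  · exact smul_nonneg (inv_nonneg.2 hk.le) hc.1
  · simp only [Pi.smul_apply, smul_assoc]
    rw [← Finset.smul_sum, hc.2, smul_zero]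
  · simp [hk.ne']

variable {A}

/-- If the weighted length of no relation has increased, the columns that occur in relations
are short. -/
lemma qNorm_le_of_relation (hm : 1 ≤ m) {Q : Matrix (Fin m) (Fin m) ℝ} (hQ : Q.PosDef)
    (hlen : ∀ c, IsRelation A c → ∑ j, c j * qNorm Q (unitCol A j) ≤ ∑ j, c j)
    {k : Fin n} {c : Fin n → ℝ} (hc : IsRelation A c) (hk : 0 < c k) :
    qNorm Q (unitCol A k) ≤ (theta A)⁻¹ := by
  classical
  obtain ⟨c', hc', hk', hli⟩ := exists_sparse_relation A hc hk
  set E := Finset.univ.filter fun j => j ≠ k ∧ c' j ≠ 0 with hE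
  have hkE : k ∉ E := by simp [hE]
  have hsplit : ∀ (M : Type) [AddCommMonoid M] (f : Fin n → M), (∀ j, c' j = 0 → f j = 0) →
      ∑ j, f j = f k + ∑ j ∈ E, f j := by
    intro M _ f hf
    rw [← Finset.sum_insert hkE]
    refine (Finset.sum_subset (Finset.subset_univ _) fun j _ hj => hf j ?_).symm
    rw [Finset.mem_insert, not_or] at hj
    by_contra hne
    exact hj.2 (by simp [hE, hne, hj.1])
  have h1 := hlen c' hc'
  rw [hsplit ℝ (fun j => c' j * qNorm Q (unitCol A j)) (fun j h => by simp [h]),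
    hsplit ℝ c' fun _ h => h, hk', one_mul] at h1
  have h2 := hc'.2
  rw [hsplit _ (fun j => c' j • unitCol A j) (fun j h => by simp [h]), hk', one_smul] at h2
  have h3 : unitCol A k = (-1 : ℝ) • ∑ j ∈ E, c' j • unitCol A j := by
    rw [neg_smul, one_smul]
    exact eq_neg_of_add_eq_zero_left h2
  -- The columns in `E` contribute at least ‖â_k‖_Q to the weighted length, so with `h1` one gets
  -- 2‖â_k‖_Q ≤ 1 + ∑_E c'.
  have h4 : qNorm Q (unitCol A k) ≤ ∑ j ∈ E, c' j * qNorm Q (unitCol A j) := by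
    rw [h3, qNorm_smul, abs_neg, abs_one, one_mul]
    refine (qNorm_sum_le hQ _ _).trans (Finset.sum_le_sum fun j _ => ?_)
    rw [qNorm_smul, abs_of_nonneg (hc'.1 j)]
  have hd := one_le_delta A
  -- The coefficients on `E` are those of the vector -â_k, of Euclidean norm at most 1, with respect
  -- to independent columns.
  have h5 : ∀ j ∈ E, c' j ≤ delta A := by
    intro j hj
    have := abs_coeff_le A hli c' hj
    have h6 : qNorm 1 (∑ i ∈ E, c' i • unitCol A i) ≤ 1 := by
      have h7 := qNorm_one_unitCol_le A k
      rwa [h3, qNorm_smul, abs_neg, abs_one, one_mul] at h7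
    calc c' j ≤ |c' j| := le_abs_self _
      _ ≤ _ := this
      _ ≤ delta A * 1 := by gcongr
      _ = _ := mul_one _
  have h6 : ∑ j ∈ E, c' j ≤ m * delta A := by
    calc ∑ j ∈ E, c' j ≤ ∑ _j ∈ E, delta A := Finset.sum_le_sum h5
      _ = E.card * delta A := by simp
      _ ≤ _ := by
        gcongr
        rw [colRank_eq_card A hli]
        exact colRank_le_rows A E
  rw [theta_inv_eq]
  have hm' : (1 : ℝ) ≤ m := by exact_mod_cast hm
  -- From 2‖â_k‖_Q ≤ 1 + mΔ and mΔ ≥ 1 one obtains ‖â_k‖_Q ≤ mΔ ≤ (mΔ)² = θ⁻¹.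
  have h7 : 1 ≤ m * delta A := one_le_mul_of_one_le_of_one_le hm' hd
  nlinarith

/-- The weighted length of relations does not increase when the matrix is rescaled. -/
lemma sum_qNorm_rescaledQ_le {Q : Matrix (Fin m) (Fin m) ℝ} (hQ : Q.PosDef) {y : Fin m → ℝ}
    (hy : y ≠ 0) {c : Fin n → ℝ} (hc : IsRelation A c)
    (hflat : ∀ j, 0 < c j → -eps m * qNorm Q (unitCol A j) * qNorm Q y ≤ qInner Q (unitCol A j) y) :
    ∑ j, c j * qNorm (rescaledQ Q y) (unitCol A j) ≤ ∑ j, c j * qNorm Q (unitCol A j) := by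
  have he := eps_nonneg m
  have h1 : ∀ j, c j * ((1 + 3 * eps m) * qNorm (rescaledQ Q y) (unitCol A j)) ≤
      c j * ((1 + 2 * eps m) * qNorm Q (unitCol A j) +
        qInner Q (unitCol A j) y / qNorm Q y) := by
    intro j
    rcases (hc.1 j).eq_or_lt with h | h
    · simp only [Pi.zero_apply] at h
      simp [← h]
    · exact mul_le_mul_of_nonneg_left (qNorm_rescaledQ_le hQ hy (hflat j h)) h.le
  have h2 := Finset.sum_le_sum fun j (_ : j ∈ Finset.univ) => h1 j
  -- The inner products with `y` cancel because the columns with weights `c` sum to zero.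
  have h3 : ∑ j, c j * (qInner Q (unitCol A j) y / qNorm Q y) = 0 := by
    simp only [← mul_div_assoc]
    rw [← Finset.sum_div]
    simp only [← qInner_smul_left]
    rw [← qInner_sum_left, hc.2]
    simp
  simp only [mul_add] at h2
  rw [Finset.sum_add_distrib, h3, add_zero] at h2
  have h4 : (1 + 3 * eps m) * ∑ j, c j * qNorm (rescaledQ Q y) (unitCol A j) ≤
      (1 + 2 * eps m) * ∑ j, c j * qNorm Q (unitCol A j) := by
    rw [Finset.mul_sum, Finset.mul_sum]
    simpa only [mul_left_comm] using h2
  have h5 : 0 ≤ ∑ j, c j * qNorm Q (unitCol A j) :=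
    Finset.sum_nonneg fun j _ => mul_nonneg (hc.1 j) (qNorm_nonneg _ _)
  have h6 : (1 + 3 * eps m) * ∑ j, c j * qNorm (rescaledQ Q y) (unitCol A j) ≤
      (1 + 3 * eps m) * ∑ j, c j * qNorm Q (unitCol A j) :=
    h4.trans (by gcongr; norm_num)
  exact le_of_mul_le_mul_left h6 (by positivity)

end Relations

/-! # The projection onto the kernel -/

section Projection

variable {m n : ℕ} {A : Matrix (Fin m) (Fin n) ℤ} {S : Finset (Fin n)}

lemma kernelProj_mem (x : Fin n → ℝ) :
    unitCols A *ᵥ kernelProj A S x = 0 ∧ ∀ j, j ∉ S → kernelProj A S x j = 0 :=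
  (kernelOn A S).starProjection_apply_mem (WithLp.toLp 2 x)

/-- The vector Âx is also Âw' for some w' supported on a basis, with coefficients at most Δ‖Âx‖
each. Then x - w' lies in the kernel, so the projection of x is at distance at most ‖w'‖ < 1 from x,
whose entries on `S` are at least 1. -/
lemma kernelProj_pos_of_qNorm_lt {x : Fin n → ℝ} (hx0 : ∀ j, j ∉ S → x j = 0)
    (hx1 : ∀ j ∈ S, 1 ≤ x j) (hlt : m * delta A * qNorm 1 (unitCols A *ᵥ x) < 1) :
    ∀ j ∈ S, 0 < kernelProj A S x j := by
  classical
  obtain ⟨B, -, hBS, hB, hspan⟩ := exists_basis A (Finset.empty_subset S) (by simp)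
  have hy : unitCols A *ᵥ x ∈ colSpan A B := by
    rw [hspan, unitCols_mulVec]
    refine Submodule.sum_mem _ fun j _ => ?_
    by_cases hj : j ∈ S
    · exact Submodule.smul_mem _ _ (Submodule.subset_span ⟨j, hj, rfl⟩)
    · rw [hx0 j hj, zero_smul]
      exact Submodule.zero_mem _
  obtain ⟨w, hw⟩ := Submodule.mem_span_image_finset_iff_exists_fun' ℝ |>.1 hy
  set w' : Fin n → ℝ := fun j => if j ∈ B then w j else 0 with hw'
  have hw'y : unitCols A *ᵥ w' = unitCols A *ᵥ x := by
    rw [← hw, unitCols_mulVec]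
    simp only [hw', ite_smul, zero_smul]
    rw [Finset.sum_ite_mem, Finset.univ_inter]
  have hmem : WithLp.toLp 2 (x - w') ∈ kernelOn A S := by
    refine ⟨?_, fun j hj => ?_⟩
    · change unitCols A *ᵥ (x - w') = 0
      rw [mulVec_sub, hw'y, sub_self]
    · change x j - w' j = 0
      have : j ∉ B := fun h => hj (hBS h)
      simp [hx0 j hj, hw', this]
  have hmin : ‖WithLp.toLp 2 x - (kernelOn A S).starProjection (WithLp.toLp 2 x)‖ ≤
      ‖WithLp.toLp 2 w'‖ := by
    rw [Submodule.starProjection_minimal]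
    refine (ciInf_le ⟨0, Set.forall_mem_range.mpr fun _ => norm_nonneg _⟩
      (⟨_, hmem⟩ : kernelOn A S)).trans (le_of_eq ?_)
    congr 1
    ext j
    simp
  have hsum : ‖WithLp.toLp 2 w'‖ ≤ ∑ j ∈ B, |w j| := by
    rw [EuclideanSpace.norm_eq]
    apply Real.sqrt_le_iff.2 ⟨Finset.sum_nonneg fun _ _ => abs_nonneg _, ?_⟩
    have : ∑ j ∈ B, |w j| ^ 2 = ∑ i, ‖(WithLp.toLp 2 w').ofLp i‖ ^ 2 := by
      rw [← Finset.univ_inter B, ← Finset.sum_ite_mem]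
      refine Finset.sum_congr rfl fun j _ => ?_
      simp only [hw', Real.norm_eq_abs]
      split_ifs <;> simp
    rw [← this]
    exact Finset.sum_sq_le_sq_sum_of_nonneg fun i _ => abs_nonneg _
  have hd := one_le_delta A
  have hbound : ∑ j ∈ B, |w j| ≤ m * delta A * qNorm 1 (unitCols A *ᵥ x) := by
    calc ∑ j ∈ B, |w j| ≤ ∑ _j ∈ B, delta A * qNorm 1 (unitCols A *ᵥ x) := by
          refine Finset.sum_le_sum fun j hj => ?_
          have := abs_coeff_le A hB w hj
          rwa [hw] at this
      _ = B.card * (delta A * qNorm 1 (unitCols A *ᵥ x)) := by simp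
      _ ≤ m * (delta A * qNorm 1 (unitCols A *ᵥ x)) := by
        have h1 := qNorm_nonneg 1 (unitCols A *ᵥ x)
        gcongr
        rw [colRank_eq_card A hB]
        exact colRank_le_rows A B
      _ = _ := by ring
  intro j hj
  have h1 : |x j - kernelProj A S x j| < 1 := by
    have h2 := PiLp.norm_apply_le
      (WithLp.toLp 2 x - (kernelOn A S).starProjection (WithLp.toLp 2 x)) j
    calc |x j - kernelProj A S x j| ≤ _ := h2
      _ < 1 := by linarith
  have := (abs_lt.1 h1).2
  linarith [hx1 j hj]

/-- The factor by which an entry of `x` is divided on output. -/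
noncomputable def colScale (A : Matrix (Fin m) (Fin n) ℤ) (j : Fin n) : ℝ :=
  if colNorm A j = 0 then 1 else colNorm A j

lemma colScale_pos (j : Fin n) : 0 < colScale A j := by
  unfold colScale
  split_ifs with h
  · exact one_pos
  · exact lt_of_le_of_ne (colNorm_nonneg A j) (Ne.symm h)

lemma colScale_smul_unitCol (j : Fin n) : colScale A j • unitCol A j = realCol A j := by
  unfold colScale
  split_ifs with h
  · rw [(colNorm_eq_zero_iff A j).1 h, (unitCol_eq_zero_iff A j).2 h, smul_zero]
  · exact colNorm_smul_unitCol A j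

lemma map_mulVec_eq (x : Fin n → ℝ) :
    A.map (Int.cast : ℤ → ℝ) *ᵥ x = ∑ j, (x j * colScale A j) • unitCol A j := by
  rw [mulVec_eq_sum]
  refine Finset.sum_congr rfl fun j _ => ?_
  rw [op_smul_eq_smul, mul_smul, colScale_smul_unitCol]
  rfl

/-- Multiplication of the entries by `colScale` turns nonnegative solutions into relations with the
same support. So `hS` says that `S` contains all their supports, and at the exit the returned vector
is positive on `S`. -/
lemma output_isMaxSupportSolution {s : State ℝ m n} (hd : Done A s)
    (hS : ∀ c, IsRelation A c → ∀ j, 0 < c j → j ∈ s.S) :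
    IsMaxSupportSolution A (output A s) := by
  have hout : ∀ j, output A s j * colScale A j = kernelProj A s.S s.x j := by
    intro j
    unfold output colScale
    split_ifs with h1 h2
    · simp
    · field_simp
    · rw [(kernelProj_mem s.x).2 j h1]; simp
    · rw [(kernelProj_mem s.x).2 j h1]; simp
  have hpos : ∀ j ∈ s.S, 0 < kernelProj A s.S s.x j := by
    rcases hd with h | h
    · intro j hj
      rw [h] at hj
      simp at hj
    · exact h
  have hout' : ∀ j, output A s j = kernelProj A s.S s.x j / colScale A j := fun j => by
    rw [← hout, mul_div_cancel_right₀ _ (colScale_pos j).ne']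
  refine ⟨?_, fun j => ?_, fun x' hx' hx'0 j hj => ?_⟩
  · rw [map_mulVec_eq]
    simp only [hout]
    rw [← unitCols_mulVec]
    exact (kernelProj_mem s.x).1
  · rw [hout']
    refine div_nonneg ?_ (colScale_pos j).le
    by_cases h : j ∈ s.S
    · exact (hpos j h).le
    · rw [(kernelProj_mem s.x).2 j h]
  · have hrel : IsRelation A fun j => x' j * colScale A j :=
      ⟨fun j => mul_nonneg (hx'0 j) (colScale_pos j).le, by rw [← map_mulVec_eq, hx']⟩
    have hjS := hS _ hrel j
      (mul_pos (lt_of_le_of_ne (hx'0 j) (Ne.symm hj)) (colScale_pos j))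
    rw [Function.mem_support, hout']
    exact (div_pos (hpos j hjS) (colScale_pos j)).ne'

end Projection

/-! # The invariant of the algorithm -/

section Invariant

variable {m n : ℕ} {A : Matrix (Fin m) (Fin n) ℤ}

lemma eps_lt_one (hm : 1 ≤ m) : eps m < 1 := by
  have : (1 : ℝ) ≤ m := by exact_mod_cast hm
  unfold eps
  rw [div_lt_one (by positivity)]
  linarith

lemma nat_le_two_pow_real {a L : ℕ} (h : a ≤ L) : (a : ℝ) ≤ 2 ^ L := by
  exact_mod_cast h.trans Nat.lt_two_pow_self.le

/-- The elementary consequences of `m, n ≥ 1` for the encoding length. -/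
structure Sizes (A : Matrix (Fin m) (Fin n) ℤ) : Prop where
  hm : 1 ≤ m
  hn : 1 ≤ n

namespace Sizes

variable (h : Sizes A)
include h

lemma rows_le : m ≤ encodingLength A :=
  (Nat.le_mul_of_pos_right m h.hn).trans (mul_le_encodingLength A)

lemma cols_le : n ≤ encodingLength A :=
  (Nat.le_mul_of_pos_left n h.hm).trans (mul_le_encodingLength A)

lemma one_le : 1 ≤ encodingLength A := h.hm.trans h.rows_le

lemma theta_inv_le : (theta A)⁻¹ ≤ 2 ^ (4 * encodingLength A) := by
  rw [theta_inv_eq]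
  have h1 := nat_le_two_pow_real h.rows_le
  have h2 := delta_le_pow A
  have h3 := one_le_delta A
  calc (m : ℝ) ^ 2 * delta A ^ 2 ≤ (2 ^ encodingLength A) ^ 2 * (2 ^ encodingLength A) ^ 2 := by
        gcongr
    _ = _ := by ring

lemma one_le_theta_inv : 1 ≤ (theta A)⁻¹ := by
  rw [theta_inv_eq]
  have h1 : (1 : ℝ) ≤ m := by exact_mod_cast h.hm
  exact one_le_mul_of_one_le_of_one_le (one_le_pow₀ h1) (one_le_pow₀ (one_le_delta A))

end Sizes

/-- The rank of `A`. -/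
noncomputable def fullRank (A : Matrix (Fin m) (Fin n) ℤ) : ℕ := colRank A Finset.univ

lemma colRank_le_fullRank (S : Finset (Fin n)) : colRank A S ≤ fullRank A :=
  colRank_mono A (Finset.subset_univ S)

/-- The bound on the number of updates. -/
noncomputable def dvBound (A : Matrix (Fin m) (Fin n) ℤ) : ℕ :=
  11132 * (m ^ 2 * fullRank A * encodingLength A)

/-- What holds after `D` updates and `N` rescalings, up to the detection of a rank drop. -/
structure PreInv (A : Matrix (Fin m) (Fin n) ℤ) (D N : ℕ) (s : State ℝ m n) : Prop where
  posDef : s.Q.PosDef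
  y_eq : s.y = unitCols A *ᵥ s.x
  x_off : ∀ j, j ∉ s.S → s.x j = 0
  x_on : ∀ j ∈ s.S, 1 ≤ s.x j
  short : ∀ j ∈ s.S \ s.T, qNorm s.Q (unitCol A j) ≤ (theta A)⁻¹
  length : ∀ c, IsRelation A c → ∑ j, c j * qNorm s.Q (unitCol A j) ≤ ∑ j, c j
  supp : ∀ c, IsRelation A c → ∀ j, 0 < c j → j ∈ s.S ∧ j ∉ s.T
  lower : ∀ v, qNorm 1 v ^ 2 ≤ ((1 + 3 * eps m) ^ 2) ^ N * qNorm s.Q v ^ 2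
  -- Each rescaling doubles the volume of every basis. Δ² pays for the initial volume, and 2^(10L)
  -- for each dimension lost by deletions.
  volume : ∀ B ⊆ s.S, LinearIndepOn ℝ (unitCol A) (B : Set (Fin n)) →
    colSpan A B = colSpan A s.S → (2 : ℝ) ^ N ≤
      delta A ^ 2 * (2 ^ (10 * encodingLength A)) ^ (fullRank A - colRank A s.S) *
        minorDet s.Q (unitCol A) B
  -- One factor 2^(26L) is granted at the start and one for each lost dimension; it pays for the
  -- restart of `y`. The counters `D` and `N` run through all rounds.
  potential : qNorm s.Q s.y ^ 2 ≤ (1 - eps m ^ 2) ^ D * 4 ^ N *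
    (2 ^ (26 * encodingLength A)) ^ (fullRank A - colRank A s.S + 1)
  -- In rank zero the bounds vanish, and indeed no iteration takes place. The `+ 1` is needed
  -- because the bound on updates is available only in states that are not done.
  count : (D = 0 ∧ N = 0) ∨ (1 ≤ fullRank A ∧ D ≤ dvBound A + 1)

/-- The invariant of the main loop. -/
structure Inv (A : Matrix (Fin m) (Fin n) ℤ) (D N : ℕ) (s : State ℝ m n) : Prop
    extends PreInv A D N s where
  rank_eq : colRank A (s.S \ s.T) = colRank A s.S

lemma qNorm_mulVec_onesOn_le {Q : Matrix (Fin m) (Fin m) ℝ} (hQ : Q.PosDef) {S : Finset (Fin n)}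
    {b : ℝ} (hb : 0 ≤ b) (h : ∀ j ∈ S, qNorm Q (unitCol A j) ≤ b) :
    qNorm Q (unitCols A *ᵥ onesOn S) ≤ n * b := by
  rw [unitCols_mulVec]
  refine (qNorm_sum_le hQ _ _).trans ?_
  calc _ ≤ ∑ _j : Fin n, b := by
        refine Finset.sum_le_sum fun j _ => ?_
        rw [qNorm_smul, onesOn]
        split_ifs with hj
        · simpa using h j hj
        · simpa using hb
    _ = _ := by simp

lemma inv_start (h : Sizes A) : Inv A 0 0 (start A) where
  posDef := PosDef.one
  y_eq := rfl
  x_off := fun j hj => absurd (Finset.mem_univ j) hj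
  x_on := fun j hj => by simp [start, onesOn]
  short := fun j _ => (qNorm_one_unitCol_le A j).trans h.one_le_theta_inv
  length := fun c hc => Finset.sum_le_sum fun j _ =>
    mul_le_of_le_one_right (hc.1 j) (qNorm_one_unitCol_le A j)
  supp := fun c _ j _ => by simp [start]
  lower := fun v => by simp [start]
  volume := fun B _ hB _ => by
    have : fullRank A - colRank A (start A).S = 0 := Nat.sub_self _
    rw [this, pow_zero, pow_zero, mul_one]
    exact one_le_delta_sq_mul_minorDet A hB
  potential := by
    have h0 : fullRank A - colRank A (start A).S = 0 := Nat.sub_self _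
    rw [h0]
    have h1 : qNorm (start A).Q (start A).y ≤ n * 1 :=
      qNorm_mulVec_onesOn_le PosDef.one zero_le_one fun j _ => qNorm_one_unitCol_le A j
    have h2 := nat_le_two_pow_real h.cols_le
    have h3 := qNorm_nonneg (start A).Q (start A).y
    calc qNorm (start A).Q (start A).y ^ 2 ≤ (2 ^ encodingLength A) ^ 2 := by
          gcongr; linarith
      _ = 2 ^ (2 * encodingLength A) := by ring
      _ ≤ 2 ^ (26 * encodingLength A) := by
        apply pow_le_pow_right₀ one_le_two; omega
      _ = _ := by simp
  count := Or.inl ⟨rfl, rfl⟩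
  rank_eq := by simp [start]

variable {D N : ℕ} {s : State ℝ m n}

lemma colSpan_eq_of_rank_eq {S T : Finset (Fin n)} (hST : S ⊆ T)
    (h : colRank A S = colRank A T) : colSpan A S = colSpan A T := by
  rw [colRank_eq, colRank_eq] at h
  exact Submodule.eq_of_le_of_finrank_eq (colSpan_mono A hST) h

lemma PreInv.y_mem (hI : PreInv A D N s) : s.y ∈ colSpan A s.S := by
  rw [hI.y_eq, unitCols_mulVec]
  refine Submodule.sum_mem _ fun j _ => ?_
  by_cases hj : j ∈ s.S
  · exact Submodule.smul_mem _ _ (Submodule.subset_span ⟨j, hj, rfl⟩)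
  · rw [hI.x_off j hj, zero_smul]
    exact Submodule.zero_mem _

/-- The number of rescalings is bounded, because the long columns do not span. -/
lemma Inv.rescalings_le (h : Sizes A) (hI : Inv A D N s) :
    N ≤ 12 * (fullRank A * encodingLength A) := by
  rcases hI.count with ⟨-, rfl⟩ | ⟨hr, -⟩
  · simp
  -- A basis of the columns of `S` consisting only of short columns; it spans because `T` has not
  -- lowered the rank.
  obtain ⟨B, -, hBS, hB, hspan⟩ := exists_basis A (Finset.empty_subset (s.S \ s.T)) (by simp)
  have hvol := hI.volume B (hBS.trans Finset.sdiff_subset) hB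
    (hspan.trans (colSpan_eq_of_rank_eq Finset.sdiff_subset hI.rank_eq))
  have hcard : B.card = colRank A s.S := by
    rw [colRank_eq_card A hB, ← hI.rank_eq, colRank_eq, colRank_eq, hspan]
  set L := encodingLength A with hL
  have h1 : minorDet s.Q (unitCol A) B ≤ (2 ^ (8 * L)) ^ colRank A s.S := by
    refine (minorDet_le_prod hI.posDef B hB).trans ?_
    rw [← hcard, ← Finset.prod_const]
    refine Finset.prod_le_prod (fun _ _ => sq_nonneg _) fun j hj => ?_
    calc qNorm s.Q (unitCol A j) ^ 2 ≤ (2 ^ (4 * L)) ^ 2 := by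
          have := qNorm_nonneg s.Q (unitCol A j)
          gcongr
          exact (hI.short j (hBS hj)).trans h.theta_inv_le
      _ = _ := by ring
  have hrr := colRank_le_fullRank (A := A) s.S
  have hd := delta_le_pow A
  have hd1 := one_le_delta A
  have hm0 := minorDet_pos hI.posDef hB
  have h2 : (2 : ℝ) ^ N ≤ 2 ^ (2 * L + 10 * L * (fullRank A - colRank A s.S) +
      8 * L * colRank A s.S) := by
    calc (2 : ℝ) ^ N ≤ _ := hvol
      _ ≤ (2 ^ L) ^ 2 * (2 ^ (10 * L)) ^ (fullRank A - colRank A s.S) *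
          (2 ^ (8 * L)) ^ colRank A s.S := by gcongr
      _ = _ := by
        rw [← pow_mul, ← pow_mul, ← pow_mul, ← pow_add, ← pow_add, mul_comm L 2]
  have h3 := (pow_le_pow_iff_right₀ (one_lt_two (α := ℝ))).1 h2
  -- With ρ the rank of the columns of `S`, 2L + 10L(r - ρ) + 8Lρ ≤ 12rL because r ≥ 1.
  obtain ⟨t, ht⟩ := Nat.exists_eq_add_of_le hrr
  rw [ht, Nat.add_sub_cancel_left] at h3
  have h4 : L ≤ fullRank A * L := Nat.le_mul_of_pos_left _ hr
  rw [ht] at h4 ⊢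
  have : 0 ≤ L * colRank A s.S := Nat.zero_le _
  nlinarith

/-- While the exit test fails, the Euclidean norm of `y` is at least 1/(mΔ). Its square exceeds
‖y‖_Q² by at most the factor (1+3ε)^(2N), and N ≤ 12mL bounds this factor by 2^(12L); the remaining
2^(4L) comes from (mΔ)². -/
lemma Inv.one_le_of_not_done (h : Sizes A) (hI : Inv A D N s) (hd : ¬ Done A s) :
    1 ≤ 2 ^ (16 * encodingLength A) * qNorm s.Q s.y ^ 2 := by
  have he := eps_nonneg m
  set L := encodingLength A with hL
  have h1 : 1 ≤ m * delta A * qNorm 1 s.y := by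
    by_contra hlt
    rw [not_le, hI.y_eq] at hlt
    exact hd (Or.inr (kernelProj_pos_of_qNorm_lt hI.x_off hI.x_on hlt))
  have h2 : ((1 + 3 * eps m) ^ 2) ^ N ≤ 2 ^ (12 * L) := by
    have h3 : N ≤ m * (12 * L) := by
      refine (hI.rescalings_le h).trans ?_
      have := Nat.mul_le_mul_right L (colRank_le_rows A Finset.univ)
      rw [fullRank]; linarith
    calc ((1 + 3 * eps m) ^ 2) ^ N ≤ ((1 + 3 * eps m) ^ 2) ^ (m * (12 * L)) :=
          pow_le_pow_right₀ (one_le_pow₀ (by linarith)) h3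
      _ = (((1 + 3 * eps m) ^ 2) ^ m) ^ (12 * L) := pow_mul _ _ _
      _ ≤ _ := pow_le_pow_left₀ (by positivity) (one_add_eps_pow_le h.hm) _
  have hdl := delta_le_pow A
  have hd1 := one_le_delta A
  have hmL := nat_le_two_pow_real h.rows_le
  calc (1 : ℝ) ≤ (m * delta A * qNorm 1 s.y) ^ 2 := one_le_pow₀ h1
    _ = (m * delta A) ^ 2 * qNorm 1 s.y ^ 2 := by ring
    _ ≤ (2 ^ L * 2 ^ L) ^ 2 * (2 ^ (12 * L) * qNorm s.Q s.y ^ 2) := by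
      gcongr
      exact (hI.lower s.y).trans (by gcongr)
    _ = _ := by ring

lemma Inv.y_ne_zero (h : Sizes A) (hI : Inv A D N s) (hd : ¬ Done A s) : s.y ≠ 0 := by
  intro h0
  have := hI.one_le_of_not_done h hd
  rw [h0] at this
  norm_num at this

lemma Inv.one_le_fullRank (h : Sizes A) (hI : Inv A D N s) (hd : ¬ Done A s) :
    1 ≤ fullRank A := by
  refine le_trans ?_ (colRank_le_fullRank (A := A) s.S)
  rw [colRank_eq, Nat.one_le_iff_ne_zero, Ne, Submodule.finrank_eq_zero]
  intro h0
  have := hI.y_mem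
  rw [h0, Submodule.mem_bot] at this
  exact hI.y_ne_zero h hd this

lemma Inv.one_le_potential (h : Sizes A) (hI : Inv A D N s) (hd : ¬ Done A s) :
    1 ≤ 2 ^ (16 * encodingLength A) * ((1 - eps m ^ 2) ^ D * 4 ^ N *
    (2 ^ (26 * encodingLength A)) ^ (fullRank A - colRank A s.S + 1)) :=
  (hI.one_le_of_not_done h hd).trans (by gcongr; exact hI.potential)

/-- Bernoulli's inequality, with 121 m² ε² = 1. -/
lemma two_le_one_add_eps_pow (hm : 1 ≤ m) : 2 ≤ (1 + eps m ^ 2) ^ (121 * m ^ 2) := by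
  have h1 : (0 : ℝ) < m := by exact_mod_cast hm
  have h2 := one_add_mul_le_pow (a := eps m ^ 2) (by nlinarith [sq_nonneg (eps m)]) (121 * m ^ 2)
  refine le_trans (le_of_eq ?_) h2
  unfold eps
  push_cast
  field_simp
  norm_num

/-- The number of updates is bounded, because `‖y‖` cannot become too small. -/
lemma Inv.updates_le (h : Sizes A) (hI : Inv A D N s) (hd : ¬ Done A s) : D ≤ dvBound A := by
  have hr := hI.one_le_fullRank h hd
  have hN := hI.rescalings_le h
  have hpot := hI.one_le_potential h hd
  have he := eps_nonneg m
  have he1 := eps_lt_one h.hm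
  have hm0 : (0 : ℝ) < m := by exact_mod_cast h.hm
  have hepos : 0 < eps m := by unfold eps; positivity
  set L := encodingLength A with hL
  set r := fullRank A with hrdef
  -- Here 16 + 2·12 + 26·2 = 92. Together with the 121 m² updates per factor 2, this gives the
  -- constant 121·92 = 11132 of `dvBound`.
  have hexp : 16 * L + 2 * N + 26 * L * (r - colRank A s.S + 1) ≤ 92 * (r * L) := by
    have h1 : L ≤ r * L := Nat.le_mul_of_pos_left _ hr
    have h2 : 26 * L * (r - colRank A s.S + 1) ≤ 26 * L * (r + 1) := by gcongr; omega
    nlinarith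
  have h1 : (1 : ℝ) ≤ (1 - eps m ^ 2) ^ D * 2 ^ (92 * (r * L)) := by
    calc (1 : ℝ) ≤ _ := hpot
      _ = (1 - eps m ^ 2) ^ D * 2 ^ (16 * L + 2 * N + 26 * L * (r - colRank A s.S + 1)) := by
        rw [show (4 : ℝ) = 2 ^ 2 by norm_num, ← pow_mul, ← pow_mul, pow_add, pow_add]
        ring
      _ ≤ _ := by
        have : 0 ≤ (1 - eps m ^ 2) ^ D := pow_nonneg (by nlinarith) _
        gcongr
        norm_num
  -- Since (1+ε²)(1-ε²) ≤ 1, the decay is traded for growth with a base above 1, where exponents can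
  -- be compared.
  have h2 : (1 + eps m ^ 2) ^ D ≤ 2 ^ (92 * (r * L)) := by
    have h3 : (1 + eps m ^ 2) ^ D * (1 - eps m ^ 2) ^ D ≤ 1 := by
      rw [← mul_pow]
      apply pow_le_one₀
      · exact mul_nonneg (by positivity) (by nlinarith)
      · nlinarith [sq_nonneg (eps m ^ 2)]
    have h4 : 0 ≤ (1 + eps m ^ 2) ^ D := by positivity
    calc (1 + eps m ^ 2) ^ D = (1 + eps m ^ 2) ^ D * 1 := (mul_one _).symm
      _ ≤ (1 + eps m ^ 2) ^ D * ((1 - eps m ^ 2) ^ D * 2 ^ (92 * (r * L))) := by gcongr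
      _ = ((1 + eps m ^ 2) ^ D * (1 - eps m ^ 2) ^ D) * 2 ^ (92 * (r * L)) := by ring
      _ ≤ 1 * 2 ^ (92 * (r * L)) := by gcongr
      _ = _ := one_mul _
  have h5 : (1 + eps m ^ 2) ^ D ≤ (1 + eps m ^ 2) ^ (121 * m ^ 2 * (92 * (r * L))) := by
    rw [pow_mul]
    exact h2.trans (pow_le_pow_left₀ zero_le_two (two_le_one_add_eps_pow h.hm) _)
  have h6 := (pow_le_pow_iff_right₀ (by nlinarith : 1 < 1 + eps m ^ 2)).1 h5
  calc D ≤ _ := h6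
    _ = dvBound A := by rw [dvBound]; ring

/-! ## The three kinds of iterations -/

/-- The update removes from `y` its component along â_k, so ‖y‖_Q² loses ⟨â_k,y⟩²/‖â_k‖², which is
at least ε²‖y‖_Q² by steepness. The step length is negative, so `x` only grows. -/
lemma Inv.dv (h : Sizes A) (hI : Inv A D N s) (hd : ¬ Done A s) {k : Fin n}
    (hk : IsArgmin A s k) (hs : IsSteep A s k) : Inv A (D + 1) N (dvUpdate A s k) := by
  have hQ := hI.posDef
  have he := eps_nonneg m
  have he1 := eps_lt_one h.hm
  have hy := qNorm_nonneg s.Q s.y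
  have hu := qNorm_nonneg s.Q (unitCol A k)
  have hs' : qInner s.Q (unitCol A k) s.y <
    -eps m * qNorm s.Q (unitCol A k) * qNorm s.Q s.y := hs
  -- A zero column is never steep, since both sides of the test would be 0.
  have hpos : 0 < qNorm s.Q (unitCol A k) := by
    rcases hu.eq_or_lt with h0 | h0
    · have h1 := abs_qInner_le hQ (unitCol A k) s.y
      rw [← h0, zero_mul] at h1
      rw [← h0, abs_nonpos_iff.1 h1] at hs'
      simp at hs'
    · exact h0
  have hprod : 0 ≤ eps m * qNorm s.Q (unitCol A k) * qNorm s.Q s.y := by positivity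
  have hneg : qInner s.Q (unitCol A k) s.y < 0 := by linarith
  set c := stepLength A s k with hc
  have hc' : c = qInner s.Q (unitCol A k) s.y / qNorm s.Q (unitCol A k) ^ 2 := rfl
  have hc0 : c < 0 := by rw [hc']; exact div_neg_of_neg_of_pos hneg (by positivity)
  have hx : ∀ j, (dvUpdate A s k).x j = s.x j - c * (Pi.single k (1 : ℝ) : Fin n → ℝ) j :=
    fun _ => rfl
  have hynew : (dvUpdate A s k).y = s.y + (-c) • unitCol A k := by
    rw [neg_smul, ← sub_eq_add_neg]; rfl
  refine { posDef := hQ, short := hI.short, length := hI.length, supp := hI.supp,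
           lower := hI.lower, volume := hI.volume, rank_eq := hI.rank_eq, y_eq := ?_,
           x_off := ?_, x_on := ?_, potential := ?_, count := ?_ }
  · change s.y - c • (unitCols A).col k = unitCols A *ᵥ (s.x - c • Pi.single k 1)
    rw [mulVec_sub, mulVec_smul, mulVec_single_one, ← hI.y_eq]
  · intro j hj
    have hjk : j ≠ k := fun e => hj (e ▸ hk.1)
    rw [hx, hI.x_off j hj, Pi.single_eq_of_ne hjk]
    ring
  · intro j hj
    rw [hx]
    rcases eq_or_ne j k with rfl | hjk
    · rw [Pi.single_eq_same]; linarith [hI.x_on j hj]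
    · rw [Pi.single_eq_of_ne hjk]; linarith [hI.x_on j hj]
  · have h1 : qNorm s.Q (dvUpdate A s k).y ^ 2 ≤ (1 - eps m ^ 2) * qNorm s.Q s.y ^ 2 := by
      rw [hynew, qNorm_sq hQ, qNorm_sq hQ]
      simp only [qInner_add_left, qInner_add_right, qInner_smul_left, qInner_smul_right]
      rw [qInner_comm hQ s.y (unitCol A k), ← qNorm_sq hQ, ← qNorm_sq hQ (unitCol A k)]
      have h2 : c * qNorm s.Q (unitCol A k) ^ 2 = qInner s.Q (unitCol A k) s.y := by
        rw [hc']; field_simp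
      have h3 : c ≤ -eps m * qNorm s.Q s.y / qNorm s.Q (unitCol A k) := by
        rw [hc', div_le_div_iff₀ (by positivity) hpos]
        nlinarith
      have h4 : (eps m * qNorm s.Q s.y / qNorm s.Q (unitCol A k)) *
          (eps m * qNorm s.Q (unitCol A k) * qNorm s.Q s.y) ≤
          (-c) * (-qInner s.Q (unitCol A k) s.y) := by
        apply mul_le_mul _ (by linarith) hprod (by linarith)
        have : -eps m * qNorm s.Q s.y / qNorm s.Q (unitCol A k) =
          -(eps m * qNorm s.Q s.y / qNorm s.Q (unitCol A k)) := by ring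
        linarith
      have h5 : (eps m * qNorm s.Q s.y / qNorm s.Q (unitCol A k)) *
          (eps m * qNorm s.Q (unitCol A k) * qNorm s.Q s.y) = eps m ^ 2 * qNorm s.Q s.y ^ 2 := by
        field_simp
      nlinarith
    have h6 : 0 ≤ 1 - eps m ^ 2 := by nlinarith
    change qNorm s.Q (dvUpdate A s k).y ^ 2 ≤ (1 - eps m ^ 2) ^ (D + 1) * 4 ^ N *
      (2 ^ (26 * encodingLength A)) ^ (fullRank A - colRank A s.S + 1)
    calc qNorm s.Q (dvUpdate A s k).y ^ 2 ≤ _ := h1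
      _ ≤ (1 - eps m ^ 2) * _ := mul_le_mul_of_nonneg_left hI.potential h6
      _ = _ := by ring
  · exact Or.inr ⟨hI.one_le_fullRank h hd, Nat.succ_le_succ (hI.updates_le h hd)⟩

/-- If no column in `S` is steep, all of them form large angles with `-y`. -/
lemma flat_of_not_isSteep (hQ : s.Q.PosDef) {k : Fin n} (hk : IsArgmin A s k)
    (hs : ¬ IsSteep A s k) {j : Fin n} (hj : j ∈ s.S) :
    -eps m * qNorm s.Q (unitCol A j) * qNorm s.Q s.y ≤ qInner s.Q (unitCol A j) s.y := by
  have hs' : -eps m * qNorm s.Q (unitCol A k) * qNorm s.Q s.y ≤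
    qInner s.Q (unitCol A k) s.y := not_lt.1 hs
  have hcos : qInner s.Q (unitCol A k) s.y / qNorm s.Q (unitCol A k) ≤
    qInner s.Q (unitCol A j) s.y / qNorm s.Q (unitCol A j) := hk.2 j hj
  have he := eps_nonneg m
  have hy := qNorm_nonneg s.Q s.y
  rcases (qNorm_nonneg s.Q (unitCol A j)).eq_or_lt with h0 | h0
  · have h1 := abs_qInner_le hQ (unitCol A j) s.y
    rw [← h0, zero_mul] at h1
    rw [← h0, abs_nonpos_iff.1 h1]
    simp
  have h1 : -(eps m * qNorm s.Q s.y) ≤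
      qInner s.Q (unitCol A k) s.y / qNorm s.Q (unitCol A k) := by
    rcases (qNorm_nonneg s.Q (unitCol A k)).eq_or_lt with h2 | h2
    · rw [← h2, div_zero]
      have : 0 ≤ eps m * qNorm s.Q s.y := by positivity
      linarith
    · rw [le_div_iff₀ h2]
      linarith
  have h2 := h1.trans hcos
  rw [le_div_iff₀ h0] at h2
  linarith

/-- The bound on relations is established first, because it shows that a column entering `T` occurs
in no relation. The conclusion is only `PreInv`, since the enlarged `T` may lower the rank. -/
lemma Inv.rescale (h : Sizes A) (hI : Inv A D N s) (hd : ¬ Done A s) {k : Fin n}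
    (hk : IsArgmin A s k) (hs : ¬ IsSteep A s k) : PreInv A D (N + 1) (rescaleUpdate A s) := by
  have hQ := hI.posDef
  have hy := hI.y_ne_zero h hd
  have hQ' : (rescaledQ s.Q s.y).PosDef := rescaledQ_posDef hQ s.y
  have he1 := eps_lt_one h.hm
  have he := eps_nonneg m
  have hlen : ∀ c, IsRelation A c →
      ∑ j, c j * qNorm (rescaledQ s.Q s.y) (unitCol A j) ≤ ∑ j, c j := fun c hc =>
    (sum_qNorm_rescaledQ_le hQ hy hc fun j hj =>
      flat_of_not_isSteep hQ hk hs (hI.supp c hc j hj).1).trans (hI.length c hc)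
  refine { posDef := hQ', y_eq := hI.y_eq, x_off := hI.x_off, x_on := hI.x_on, length := hlen,
           short := ?_, supp := ?_, lower := ?_, volume := ?_, potential := ?_, count := ?_ }
  · intro j hj
    by_contra hlt
    simp only [rescaleUpdate, Finset.mem_sdiff, Finset.mem_union, Finset.mem_filter,
      not_or] at hj
    exact hj.2.2 ⟨⟨hj.1, hj.2.1⟩, not_le.1 hlt⟩
  · intro c hc j hj
    refine ⟨(hI.supp c hc j hj).1, fun hmem => ?_⟩
    simp only [rescaleUpdate, Finset.mem_union, Finset.mem_filter] at hmem
    rcases hmem with hmem | ⟨-, hmem⟩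
    · exact (hI.supp c hc j hj).2 hmem
    · exact absurd (qNorm_le_of_relation h.hm hQ' hlen hc hj) (not_le.2 hmem)
  · intro v
    calc qNorm 1 v ^ 2 ≤ ((1 + 3 * eps m) ^ 2) ^ N * qNorm s.Q v ^ 2 := hI.lower v
      _ ≤ ((1 + 3 * eps m) ^ 2) ^ N * ((1 + 3 * eps m) ^ 2 *
          qNorm (rescaledQ s.Q s.y) v ^ 2) := by
        gcongr
        exact qNorm_sq_le_rescaledQ hQ s.y v
      _ = _ := by rw [pow_succ ((1 + 3 * eps m) ^ 2), mul_assoc]; rfl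
  · intro B hBS hB hspan
    have h1 : 2 * minorDet s.Q (unitCol A) B ≤ minorDet (rescaledQ s.Q s.y) (unitCol A) B := by
      refine two_mul_gramDet_le h.hm hQ hB hy ?_
      have := hI.y_mem
      rw [show colSpan A s.S = colSpan A B from hspan.symm, colSpan, Set.image_eq_range] at this
      exact this
    have h2 := hI.volume B hBS hB hspan
    have hd1 := one_le_delta A
    calc (2 : ℝ) ^ (N + 1) = 2 * 2 ^ N := by ring
      _ ≤ 2 * (_ * minorDet s.Q (unitCol A) B) := by gcongr
      _ = delta A ^ 2 * (2 ^ (10 * encodingLength A)) ^ (fullRank A - colRank A s.S) *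
          (2 * minorDet s.Q (unitCol A) B) := by ring
      _ ≤ _ := mul_le_mul_of_nonneg_left h1 (by positivity)
  · have h1 : 0 ≤ (1 - eps m ^ 2) ^ D := pow_nonneg (by nlinarith) _
    calc qNorm (rescaledQ s.Q s.y) s.y ^ 2 ≤ 4 * qNorm s.Q s.y ^ 2 := qNorm_rescaledQ_self hQ
      _ ≤ 4 * _ := mul_le_mul_of_nonneg_left hI.potential zero_le_four
      _ = (1 - eps m ^ 2) ^ D * 4 ^ (N + 1) *
        (2 ^ (26 * encodingLength A)) ^ (fullRank A - colRank A s.S + 1) := by ring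
  · exact Or.inr ⟨hI.one_le_fullRank h hd, (hI.updates_le h hd).trans (Nat.le_succ _)⟩

/-- `Q` is kept, so the volume must be transferred to bases of the smaller span, and the norm of the
new `y` must be compared with the potential before the restart. -/
lemma Inv.remove (h : Sizes A) (hI : Inv A D N s) (hd : ¬ Done A s)
    (hP : PreInv A D (N + 1) (rescaleUpdate A s))
    (hr : colRank A ((rescaleUpdate A s).S \ (rescaleUpdate A s).T) <
      colRank A (rescaleUpdate A s).S) :
    Inv A D (N + 1) (remove A (rescaleUpdate A s)) := by
  set s' := rescaleUpdate A s with hs'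
  have hS : s'.S = s.S := rfl
  have hQ' := hP.posDef
  have he1 := eps_lt_one h.hm
  have he := eps_nonneg m
  set L := encodingLength A with hL
  have hθ := h.theta_inv_le
  have hθ1 := h.one_le_theta_inv
  refine { posDef := hQ', y_eq := rfl, x_off := ?_, x_on := ?_, length := hP.length,
           short := ?_, supp := ?_, lower := hP.lower, volume := ?_, potential := ?_,
           count := hP.count, rank_eq := ?_ }
  · intro j hj
    have hj' : j ∉ s'.S \ s'.T := hj
    exact if_neg hj'
  · intro j hj
    have hj' : j ∈ s'.S \ s'.T := hj
    exact (if_pos hj').symm.le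
  · intro j hj
    exact hP.short j (Finset.sdiff_subset hj)
  · intro c hc j hj
    refine ⟨Finset.mem_sdiff.2 (hP.supp c hc j hj), ?_⟩
    simp [KernelAlg.remove]
  · intro B' hB'S hB' hspan'
    change B' ⊆ s'.S \ s'.T at hB'S
    change colSpan A B' = colSpan A (s'.S \ s'.T) at hspan'
    change (2 : ℝ) ^ (N + 1) ≤ delta A ^ 2 * (2 ^ (10 * L)) ^
      (fullRank A - colRank A (s'.S \ s'.T)) * minorDet s'.Q (unitCol A) B'
    have hsub : s'.S \ s'.T ⊆ s.S \ s.T :=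
      Finset.sdiff_subset_sdiff le_rfl Finset.subset_union_left
    -- The basis is completed by columns that were outside `T` before this rescaling. Those still
    -- spanned and had norm at most θ⁻¹, hence now at most 2θ⁻¹. Older members of `T` have no such
    -- bound. The square satisfies 2^(2+8L) ≤ 2^(10L) because L ≥ 1.
    obtain ⟨B, hB'B, hBS, hB, hspan⟩ := exists_basis A (hB'S.trans hsub) hB'
    have hspanS := hspan.trans (colSpan_eq_of_rank_eq Finset.sdiff_subset hI.rank_eq)
    have hvol := hP.volume B (hBS.trans Finset.sdiff_subset) hB hspanS
    have hB2 : B' ∪ (B \ B') = B := Finset.union_sdiff_of_subset hB'B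
    have h1 := minorDet_union_le (u := unitCol A) hQ' B' (B \ B') Finset.disjoint_sdiff
      (by rwa [hB2])
    rw [hB2] at h1
    have hc1 : B.card = colRank A s'.S := by
      rw [colRank_eq_card A hB, colRank_eq, colRank_eq, hspanS, hS]
    have hc2 : B'.card = colRank A (s'.S \ s'.T) := by
      rw [colRank_eq_card A hB', colRank_eq, colRank_eq, hspan']
    have h2 : ∏ j ∈ B \ B', qNorm s'.Q (unitCol A j) ^ 2 ≤
        (2 ^ (10 * L)) ^ (colRank A s'.S - colRank A (s'.S \ s'.T)) := by
      rw [← hc1, ← hc2, ← Finset.card_sdiff_of_subset hB'B, ← Finset.prod_const]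
      refine Finset.prod_le_prod (fun _ _ => sq_nonneg _) fun j hj => ?_
      have h3 : qNorm s'.Q (unitCol A j) ≤ 2 * 2 ^ (4 * L) :=
        (qNorm_rescaledQ_le_two_mul hI.posDef s.y (unitCol A j)).trans
          (by gcongr; exact (hI.short j (hBS (Finset.sdiff_subset hj))).trans hθ)
      have h4 := qNorm_nonneg s'.Q (unitCol A j)
      calc qNorm s'.Q (unitCol A j) ^ 2 ≤ (2 * 2 ^ (4 * L)) ^ 2 := by gcongr
        _ = 2 ^ (2 + 8 * L) := by ring
        _ ≤ _ := by
          apply pow_le_pow_right₀ one_le_two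
          have := h.one_le
          omega
    have hB'pos := minorDet_pos hQ' hB'
    have hd1 := one_le_delta A
    have hrr := colRank_le_fullRank (A := A) s'.S
    have hexp : fullRank A - colRank A (s'.S \ s'.T) = (fullRank A - colRank A s'.S) +
        (colRank A s'.S - colRank A (s'.S \ s'.T)) := by omega
    calc (2 : ℝ) ^ (N + 1) ≤ _ := hvol
      _ ≤ delta A ^ 2 * (2 ^ (10 * L)) ^ (fullRank A - colRank A s'.S) *
          (minorDet s'.Q (unitCol A) B' *
            (2 ^ (10 * L)) ^ (colRank A s'.S - colRank A (s'.S \ s'.T))) := by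
        gcongr
        exact h1.trans (by gcongr)
      _ = _ := by rw [hexp, pow_add]; ring
  · change qNorm s'.Q (unitCols A *ᵥ onesOn (s'.S \ s'.T)) ^ 2 ≤ (1 - eps m ^ 2) ^ D *
      4 ^ (N + 1) * (2 ^ (26 * L)) ^ (fullRank A - colRank A (s'.S \ s'.T) + 1)
    have h1 := qNorm_mulVec_onesOn_le (A := A) hQ' (by linarith) hP.short
    have h2 : (n : ℝ) * (theta A)⁻¹ ≤ 2 ^ L * 2 ^ (4 * L) := by
      gcongr
      exact nat_le_two_pow_real h.cols_le
    -- As the algorithm had not finished, the old potential is at least 2^(-16L). The new ‖y‖_Q² is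
    -- at most 2^(10L), which explains the factor 2^(26L) per lost dimension.
    have h3 := hI.one_le_potential h hd
    have h4 : 0 ≤ (1 - eps m ^ 2) ^ D := pow_nonneg (by nlinarith) _
    have h5 := qNorm_nonneg s'.Q (unitCols A *ᵥ onesOn (s'.S \ s'.T))
    have hrr := colRank_le_fullRank (A := A) s'.S
    rw [hS] at hr hrr
    calc qNorm s'.Q (unitCols A *ᵥ onesOn (s'.S \ s'.T)) ^ 2 ≤ (2 ^ L * 2 ^ (4 * L)) ^ 2 := by
          gcongr; exact h1.trans h2
      _ = 2 ^ (10 * L) * 1 := by ring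
      _ ≤ 2 ^ (10 * L) * _ := mul_le_mul_of_nonneg_left h3 (by positivity)
      _ = (1 - eps m ^ 2) ^ D * 4 ^ N *
          (2 ^ (26 * L)) ^ (fullRank A - colRank A s.S + 1 + 1) := by
        rw [pow_succ ((2 : ℝ) ^ (26 * L)) (_ + 1)]; ring
      _ ≤ _ := by
        gcongr
        · norm_num
        · omega
        · exact one_le_pow₀ one_le_two
        · rw [hS]; omega
  · simp [KernelAlg.remove]

/-- Every iteration preserves the invariant. -/
lemma Inv.step (h : Sizes A) (hI : Inv A D N s) (hd : ¬ Done A s) {s' : State ℝ m n}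
    (hs : Step A s s') :
    Inv A (D + 1) N s' ∨ Inv A D (N + 1) s' := by
  cases hs with
  | dv k hk hs => exact Or.inl (hI.dv h hd hk hs)
  | rescale k hk hs hr =>
    exact Or.inr ⟨hI.rescale h hd hk hs,
      le_antisymm (colRank_mono A Finset.sdiff_subset) (not_lt.1 hr)⟩
  | rescaleRemove k hk hs hr => exact Or.inr (hI.remove h hd (hI.rescale h hd hk hs) hr)

lemma Run.exists_inv (h : Sizes A) {M : ℕ} (hR : Run A M s) :
    ∃ D N, M = D + N ∧ Inv A D N s := by
  induction hR with
  | start => exact ⟨0, 0, rfl, inv_start h⟩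
  | next _ hd hs ih =>
    obtain ⟨D, N, rfl, hI⟩ := ih
    rcases hI.step h hd hs with h' | h'
    · exact ⟨D + 1, N, by omega, h'⟩
    · exact ⟨D, N + 1, by omega, h'⟩

lemma exists_step (hd : ¬ Done A s) : ∃ s', Step A s s' := by
  have hne : s.S.Nonempty := Finset.nonempty_iff_ne_empty.2 fun h => hd (Or.inl h)
  obtain ⟨k, hk⟩ := s.S.exists_min_image (cosine A s) hne
  by_cases hs : IsSteep A s k
  · exact ⟨_, .dv k hk hs⟩
  by_cases hr : colRank A ((rescaleUpdate A s).S \ (rescaleUpdate A s).T) <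
      colRank A (rescaleUpdate A s).S
  · exact ⟨_, .rescaleRemove k hk hs hr⟩
  · exact ⟨_, .rescale k hk hs hr⟩

lemma Inv.isMaxSupportSolution (hI : Inv A D N s) (hd : Done A s) :
    IsMaxSupportSolution A (output A s) :=
  output_isMaxSupportSolution hd fun c hc j hj => (hI.supp c hc j hj).1

/-- In positive rank m² r L ≥ 1, so the extra update is absorbed by passing from 11132 to 11133. -/
lemma Inv.count_le (h : Sizes A) (hI : Inv A D N s) :
    D ≤ 11133 * (m ^ 2 * fullRank A * encodingLength A) ∧
      N ≤ 12 * (fullRank A * encodingLength A) := by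
  refine ⟨?_, hI.rescalings_le h⟩
  rcases hI.count with ⟨rfl, -⟩ | ⟨hr, hD⟩
  · simp
  · have : 0 < m ^ 2 * fullRank A * encodingLength A :=
      Nat.mul_pos (Nat.mul_pos (pow_pos h.hm 2) hr) h.one_le
    rw [dvBound] at hD
    omega

end Invariant

/-! # Values and costs of programs -/

section Exec

variable {α β : Type}

@[simp] lemma exec_bind_fst (c : Comp ℝ α) (f : α → Comp ℝ β) :
    (c >>= f).exec.1 = (f c.exec.1).exec.1 := by
  change (c.andThen f).exec.1 = _
  induction c with
  | ret a => rfl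
  | nat c k ih => exact ih _
  | arith o a b k ih => exact ih _
  | sqrt a k ih => exact ih _
  | lt a b k ih => exact ih _

@[simp] lemma exec_bind_snd (c : Comp ℝ α) (f : α → Comp ℝ β) :
    (c >>= f).exec.2 = c.exec.2 + (f c.exec.1).exec.2 := by
  change (c.andThen f).exec.2 = _
  induction c with
  | ret a => exact (Nat.zero_add _).symm
  | nat c k ih => simp only [Comp.andThen, Comp.exec, ih]; omega
  | arith o a b k ih => simp only [Comp.andThen, Comp.exec, ih]; omega
  | sqrt a k ih => simp only [Comp.andThen, Comp.exec, ih]; omega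
  | lt a b k ih => simp only [Comp.andThen, Comp.exec, ih]; omega

@[simp] lemma exec_pure_fst (a : α) : (pure a : Comp ℝ α).exec.1 = a := rfl
@[simp] lemma exec_pure_snd (a : α) : (pure a : Comp ℝ α).exec.2 = 0 := rfl
@[simp] lemma natC_fst (c : ℕ) : (natC c : Comp ℝ ℝ).exec.1 = c := rfl
@[simp] lemma natC_snd (c : ℕ) : (natC c : Comp ℝ ℝ).exec.2 = 1 := rfl
@[simp] lemma addC_fst (a b : ℝ) : (addC a b).exec.1 = a + b := rfl
@[simp] lemma addC_snd (a b : ℝ) : (addC a b).exec.2 = 1 := rfl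
@[simp] lemma subC_fst (a b : ℝ) : (subC a b).exec.1 = a - b := rfl
@[simp] lemma subC_snd (a b : ℝ) : (subC a b).exec.2 = 1 := rfl
@[simp] lemma mulC_fst (a b : ℝ) : (mulC a b).exec.1 = a * b := rfl
@[simp] lemma mulC_snd (a b : ℝ) : (mulC a b).exec.2 = 1 := rfl
@[simp] lemma divC_fst (a b : ℝ) : (divC a b).exec.1 = a / b := rfl
@[simp] lemma divC_snd (a b : ℝ) : (divC a b).exec.2 = 1 := rfl
@[simp] lemma sqrtC_fst (a : ℝ) : (sqrtC a).exec.1 = √a := rfl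
@[simp] lemma sqrtC_snd (a : ℝ) : (sqrtC a).exec.2 = 1 := rfl
open Classical in
@[simp] lemma ltC_fst (a b : ℝ) : (ltC a b).exec.1 = decide (a < b) := rfl
@[simp] lemma ltC_snd (a b : ℝ) : (ltC a b).exec.2 = 1 := rfl

@[simp] lemma tab_fst : ∀ {d : ℕ} (f : Fin d → Comp ℝ α), (tab f).exec.1 = fun i => (f i).exec.1
  | 0, f => by funext i; exact i.elim0
  | d + 1, f => by
    funext i
    refine Fin.cases ?_ (fun i => ?_) i
    · simp [tab]
    · simp [tab, tab_fst]

@[simp] lemma tab_snd : ∀ {d : ℕ} (f : Fin d → Comp ℝ α), (tab f).exec.2 = ∑ i, (f i).exec.2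
  | 0, f => by simp [tab]
  | d + 1, f => by simp [tab, tab_snd, Fin.sum_univ_succ]

@[simp] lemma tabMat_fst {d e : ℕ} (f : Fin d → Fin e → Comp ℝ ℝ) :
    (tabMat f).exec.1 = Matrix.of fun i j => (f i j).exec.1 := by
  simp [tabMat]

@[simp] lemma tabMat_snd {d e : ℕ} (f : Fin d → Fin e → Comp ℝ ℝ) :
    (tabMat f).exec.2 = ∑ i, ∑ j, (f i j).exec.2 := by
  simp [tabMat]

@[simp] lemma dotC_fst : ∀ {d : ℕ} (u v : Fin d → ℝ), (dotC u v).exec.1 = u ⬝ᵥ v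
  | 0, u, v => by simp [dotC]
  | d + 1, u, v => by
    simp only [dotC, exec_bind_fst, mulC_fst, dotC_fst, addC_fst]
    simp [dotProduct, Fin.sum_univ_succ]

@[simp] lemma dotC_snd : ∀ {d : ℕ} (u v : Fin d → ℝ), (dotC u v).exec.2 = 2 * d + 1
  | 0, u, v => by simp [dotC]
  | d + 1, u, v => by
    simp only [dotC, exec_bind_snd, mulC_snd, dotC_snd, addC_snd]
    omega

variable {d e m n : ℕ}

@[simp] lemma mulVecC_fst (M : Matrix (Fin d) (Fin e) ℝ) (v : Fin e → ℝ) :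
    (mulVecC M v).exec.1 = M *ᵥ v := by
  simp [mulVecC]; rfl

@[simp] lemma mulVecC_snd (M : Matrix (Fin d) (Fin e) ℝ) (v : Fin e → ℝ) :
    (mulVecC M v).exec.2 = d * (2 * e + 1) := by
  simp [mulVecC]

@[simp] lemma subScaled_fst (v : Fin d → ℝ) (c : ℝ) (u : Fin d → ℝ) :
    (subScaled v c u).exec.1 = v - c • u := by
  simp [subScaled]; rfl

@[simp] lemma subScaled_snd (v : Fin d → ℝ) (c : ℝ) (u : Fin d → ℝ) :
    (subScaled v c u).exec.2 = 2 * d := by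
  simp [subScaled, mul_comm]

@[simp] lemma keepCols_fst (S : Finset (Fin n)) (M : Matrix (Fin m) (Fin n) ℝ) :
    (keepCols S M).exec.1 = Matrix.of fun i j => if j ∈ S then M i j else 0 := by
  simp [keepCols]

@[simp] lemma keepCols_snd (S : Finset (Fin n)) (M : Matrix (Fin m) (Fin n) ℝ) :
    (keepCols S M).exec.2 = 1 := by
  simp [keepCols]

open Classical in
@[simp] lemma isNonzero_fst (v : Fin d → ℝ) : (isNonzero v).exec.1 = decide (v ≠ 0) := by
  simp only [isNonzero, exec_bind_fst, natC_fst, dotC_fst, ltC_fst, Nat.cast_zero]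
  congr 1
  rw [eq_iff_iff]
  refine ⟨fun h h0 => by simp [h0] at h, fun h => ?_⟩
  refine lt_of_le_of_ne (Finset.sum_nonneg fun i _ => mul_self_nonneg (v i)) fun h0 => h ?_
  exact dotProduct_self_eq_zero.1 h0.symm

@[simp] lemma isNonzero_snd (v : Fin d → ℝ) : (isNonzero v).exec.2 = 2 * d + 3 := by
  simp [isNonzero]; omega

/-! # Orthogonal lists of vectors -/

/-- The vectors of the list are nonzero and pairwise orthogonal. -/
def OrthList (B : List (Fin d → ℝ)) : Prop :=
  B.Pairwise (fun b c => b ⬝ᵥ c = 0) ∧ ∀ b ∈ B, b ≠ 0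

/-- The span of a list of vectors. -/
def listSpan (B : List (Fin d → ℝ)) : Submodule ℝ (Fin d → ℝ) := Submodule.span ℝ {b | b ∈ B}

/-- The projection of `v` to the span of an orthogonal list. -/
noncomputable def projSum (B : List (Fin d → ℝ)) (v : Fin d → ℝ) : Fin d → ℝ :=
  (B.map fun b => ((b ⬝ᵥ v) / (b ⬝ᵥ b)) • b).sum

lemma orthList_cons {b : Fin d → ℝ} {B : List (Fin d → ℝ)} :
    OrthList (b :: B) ↔ (b ≠ 0 ∧ ∀ c ∈ B, b ⬝ᵥ c = 0) ∧ OrthList B := by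
  simp only [OrthList, List.pairwise_cons, List.forall_mem_cons]
  tauto

lemma orthList_nil : OrthList ([] : List (Fin d → ℝ)) := by simp [OrthList]

lemma listSpan_nil : listSpan ([] : List (Fin d → ℝ)) = ⊥ := by simp [listSpan]

lemma listSpan_cons (b : Fin d → ℝ) (B : List (Fin d → ℝ)) :
    listSpan (b :: B) = Submodule.span ℝ {b} ⊔ listSpan B := by
  rw [listSpan, listSpan, ← Submodule.span_union]
  congr 1
  ext c
  simp

lemma dotProduct_eq_zero_of_mem_listSpan {B : List (Fin d → ℝ)} {b v : Fin d → ℝ}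
    (h : ∀ c ∈ B, b ⬝ᵥ c = 0) (hv : v ∈ listSpan B) : b ⬝ᵥ v = 0 := by
  induction hv using Submodule.span_induction with
  | mem c hc => exact h c hc
  | zero => exact dotProduct_zero b
  | add u w _ _ hu hw => rw [dotProduct_add, hu, hw, add_zero]
  | smul a u _ hu => rw [dotProduct_smul, hu, smul_zero]

lemma projSum_cons (b : Fin d → ℝ) (B : List (Fin d → ℝ)) (v : Fin d → ℝ) :
    projSum (b :: B) v = ((b ⬝ᵥ v) / (b ⬝ᵥ b)) • b + projSum B v := by
  simp [projSum]

lemma projSum_mem (B : List (Fin d → ℝ)) (v : Fin d → ℝ) : projSum B v ∈ listSpan B := by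
  induction B with
  | nil => simp [projSum]
  | cons b B ih =>
    rw [projSum_cons, listSpan_cons]
    exact Submodule.add_mem_sup (Submodule.smul_mem _ _ (Submodule.mem_span_singleton_self b)) ih

lemma dotProduct_projSum {B : List (Fin d → ℝ)} (hB : OrthList B) (v : Fin d → ℝ) :
    ∀ b ∈ B, b ⬝ᵥ projSum B v = b ⬝ᵥ v := by
  induction B with
  | nil => simp
  | cons b B ih =>
    rw [orthList_cons] at hB
    have hb : b ⬝ᵥ b ≠ 0 := fun h => hB.1.1 (dotProduct_self_eq_zero.1 h)
    intro c hc
    rw [projSum_cons, dotProduct_add, dotProduct_smul, smul_eq_mul]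
    rcases List.mem_cons.1 hc with rfl | hc
    · rw [dotProduct_eq_zero_of_mem_listSpan hB.1.2 (projSum_mem B v), add_zero,
        div_mul_cancel₀ _ hb]
    · rw [ih hB.2 c hc, dotProduct_comm c b, hB.1.2 c hc, mul_zero, zero_add]

lemma projSum_sub_smul {B : List (Fin d → ℝ)} {b : Fin d → ℝ} (h : ∀ c ∈ B, b ⬝ᵥ c = 0)
    (v : Fin d → ℝ) (a : ℝ) : projSum B (v - a • b) = projSum B v := by
  unfold projSum
  congr 1
  refine List.map_congr_left fun c hc => ?_
  rw [dotProduct_sub, dotProduct_smul, dotProduct_comm c b, h c hc, smul_zero, sub_zero]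

/-- The program takes each coefficient from the partially reduced vector. By orthogonality it agrees
with the coefficient of the original `v`. -/
lemma residual_fst {B : List (Fin d → ℝ)} (hB : OrthList B) (v : Fin d → ℝ) :
    (residual B v).exec.1 = v - projSum B v := by
  induction B generalizing v with
  | nil => simp [residual, projSum]
  | cons b B ih =>
    rw [orthList_cons] at hB
    simp only [residual, exec_bind_fst, dotC_fst, divC_fst, subScaled_fst]
    rw [ih hB.2, projSum_sub_smul hB.1.2, projSum_cons, sub_sub]

lemma residual_snd (B : List (Fin d → ℝ)) (v : Fin d → ℝ) :
    (residual B v).exec.2 = B.length * (6 * d + 3) := by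
  induction B generalizing v with
  | nil => simp [residual]
  | cons b B ih =>
    simp only [residual, exec_bind_snd, dotC_snd, divC_snd, subScaled_snd, ih, List.length_cons]
    ring

/-- If `v` lies in the span, the residual lies in the span and is orthogonal to it. -/
lemma residual_eq_zero_iff {B : List (Fin d → ℝ)} (hB : OrthList B) (v : Fin d → ℝ) :
    (residual B v).exec.1 = 0 ↔ v ∈ listSpan B := by
  rw [residual_fst hB, sub_eq_zero]
  refine ⟨fun h => h ▸ projSum_mem B v, fun h => ?_⟩
  have h1 : v - projSum B v ∈ listSpan B := Submodule.sub_mem _ h (projSum_mem B v)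
  have h2 : (v - projSum B v) ⬝ᵥ (v - projSum B v) = 0 := by
    refine dotProduct_eq_zero_of_mem_listSpan (fun c hc => ?_) h1
    rw [dotProduct_comm, dotProduct_sub, dotProduct_projSum hB v c hc, sub_self]
  exact sub_eq_zero.1 (dotProduct_self_eq_zero.1 h2)

lemma orthList_residual {B : List (Fin d → ℝ)} (hB : OrthList B) {v : Fin d → ℝ}
    (hv : v ∉ listSpan B) : OrthList ((residual B v).exec.1 :: B) := by
  rw [orthList_cons]
  refine ⟨⟨fun h => hv ((residual_eq_zero_iff hB v).1 h), fun c hc => ?_⟩, hB⟩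
  rw [residual_fst hB, dotProduct_comm, dotProduct_sub, dotProduct_projSum hB v c hc, sub_self]

lemma listSpan_residual {B : List (Fin d → ℝ)} (hB : OrthList B) (v : Fin d → ℝ) :
    listSpan ((residual B v).exec.1 :: B) = Submodule.span ℝ {v} ⊔ listSpan B := by
  rw [listSpan_cons, residual_fst hB]
  have hp := projSum_mem B v
  apply le_antisymm <;> refine sup_le ?_ le_sup_right <;>
    rw [Submodule.span_singleton_le_iff_mem]
  · exact Submodule.sub_mem _ (Submodule.mem_sup_left (Submodule.mem_span_singleton_self v))
      (Submodule.mem_sup_right hp)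
  · have := Submodule.add_mem_sup (Submodule.mem_span_singleton_self (R := ℝ) (v - projSum B v)) hp
    rwa [sub_add_cancel] at this

lemma length_eq_finrank {B : List (Fin d → ℝ)} (hB : OrthList B) :
    B.length = Module.finrank ℝ (listSpan B) := by
  have hli : LinearIndependent ℝ B.get := by
    rw [Fintype.linearIndependent_iff]
    intro c hc i
    have h1 : B.get i ⬝ᵥ ∑ j, c j • B.get j = c i * (B.get i ⬝ᵥ B.get i) := by
      rw [dotProduct_sum, Finset.sum_eq_single i]
      · rw [dotProduct_smul, smul_eq_mul]
      · intro j _ hji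
        rw [dotProduct_smul]
        have hp := List.pairwise_iff_get.1 hB.1
        rcases lt_or_gt_of_ne hji with h | h
        · rw [dotProduct_comm, hp _ _ h, smul_zero]
        · rw [hp _ _ h, smul_zero]
      · simp
    rw [hc, dotProduct_zero] at h1
    have h2 : B.get i ⬝ᵥ B.get i ≠ 0 := fun h =>
      hB.2 _ (List.get_mem B i) (dotProduct_self_eq_zero.1 h)
    exact (mul_eq_zero.1 h1.symm).resolve_right h2
  have h := finrank_span_eq_card hli
  rw [Fintype.card_fin] at h
  have hset : {b | b ∈ B} = Set.range B.get := by
    ext b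
    simp [List.mem_iff_get]
  rw [← h, listSpan, hset]

/-- Started with an empty `B` on the rows of a matrix, this yields an orthogonal basis of the row
space, whose length is the rank. -/
lemma gramSchmidt_spec (vs B : List (Fin d → ℝ)) (hB : OrthList B) :
    OrthList (gramSchmidt vs B).exec.1 ∧
      listSpan (gramSchmidt vs B).exec.1 = listSpan vs ⊔ listSpan B ∧
      (gramSchmidt vs B).exec.1.length ≤ vs.length + B.length ∧
      (gramSchmidt vs B).exec.2 ≤
        vs.length * ((vs.length + B.length) * (6 * d + 3) + (2 * d + 3)) := by
  classical
  induction vs generalizing B with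
  | nil => simp [gramSchmidt, hB, listSpan]
  | cons v vs ih =>
    simp only [gramSchmidt, exec_bind_fst, exec_bind_snd, isNonzero_fst, isNonzero_snd,
      residual_snd, decide_eq_true_eq, ne_eq, residual_eq_zero_iff hB, List.length_cons]
    rw [listSpan_cons v vs]
    by_cases hv : v ∈ listSpan B
    · simp only [hv, not_true_eq_false, if_false]
      obtain ⟨h1, h2, h3, h4⟩ := ih B hB
      refine ⟨h1, ?_, by omega, ?_⟩
      · rw [h2, sup_comm (Submodule.span ℝ {v}), sup_assoc,
          sup_eq_right.2 ((Submodule.span_singleton_le_iff_mem v (listSpan B)).2 hv)]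
      · nlinarith
    · simp only [hv, not_false_eq_true, if_true]
      obtain ⟨h1, h2, h3, h4⟩ := ih _ (orthList_residual hB hv)
      rw [List.length_cons] at h3 h4
      refine ⟨h1, ?_, by omega, ?_⟩
      · rw [h2, listSpan_residual hB, ← sup_assoc, sup_comm (listSpan vs)]
      · nlinarith

lemma listSpan_ofFn (M : Matrix (Fin m) (Fin n) ℝ) :
    listSpan (List.ofFn M) = Submodule.span ℝ (Set.range M.row) := by
  rw [listSpan]
  congr 1
  ext v
  exact List.mem_ofFn' M v

lemma length_ofFn_matrix (M : Matrix (Fin m) (Fin n) ℝ) :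
    (List.ofFn M : List (Fin n → ℝ)).length = m := List.length_ofFn

lemma rankC_fst (M : Matrix (Fin m) (Fin n) ℝ) : (rankC M).exec.1 = M.rank := by
  obtain ⟨h1, h2, -, -⟩ := gramSchmidt_spec (List.ofFn M) [] orthList_nil
  simp only [rankC, exec_bind_fst, exec_pure_fst]
  rw [length_eq_finrank h1, h2, listSpan_ofFn, rank_eq_finrank_span_row,
    listSpan_nil, sup_bot_eq]

lemma rankC_snd_le (M : Matrix (Fin m) (Fin n) ℝ) :
    (rankC M).exec.2 ≤ m * (m * (6 * n + 3) + (2 * n + 3)) := by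
  obtain ⟨-, -, -, h4⟩ := gramSchmidt_spec (List.ofFn M) [] orthList_nil
  rw [length_ofFn_matrix] at h4
  simpa [rankC] using h4

lemma subProjections_fst (B : List (Fin n → ℝ)) (P : Matrix (Fin n) (Fin n) ℝ) (v : Fin n → ℝ) :
    (subProjections B P).exec.1 *ᵥ v = P *ᵥ v - projSum B v := by
  induction B generalizing P with
  | nil => simp [subProjections, projSum]
  | cons b B ih =>
    simp only [subProjections, exec_bind_fst, tabMat_fst, dotC_fst, mulC_fst, divC_fst, subC_fst]
    rw [ih, projSum_cons, ← sub_sub]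
    congr 1
    funext i
    simp only [mulVec, dotProduct, of_apply, Pi.sub_apply, Pi.smul_apply, smul_eq_mul, sub_mul,
      Finset.sum_sub_distrib, Finset.sum_div, Finset.sum_mul]
    congr 1
    refine Finset.sum_congr rfl fun j _ => ?_
    ring

lemma subProjections_snd (B : List (Fin n → ℝ)) (P : Matrix (Fin n) (Fin n) ℝ) :
    (subProjections B P).exec.2 = B.length * (2 * n + 1 + 3 * (n * n)) := by
  induction B generalizing P with
  | nil => simp [subProjections]
  | cons b B ih =>
    simp only [subProjections, exec_bind_snd, tabMat_snd, dotC_snd, mulC_snd, divC_snd, subC_snd,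
      ih, List.length_cons]
    simp
    ring

lemma kernelProjC_snd_le (M : Matrix (Fin m) (Fin n) ℝ) :
    (kernelProjC M).exec.2 ≤ m * (m * (6 * n + 3) + (2 * n + 3)) + 2 +
      m * (2 * n + 1 + 3 * (n * n)) := by
  obtain ⟨-, -, h3, h4⟩ := gramSchmidt_spec (List.ofFn M) [] orthList_nil
  simp only [length_ofFn_matrix, List.length_nil, add_zero] at h3 h4
  simp only [kernelProjC, exec_bind_snd, natC_snd, subProjections_snd]
  nlinarith

/-- The identity minus the projection onto the row space. The rows vanish outside `S`, so the
computed matrix acts as the identity there, whereas Π is zero; hence the restriction to vectors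
supported on `S`. -/
lemma kernelProjC_spec {A : Matrix (Fin m) (Fin n) ℤ} (S : Finset (Fin n)) {v : Fin n → ℝ}
    (hv : ∀ j, j ∉ S → v j = 0) :
    (kernelProjC (Matrix.of fun i j => if j ∈ S then unitCols A i j else 0)).exec.1 *ᵥ v =
      kernelProj A S v := by
  set M : Matrix (Fin m) (Fin n) ℝ := Matrix.of fun i j => if j ∈ S then unitCols A i j else 0
    with hM
  obtain ⟨hB, hspan, -, -⟩ := gramSchmidt_spec (List.ofFn M) [] orthList_nil
  set B := (gramSchmidt (List.ofFn M) []).exec.1 with hBdef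
  have hspan' : listSpan B = Submodule.span ℝ (Set.range M.row) := by
    rw [hspan, listSpan_ofFn, listSpan_nil, sup_bot_eq]
  have hval : (kernelProjC M).exec.1 *ᵥ v = v - projSum B v := by
    simp only [kernelProjC, exec_bind_fst, natC_fst]
    rw [subProjections_fst, ← hBdef]
    congr 1
    have : (Matrix.of fun i j : Fin n => if i = j then ((1 : ℕ) : ℝ) else ((0 : ℕ) : ℝ)) = 1 := by
      ext i j
      simp [Matrix.one_apply]
    rw [this, one_mulVec]
  have hMmul : ∀ w : Fin n → ℝ, (∀ j, j ∉ S → w j = 0) → M *ᵥ w = unitCols A *ᵥ w := by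
    intro w hw
    funext i
    simp only [mulVec, dotProduct, hM, of_apply]
    refine Finset.sum_congr rfl fun j _ => ?_
    split_ifs with hj
    · rfl
    · simp [hw j hj]
  have hoff : ∀ w ∈ listSpan B, ∀ j, j ∉ S → w j = 0 := by
    intro w hw j hj
    rw [hspan'] at hw
    induction hw using Submodule.span_induction with
    | mem c hc =>
      obtain ⟨i, rfl⟩ := hc
      simp [hM, Matrix.row, hj]
    | zero => rfl
    | add u w _ _ hu hw => rw [Pi.add_apply, hu, hw, add_zero]
    | smul a u _ hu => rw [Pi.smul_apply, hu, smul_zero]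
  have horth : ∀ w : Fin n → ℝ, M *ᵥ w = 0 → ∀ b ∈ listSpan B, b ⬝ᵥ w = 0 := by
    intro w hw b hb
    rw [hspan'] at hb
    induction hb using Submodule.span_induction with
    | mem c hc =>
      obtain ⟨i, rfl⟩ := hc
      exact congrFun hw i
    | zero => exact zero_dotProduct w
    | add u u' _ _ hu hu' => rw [add_dotProduct, hu, hu', add_zero]
    | smul a u _ hu => rw [smul_dotProduct, hu, smul_zero]
  have hperp : ∀ b ∈ listSpan B, b ⬝ᵥ (v - projSum B v) = 0 := by
    intro b hb
    rw [dotProduct_comm]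
    refine dotProduct_eq_zero_of_mem_listSpan (fun c hc => ?_) hb
    rw [dotProduct_comm, dotProduct_sub, dotProduct_projSum hB v c hc, sub_self]
  have hoff' : ∀ j, j ∉ S → (v - projSum B v) j = 0 := fun j hj => by
    rw [Pi.sub_apply, hv j hj, hoff _ (projSum_mem B v) j hj, sub_zero]
  rw [hval]
  have hkey : (kernelOn A S).starProjection (WithLp.toLp 2 v) =
      WithLp.toLp 2 (v - projSum B v) := by
    apply Submodule.eq_starProjection_of_mem_of_inner_eq_zero
    · refine ⟨?_, hoff'⟩
      change unitCols A *ᵥ (v - projSum B v) = 0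
      rw [← hMmul _ hoff']
      funext i
      refine hperp (M i) ?_
      rw [hspan']
      exact Submodule.subset_span ⟨i, rfl⟩
    · rintro w ⟨hw, hwoff⟩
      have h1 := horth w.ofLp ((hMmul _ hwoff).trans hw) _ (projSum_mem B v)
      rw [← WithLp.toLp_sub, sub_sub_cancel]
      rw [EuclideanSpace.inner_eq_star_dotProduct]
      simpa [dotProduct_comm] using h1
  rw [kernelProj, hkey]

end Exec

/-! # The threshold -/

section Threshold

variable {m n : ℕ}

/-- The list is sorted by decreasing key. -/
def SortedDesc (key : Fin n → ℝ) (l : List (Fin n)) : Prop := l.Pairwise fun i j => key j ≤ key i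

lemma insertDesc_spec (key : Fin n → ℝ) (j : Fin n) (l : List (Fin n)) (hl : SortedDesc key l) :
    (insertDesc key j l).exec.1.Perm (j :: l) ∧ SortedDesc key (insertDesc key j l).exec.1 ∧
      (insertDesc key j l).exec.2 ≤ l.length := by
  induction l with
  | nil => simp [insertDesc, SortedDesc]
  | cons i l ih =>
    rw [SortedDesc, List.pairwise_cons] at hl
    obtain ⟨h1, h2, h3⟩ := ih hl.2
    simp only [insertDesc, exec_bind_fst, exec_bind_snd, ltC_fst, ltC_snd, decide_eq_true_eq,
      List.length_cons]
    by_cases h : key i < key j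
    · simp only [h, if_true, exec_pure_fst, exec_pure_snd]
      refine ⟨List.Perm.refl _, ?_, by omega⟩
      rw [SortedDesc, List.pairwise_cons, List.pairwise_cons]
      refine ⟨fun k hk => ?_, hl⟩
      rcases List.mem_cons.1 hk with rfl | hk
      · exact h.le
      · exact (hl.1 k hk).trans h.le
    · simp only [h, if_false, exec_bind_fst, exec_bind_snd, exec_pure_fst, exec_pure_snd]
      refine ⟨(h1.cons i).trans (List.Perm.swap j i l), ?_, by omega⟩
      rw [SortedDesc, List.pairwise_cons]
      refine ⟨fun k hk => ?_, h2⟩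
      rcases List.mem_cons.1 (h1.mem_iff.1 hk) with rfl | hk
      · exact not_lt.1 h
      · exact hl.1 k hk

lemma sortDesc_spec (key : Fin n → ℝ) (l : List (Fin n)) :
    (sortDesc key l).exec.1.Perm l ∧ SortedDesc key (sortDesc key l).exec.1 ∧
      (sortDesc key l).exec.2 ≤ l.length * l.length := by
  induction l with
  | nil => simp [sortDesc, SortedDesc]
  | cons j l ih =>
    obtain ⟨h1, h2, h3⟩ := ih
    obtain ⟨h4, h5, h6⟩ := insertDesc_spec key j _ h2
    simp only [sortDesc, exec_bind_fst, exec_bind_snd, List.length_cons]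
    refine ⟨h4.trans (h1.cons j), h5, ?_⟩
    rw [h1.length_eq] at h6
    nlinarith

lemma greedy_snd_le (M : Matrix (Fin m) (Fin n) ℝ) (key : Fin n → ℝ) (l : List (Fin n))
    (B : List (Fin m → ℝ)) (c : ℝ) :
    (greedy M key l B c).exec.2 ≤
      l.length * ((l.length + B.length) * (6 * m + 3) + (2 * m + 4)) := by
  classical
  induction l generalizing B c with
  | nil => simp [greedy]
  | cons j l ih =>
    simp only [greedy, exec_bind_snd, residual_snd, isNonzero_snd, List.length_cons]
    split_ifs
    · simp only [exec_bind_snd, mulC_snd]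
      have := ih ((residual B (M.col j)).exec.1 :: B) (mulC c (key j)).exec.1
      rw [List.length_cons] at this
      nlinarith
    · have := ih B c
      nlinarith

variable (A : Matrix (Fin m) (Fin n) ℤ)

lemma linearIndepOn_insert_iff {K : Finset (Fin n)} {j : Fin n} (hj : j ∉ K) :
    LinearIndepOn ℝ (unitCol A) ((insert j K : Finset (Fin n)) : Set (Fin n)) ↔
      LinearIndepOn ℝ (unitCol A) (K : Set (Fin n)) ∧ realCol A j ∉ colSpan A K := by
  rw [Finset.coe_insert, linearIndepOn_insert (by simpa using hj)]
  have h1 : ∀ p : Submodule ℝ (Fin m → ℝ), unitCol A j ∈ p ↔ realCol A j ∈ p := fun p =>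
    ⟨fun h => by rw [← colNorm_smul_unitCol]; exact p.smul_mem _ h,
      fun h => by rw [unitCol_eq]; exact p.smul_mem _ h⟩
  rw [← h1]
  rfl

lemma colSpan_insert (K : Finset (Fin n)) (j : Fin n) :
    colSpan A (insert j K) = Submodule.span ℝ {realCol A j} ⊔ colSpan A K := by
  rw [colSpan_eq_real, colSpan_eq_real, ← Submodule.span_union, Finset.coe_insert,
    Set.image_insert_eq, Set.singleton_union]

/-- The greedy algorithm maximizes the product of the keys over the independent sets. -/
lemma greedy_spec (key : Fin n → ℝ) (hkey0 : ∀ j, 0 ≤ key j)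
    (hkey : ∀ j, realCol A j ≠ 0 → 1 ≤ key j)
    (l : List (Fin n)) (hl : SortedDesc key l) (hnd : l.Nodup) (K : Finset (Fin n))
    (hK : LinearIndepOn ℝ (unitCol A) (K : Set (Fin n)))
    (B : List (Fin m → ℝ)) (hB : OrthList B) (hspan : listSpan B = colSpan A K) (c : ℝ) :
    ∃ G : Finset (Fin n), (∀ j ∈ G, j ∈ l) ∧ Disjoint K G ∧
      LinearIndepOn ℝ (unitCol A) ((K ∪ G : Finset (Fin n)) : Set (Fin n)) ∧
      (greedy (A.map (Int.cast : ℤ → ℝ)) key l B c).exec.1 = c * ∏ j ∈ G, key j ∧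
      ∀ I : Finset (Fin n), (∀ j ∈ I, j ∈ l) → Disjoint K I →
        LinearIndepOn ℝ (unitCol A) ((K ∪ I : Finset (Fin n)) : Set (Fin n)) →
        ∏ j ∈ I, key j ≤ ∏ j ∈ G, key j := by
  classical
  induction l generalizing K B c with
  | nil =>
    refine ⟨∅, by simp, by simp, by simpa using hK, by simp [greedy], fun I hI _ _ => ?_⟩
    have : I = ∅ := Finset.eq_empty_of_forall_notMem fun j hj => by simpa using hI j hj
    rw [this]
  | cons j l ih =>
    rw [SortedDesc, List.pairwise_cons] at hl
    rw [List.nodup_cons] at hnd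
    have hcol : (A.map (Int.cast : ℤ → ℝ)).col j = realCol A j := rfl
    simp only [greedy, exec_bind_fst, isNonzero_fst, decide_eq_true_eq, ne_eq,
      residual_eq_zero_iff hB, hcol]
    by_cases hj : realCol A j ∈ colSpan A K
    · have hj' : realCol A j ∈ listSpan B := hspan ▸ hj
      simp only [hj', not_true_eq_false, if_false]
      obtain ⟨G, h1, h2, h3, h4, h5⟩ := ih hl.2 hnd.2 K hK B hB hspan c
      refine ⟨G, fun i hi => List.mem_cons_of_mem _ (h1 i hi), h2, h3, h4, fun I hI hKI hli => ?_⟩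
      refine h5 I (fun i hi => ?_) hKI hli
      rcases List.mem_cons.1 (hI i hi) with rfl | h
      · exfalso
        have hiK : i ∉ K := Finset.disjoint_right.1 hKI hi
        have : LinearIndepOn ℝ (unitCol A) ((insert i K : Finset (Fin n)) : Set (Fin n)) := by
          refine hli.mono ?_
          rw [Finset.coe_subset]
          exact Finset.insert_subset (Finset.mem_union_right _ hi) Finset.subset_union_left
        exact ((linearIndepOn_insert_iff A hiK).1 this).2 hj
      · exact h
    · have hj' : realCol A j ∉ listSpan B := hspan ▸ hj
      simp only [hj', not_false_eq_true, if_true, exec_bind_fst, mulC_fst]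
      have hjK : j ∉ K := fun h => hj (by
        rw [colSpan_eq_real]; exact Submodule.subset_span ⟨j, h, rfl⟩)
      have hK' := (linearIndepOn_insert_iff A hjK).2 ⟨hK, hj⟩
      have hj0 : realCol A j ≠ 0 := fun h => hj (h ▸ Submodule.zero_mem _)
      obtain ⟨G, h1, h2, h3, h4, h5⟩ := ih hl.2 hnd.2 (insert j K) hK'
        _ (orthList_residual hB hj') (by rw [listSpan_residual hB, hspan, colSpan_insert])
        (c * key j)
      have hjG : j ∉ G := fun h => hnd.1 (h1 j h)
      refine ⟨insert j G, ?_, ?_, ?_, ?_, ?_⟩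
      · intro i hi
        rcases Finset.mem_insert.1 hi with rfl | h
        · exact List.mem_cons_self
        · exact List.mem_cons_of_mem _ (h1 i h)
      · rw [Finset.disjoint_insert_right]
        exact ⟨hjK, (Finset.disjoint_insert_left.1 h2).2⟩
      · rwa [Finset.union_insert, ← Finset.insert_union]
      · rw [h4, Finset.prod_insert hjG, mul_assoc]
      · intro I hI hKI hli
        -- The exchange argument: completing `K ∪ {j}` to a basis inside `K ∪ I ∪ {j}` drops at most
        -- one element of `I`. The sorting makes its key at most `key j`; if nothing is dropped, `1
        -- ≤ key j` suffices.
        obtain ⟨B', hKB, hBI, hB', hsp⟩ := exists_basis A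
          (Finset.insert_subset_insert j (Finset.subset_union_left (s₁ := K) (s₂ := I))) hK'
        set I' := B' \ insert j K with hI'
        have hI'I : I' ⊆ I := by
          intro i hi
          rw [hI', Finset.mem_sdiff, Finset.mem_insert, not_or] at hi
          have := hBI hi.1
          rw [Finset.mem_insert, Finset.mem_union] at this
          tauto
        have hjI' : j ∉ I' := by simp [hI']
        have hunion : insert j K ∪ I' = B' := Finset.union_sdiff_of_subset hKB
        have hcard : I.card ≤ I'.card + 1 := by
          have e1 : K.card + I.card ≤ B'.card := by
            rw [← Finset.card_union_of_disjoint hKI, colRank_eq_card A hli, colRank_eq_card A hB',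
              colRank_eq A B', hsp, ← colRank_eq]
            exact colRank_mono A (Finset.subset_insert _ _)
          have e2 : I'.card = B'.card - (insert j K).card := Finset.card_sdiff_of_subset hKB
          rw [Finset.card_insert_of_notMem hjK] at e2
          omega
        have hprod : ∏ i ∈ I \ I', key i ≤ key j := by
          have hc1 : (I \ I').card ≤ 1 := by
            rw [Finset.card_sdiff_of_subset hI'I]; omega
          have : Nonempty (Fin n) := ⟨j⟩
          rcases Finset.card_le_one_iff_subset_singleton.1 hc1 with ⟨i, hi⟩
          rcases Finset.subset_singleton_iff.1 hi with h | h
          · rw [h, Finset.prod_empty]; exact hkey j hj0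
          · rw [h, Finset.prod_singleton]
            have hiI : i ∈ I := Finset.sdiff_subset (h ▸ Finset.mem_singleton_self i : i ∈ I \ I')
            rcases List.mem_cons.1 (hI i hiI) with rfl | h'
            · exact le_rfl
            · exact hl.1 i h'
        have hrec := h5 I' (fun i hi => by
            rcases List.mem_cons.1 (hI i (hI'I hi)) with rfl | h'
            · exact absurd hi hjI'
            · exact h') Finset.disjoint_sdiff (by rwa [hunion])
        rw [← Finset.prod_sdiff hI'I, Finset.prod_insert hjG]
        exact mul_le_mul hprod hrec (Finset.prod_nonneg fun i _ => hkey0 i) (hkey0 j)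

/-- With squared norms as keys, the greedy optimum is Δ² itself. Keys of nonzero columns are at
least 1, because they are positive integers. -/
lemma thresholdC_fst :
    (thresholdC (A.map (Int.cast : ℤ → ℝ)) fun j => colNorm A j ^ 2).exec.1 = (theta A)⁻¹ := by
  obtain ⟨h1, h2, -⟩ := sortDesc_spec (fun j => colNorm A j ^ 2) (List.finRange n)
  have hmem : ∀ j, j ∈ (sortDesc (fun j => colNorm A j ^ 2) (List.finRange n)).exec.1 :=
    fun j => h1.mem_iff.2 (List.mem_finRange j)
  have hkey : ∀ j, realCol A j ≠ 0 → 1 ≤ colNorm A j ^ 2 := fun j hj => by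
    refine one_le_pow₀ (one_le_colNorm A fun h => hj ?_)
    rw [← colNorm_smul_unitCol, h, smul_zero]
  obtain ⟨G, -, -, hG, hval, hmax⟩ := greedy_spec A (fun j => colNorm A j ^ 2)
    (fun j => sq_nonneg _) hkey _ h2 (h1.nodup_iff.2 (List.nodup_finRange n)) ∅ (by simp) []
    orthList_nil (by rw [listSpan_nil]; simp [colSpan]) 1
  have hG2 : ∏ j ∈ G, colNorm A j ^ 2 = delta A ^ 2 := by
    apply le_antisymm
    · rw [Finset.prod_pow]
      have h3 : 0 ≤ ∏ j ∈ G, colNorm A j := Finset.prod_nonneg fun j _ => colNorm_nonneg A j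
      have h4 := prod_le_delta A (B := G) (by simpa using hG)
      gcongr
    · obtain ⟨I, hI, hd⟩ := exists_delta_eq A
      rw [hd, ← Finset.prod_pow]
      exact hmax I (fun j _ => hmem j) (by simp) (by simpa using hI)
  simp only [thresholdC, exec_bind_fst, natC_fst, mulC_fst, Nat.cast_one]
  rw [hval, one_mul, hG2, theta_inv_eq, sq (m : ℝ)]

lemma thresholdC_snd_le (M : Matrix (Fin m) (Fin n) ℝ) (sq : Fin n → ℝ) :
    (thresholdC M sq).exec.2 ≤ n * n + n * (n * (6 * m + 3) + (2 * m + 4)) + 4 := by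
  obtain ⟨h1, -, h3⟩ := sortDesc_spec sq (List.finRange n)
  have h4 := greedy_snd_le M sq (sortDesc sq (List.finRange n)).exec.1 [] ((1 : ℕ) : ℝ)
  rw [h1.length_eq] at h4
  simp only [List.length_finRange, List.length_nil, add_zero] at h3 h4
  simp only [thresholdC, exec_bind_snd, natC_snd, mulC_snd, natC_fst]
  omega

/-- The data computed by `prepare`. -/
noncomputable def fixedData : Fixed ℝ m n :=
  ⟨A.map (Int.cast : ℤ → ℝ), unitCols A, colNorm A, (theta A)⁻¹, eps m⟩

lemma prepare_fst : (prepare (A.map (Int.cast : ℤ → ℝ))).exec.1 = fixedData A := by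
  have hsq : ∀ j, (A.map (Int.cast : ℤ → ℝ)).col j ⬝ᵥ (A.map (Int.cast : ℤ → ℝ)).col j =
      colNorm A j ^ 2 := fun j => by
    rw [colNorm_sq_eq_qInner, qInner_one]; rfl
  simp only [prepare, exec_bind_fst, tab_fst, tabMat_fst, dotC_fst, sqrtC_fst, natC_fst, mulC_fst,
    divC_fst, ltC_fst, exec_pure_fst, hsq, thresholdC_fst, Real.sqrt_sq (colNorm_nonneg A _),
    decide_eq_true_eq, Nat.cast_zero, Nat.cast_one]
  have hunit : (Matrix.of fun i j => (if 0 < colNorm A j then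
      divC (A.map (Int.cast : ℤ → ℝ) i j) (colNorm A j) else pure 0 : Comp ℝ ℝ).exec.1) =
      unitCols A := by
    ext i j
    simp only [of_apply, unitCols]
    split_ifs with h
    · rfl
    · rw [le_antisymm (not_lt.1 h) (colNorm_nonneg A j), div_zero]; rfl
  rw [hunit, fixedData, eps]
  norm_num

lemma prepare_snd_le (M : Matrix (Fin m) (Fin n) ℝ) :
    (prepare M).exec.2 ≤ n * (2 * m + 1) + n +
      (n * n + n * (n * (6 * m + 3) + (2 * m + 4)) + 4) + 2 * (m * n) + 6 := by
  simp only [prepare, exec_bind_snd, tab_snd, tabMat_snd, dotC_snd, sqrtC_snd, natC_snd, mulC_snd,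
    divC_snd, exec_pure_snd, ltC_snd]
  have h1 := thresholdC_snd_le M (tab fun j => dotC (M.col j) (M.col j)).exec.1
  have h2 : ∀ (f g : Fin m → Fin n → Comp ℝ ℝ) (p : Fin m → Fin n → Prop)
      [∀ i j, Decidable (p i j)], (∀ i j, (f i j).exec.2 ≤ 1) → (∀ i j, (g i j).exec.2 ≤ 1) →
      ∑ i, ∑ j, (1 + (if p i j then f i j else g i j).exec.2) ≤ 2 * (m * n) := by
    intro f g p _ hf hg
    calc _ ≤ ∑ _i : Fin m, ∑ _j : Fin n, 2 := by
          refine Finset.sum_le_sum fun i _ => Finset.sum_le_sum fun j _ => ?_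
          have := hf i j
          have := hg i j
          split_ifs <;> omega
      _ = _ := by simp; ring
  simp only [Finset.sum_const, Finset.card_univ, Fintype.card_fin, smul_eq_mul]
  refine (Nat.add_le_add le_rfl (Nat.add_le_add le_rfl (Nat.add_le_add h1 (Nat.add_le_add le_rfl
    (Nat.add_le_add (h2 _ _ _ (fun _ _ => le_rfl) fun _ _ => Nat.zero_le _) le_rfl))))).trans ?_
  omega

end Threshold

/-! # The program follows the algorithm -/

section Simulation

variable {m n : ℕ} {A : Matrix (Fin m) (Fin n) ℤ}

/-- The auxiliary quantities of the program are up to date. -/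
structure WorkInv (A : Matrix (Fin m) (Fin n) ℤ) (w : Work ℝ m n) : Prop where
  F_eq : ∀ i j, w.F i j = qInner w.Q (unitCol A i) (unitCol A j)
  z_eq : ∀ j, w.z j = qInner w.Q (unitCol A j) w.y
  P_eq : ∀ v : Fin n → ℝ, (∀ j, j ∉ w.S → v j = 0) → w.P *ᵥ v = kernelProj A w.S v
  p_eq : w.p = kernelProj A w.S w.x

lemma allPos_spec (S : Finset (Fin n)) (p : Fin n → ℝ) (l : List (Fin n)) :
    ((allPos S p l).exec.1 = true ↔ ∀ j ∈ l, j ∈ S → 0 < p j) ∧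
      (allPos S p l).exec.2 ≤ 2 * l.length := by
  classical
  induction l with
  | nil => simp [allPos]
  | cons j l ih =>
    simp only [allPos, List.length_cons, List.forall_mem_cons]
    by_cases hj : j ∈ S
    · simp only [hj, if_true, exec_bind_fst, exec_bind_snd, natC_fst, natC_snd, ltC_fst, ltC_snd,
        decide_eq_true_eq, Nat.cast_zero]
      by_cases hp : 0 < p j
      · simp only [hp, if_true, ih.1]
        refine ⟨by simp, ?_⟩
        have := ih.2
        omega
      · simp only [hp, if_false, exec_pure_fst, exec_pure_snd]
        refine ⟨by simp, by omega⟩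
    · simp only [hj, if_false, ih.1]
      refine ⟨by simp, ?_⟩
      have := ih.2
      omega

lemma finished_spec {w : Work ℝ m n} (hW : WorkInv A w) :
    ((finished w).exec.1 = true ↔ Done A w.toState) ∧ (finished w).exec.2 ≤ 2 * n := by
  unfold finished Done
  by_cases hS : w.S = ∅
  · simp [hS]
  · obtain ⟨h1, h2⟩ := allPos_spec w.S w.p (List.finRange n)
    rw [List.length_finRange] at h2
    simp only [hS, if_false, false_or]
    refine ⟨h1.trans ?_, h2⟩
    simp only [List.mem_finRange, true_imp_iff, hW.p_eq]

/-- `best` is the minimizer among the indices read so far. The two clauses about `none` exclude a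
failure when a listed index lies in `S`. -/
lemma argminC_spec (S : Finset (Fin n)) (q : Fin n → ℝ) (l : List (Fin n)) (best : Option (Fin n))
    (hbest : ∀ b, best = some b → b ∈ S) :
    (∀ k, (argminC S q l best).exec.1 = some k →
      k ∈ S ∧ (∀ b, best = some b → q k ≤ q b) ∧ ∀ j ∈ l, j ∈ S → q k ≤ q j) ∧
    ((argminC S q l best).exec.1 = none → ∀ j ∈ l, j ∉ S) ∧
    ((argminC S q l best).exec.1 = none → best = none) ∧
    (argminC S q l best).exec.2 ≤ l.length := by
  classical
  induction l generalizing best with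
  | nil =>
    simp only [argminC, exec_pure_fst, exec_pure_snd]
    refine ⟨fun k hk => ⟨hbest k hk, fun b hb => ?_, by simp⟩, by simp, id, by simp⟩
    rw [hk] at hb
    rw [Option.some.inj hb]
  | cons j l ih =>
    by_cases hj : j ∈ S
    · cases best with
      | none =>
        simp only [argminC, hj, if_true, List.length_cons]
        obtain ⟨h1, h2, h3, h4⟩ := ih (some j) (fun b hb => Option.some.inj hb ▸ hj)
        refine ⟨fun k hk => ?_, fun hn => ?_, fun _ => trivial, by omega⟩
        · obtain ⟨e1, e2, e3⟩ := h1 k hk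
          refine ⟨e1, by simp, fun i hi hiS => ?_⟩
          rcases List.mem_cons.1 hi with rfl | hi
          · exact e2 _ rfl
          · exact e3 i hi hiS
        · exact absurd (h3 hn) (by simp)
      | some b =>
        have hb := hbest b rfl
        simp only [argminC, hj, if_true, List.length_cons, exec_bind_fst, exec_bind_snd, ltC_fst,
          ltC_snd, decide_eq_true_eq]
        by_cases hlt : q j < q b
        · simp only [hlt, if_true]
          obtain ⟨h1, h2, h3, h4⟩ := ih (some j) (fun b hb => Option.some.inj hb ▸ hj)
          refine ⟨fun k hk => ?_, fun hn => absurd (h3 hn) (by simp),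
            fun hn => absurd (h3 hn) (by simp), by omega⟩
          obtain ⟨e1, e2, e3⟩ := h1 k hk
          refine ⟨e1, fun b' hb' => ?_, fun i hi hiS => ?_⟩
          · rw [← Option.some.inj hb']
            exact (e2 j rfl).trans hlt.le
          · rcases List.mem_cons.1 hi with rfl | hi
            · exact e2 _ rfl
            · exact e3 i hi hiS
        · simp only [hlt, if_false]
          obtain ⟨h1, h2, h3, h4⟩ := ih (some b) (fun b' hb' => Option.some.inj hb' ▸ hb)
          refine ⟨fun k hk => ?_, fun hn => absurd (h3 hn) (by simp),
            fun hn => absurd (h3 hn) (by simp), by omega⟩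
          obtain ⟨e1, e2, e3⟩ := h1 k hk
          refine ⟨e1, e2, fun i hi hiS => ?_⟩
          rcases List.mem_cons.1 hi with rfl | hi
          · exact (e2 b rfl).trans (not_lt.1 hlt)
          · exact e3 i hi hiS
    · simp only [argminC, hj, if_false, List.length_cons]
      obtain ⟨h1, h2, h3, h4⟩ := ih best hbest
      refine ⟨fun k hk => ?_, fun hn i hi => ?_, h3, by omega⟩
      · obtain ⟨e1, e2, e3⟩ := h1 k hk
        refine ⟨e1, e2, fun i hi hiS => ?_⟩
        rcases List.mem_cons.1 hi with rfl | hi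
        · exact absurd hiS hj
        · exact e3 i hi hiS
      · rcases List.mem_cons.1 hi with rfl | hi
        · exact hj
        · exact h2 hn i hi

lemma longColsC_spec (S : Finset (Fin n)) (F : Matrix (Fin n) (Fin n) ℝ) (t : ℝ)
    (l : List (Fin n)) (T : Finset (Fin n)) :
    (∀ k, k ∈ (longColsC S F t l T).exec.1 ↔ k ∈ T ∨ (k ∈ l ∧ k ∈ S ∧ t < √(F k k))) ∧
      (longColsC S F t l T).exec.2 ≤ 2 * l.length := by
  classical
  induction l generalizing T with
  | nil => simp [longColsC]
  | cons j l ih =>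
    simp only [longColsC, List.length_cons]
    by_cases hj : j ∈ S ∧ j ∉ T
    · simp only [hj, not_false_eq_true, and_self, if_true, exec_bind_fst, exec_bind_snd, sqrtC_fst,
        sqrtC_snd, ltC_fst, ltC_snd, decide_eq_true_eq]
      by_cases ht : t < √(F j j)
      · simp only [ht, if_true]
        refine ⟨fun k => ?_, by have := (ih (insert j T)).2; omega⟩
        rw [(ih (insert j T)).1, Finset.mem_insert, List.mem_cons]
        constructor
        · rintro ((rfl | h) | h)
          · exact Or.inr ⟨Or.inl rfl, hj.1, ht⟩
          · exact Or.inl h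
          · exact Or.inr ⟨Or.inr h.1, h.2⟩
        · rintro (h | ⟨rfl | h, h'⟩)
          · exact Or.inl (Or.inr h)
          · exact Or.inl (Or.inl rfl)
          · exact Or.inr ⟨h, h'⟩
      · simp only [ht, if_false]
        refine ⟨fun k => ?_, by have := (ih T).2; omega⟩
        rw [(ih T).1, List.mem_cons]
        constructor
        · rintro (h | h)
          · exact Or.inl h
          · exact Or.inr ⟨Or.inr h.1, h.2⟩
        · rintro (h | ⟨rfl | h, h'⟩)
          · exact Or.inl h
          · exact absurd h'.2 ht
          · exact Or.inr ⟨h, h'⟩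
    · simp only [hj, if_false]
      refine ⟨fun k => ?_, by have := (ih T).2; omega⟩
      rw [(ih T).1, List.mem_cons]
      constructor
      · rintro (h | h)
        · exact Or.inl h
        · exact Or.inr ⟨Or.inr h.1, h.2⟩
      · rintro (h | ⟨rfl | h, h'⟩)
        · exact Or.inl h
        · rw [not_and, not_not] at hj
          exact Or.inl (hj h'.1)
        · exact Or.inr ⟨h, h'⟩

lemma rank_keepCols (S : Finset (Fin n)) :
    (Matrix.of fun i j => if j ∈ S then A.map (Int.cast : ℤ → ℝ) i j else 0 :
      Matrix (Fin m) (Fin n) ℝ).rank = colRank A S := by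
  rw [rank_eq_finrank_span_cols, colRank_eq, colSpan_eq_real]
  have hcol : ∀ j, (Matrix.of fun i j => if j ∈ S then A.map (Int.cast : ℤ → ℝ) i j else 0 :
      Matrix (Fin m) (Fin n) ℝ).col j = if j ∈ S then realCol A j else 0 := by
    intro j
    funext i
    simp only [col_apply, of_apply]
    split_ifs <;> rfl
  refine congrArg (fun p : Submodule ℝ (Fin m → ℝ) => Module.finrank ℝ p) ?_
  apply le_antisymm <;> rw [Submodule.span_le]
  · rintro _ ⟨j, rfl⟩
    rw [hcol]
    split_ifs with hj
    · exact Submodule.subset_span ⟨j, hj, rfl⟩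
    · exact Submodule.zero_mem _
  · rintro _ ⟨j, hj, rfl⟩
    refine Submodule.subset_span ⟨j, ?_⟩
    rw [hcol, if_pos (by exact_mod_cast hj)]

/-! ## The beginning of a round -/

/-- A bound for the cost of `beginRound`. -/
def roundCost (m n : ℕ) : ℕ :=
  3 + m * (2 * n + 1) + 2 * (n * (2 * n + 1)) +
    (m * (m * (6 * n + 3) + (2 * n + 3)) + 2 + m * (2 * n + 1 + 3 * (n * n)))

lemma beginRound_spec (S : Finset (Fin n)) {Q : Matrix (Fin m) (Fin m) ℝ}
    {F : Matrix (Fin n) (Fin n) ℝ} (hF : ∀ i j, F i j = qInner Q (unitCol A i) (unitCol A j)) :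
    (beginRound (fixedData A) S Q F).exec.1.toState =
      ⟨onesOn S, unitCols A *ᵥ onesOn S, S, ∅, Q⟩ ∧
    WorkInv A (beginRound (fixedData A) S Q F).exec.1 ∧
    (beginRound (fixedData A) S Q F).exec.2 ≤ roundCost m n := by
  have hx : (fun j => if j ∈ S then ((1 : ℕ) : ℝ) else ((0 : ℕ) : ℝ)) = onesOn S := by
    funext j; simp [onesOn]
  have hones : ∀ j, j ∉ S → onesOn S j = 0 := fun j hj => if_neg hj
  simp only [beginRound, exec_bind_fst, exec_bind_snd, natC_fst, natC_snd, mulVecC_fst,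
    mulVecC_snd, keepCols_fst, keepCols_snd, exec_pure_fst, exec_pure_snd, hx]
  refine ⟨rfl, ⟨hF, fun j => ?_, fun v hv => kernelProjC_spec S hv, kernelProjC_spec S hones⟩, ?_⟩
  · change (F *ᵥ onesOn S) j = qInner Q (unitCol A j) (unitCols A *ᵥ onesOn S)
    rw [unitCols_mulVec, qInner_sum_right]
    simp only [mulVec, dotProduct, hF, qInner_smul_right, mul_comm]
  · have := kernelProjC_snd_le
      (Matrix.of fun i j => if j ∈ S then (fixedData A).unit i j else 0)
    rw [roundCost]
    omega

lemma firstRound_spec :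
    (firstRound (fixedData A)).exec.1.toState = start A ∧
    WorkInv A (firstRound (fixedData A)).exec.1 ∧
    (firstRound (fixedData A)).exec.2 ≤ n * (n * (2 * m + 1)) + 2 + roundCost m n := by
  have hone : (Matrix.of fun i j : Fin m => if i = j then ((1 : ℕ) : ℝ) else ((0 : ℕ) : ℝ)) = 1 := by
    ext i j
    simp [Matrix.one_apply]
  have hF : ∀ i j, (Matrix.of fun i j => (fixedData A).unit.col i ⬝ᵥ (fixedData A).unit.col j :
      Matrix (Fin n) (Fin n) ℝ) i j = qInner 1 (unitCol A i) (unitCol A j) := by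
    intro i j
    rw [qInner_one]
    rfl
  obtain ⟨h1, h2, h3⟩ := beginRound_spec (A := A) Finset.univ hF
  simp only [firstRound, exec_bind_fst, exec_bind_snd, tabMat_fst, tabMat_snd, dotC_fst, dotC_snd,
    natC_fst, natC_snd, hone]
  refine ⟨h1, h2, ?_⟩
  simp only [Finset.sum_const, Finset.card_univ, Fintype.card_fin, smul_eq_mul]
  omega

/-! ## Updates and rescalings -/

lemma kernelProj_sub_smul (S : Finset (Fin n)) (x v : Fin n → ℝ) (c : ℝ) :
    kernelProj A S (x - c • v) = kernelProj A S x - c • kernelProj A S v := by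
  unfold kernelProj
  rw [WithLp.toLp_sub, WithLp.toLp_smul, map_sub, map_smul]
  rfl

/-- `y`, `z` and `p` depend linearly on `x`, and adding a multiple of e_k to `x` changes each by a
multiple of a stored column. For `p` this is column `k` of `P`, which equals Πe_k because `k ∈ S`.
-/
lemma dvC_spec {w : Work ℝ m n} (hQ : w.Q.PosDef) (hW : WorkInv A w) {k : Fin n} (hk : k ∈ w.S) :
    (dvC (fixedData A) w k).exec.1.toState = dvUpdate A w.toState k ∧
    WorkInv A (dvC (fixedData A) w k).exec.1 ∧
    (dvC (fixedData A) w k).exec.2 ≤ 2 * m + 4 * n + 2 := by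
  have hc : w.z k / w.F k k = stepLength A w.toState k := by
    rw [hW.z_eq, hW.F_eq, ← qNorm_sq hQ]
    rfl
  have hx : Function.update w.x k (w.x k - stepLength A w.toState k) =
      w.x - stepLength A w.toState k • Pi.single k 1 := by
    funext j
    rcases eq_or_ne j k with rfl | hj
    · simp
    · simp [hj]
  simp only [dvC, exec_bind_fst, exec_bind_snd, divC_fst, divC_snd, subC_fst, subC_snd,
    subScaled_fst, subScaled_snd, exec_pure_fst, exec_pure_snd, hc, hx]
  refine ⟨rfl, ⟨hW.F_eq, fun j => ?_, hW.P_eq, ?_⟩, by omega⟩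
  · change w.z j - stepLength A w.toState k * w.F j k =
      qInner w.Q (unitCol A j) (w.y - stepLength A w.toState k • unitCol A k)
    rw [hW.z_eq, hW.F_eq, sub_eq_add_neg w.y, ← neg_smul, qInner_add_right, qInner_smul_right]
    ring
  · change w.p - stepLength A w.toState k • w.P.col k =
      kernelProj A w.S (w.x - stepLength A w.toState k • Pi.single k 1)
    rw [kernelProj_sub_smul, hW.p_eq, ← mulVec_single_one, hW.P_eq]
    intro j hj
    exact Pi.single_eq_of_ne (fun e => hj (by rw [e]; exact hk)) 1

/-- A bound for the cost of `rescaleC`, apart from `beginRound`. -/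
def rescaleCost (m n : ℕ) : ℕ :=
  5 + 2 * (m * (2 * m + 1)) + (4 + 4 * (m * m) + 4 * (n * n)) + n * (2 * m + 1) + 2 * n +
    2 * (1 + m * (m * (6 * n + 3) + (2 * n + 3)))

lemma rankOneUpdate_fst {d : ℕ} (M : Matrix (Fin d) (Fin d) ℝ) (v : Fin d → ℝ) (b c : ℝ) :
    (rankOneUpdate M v b c).exec.1 =
      Matrix.of fun i j => (M i j + 3 / b * (v i * v j)) / c := by
  simp [rankOneUpdate]

lemma rankOneUpdate_snd {d : ℕ} (M : Matrix (Fin d) (Fin d) ℝ) (v : Fin d → ℝ) (b c : ℝ) :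
    (rankOneUpdate M v b c).exec.2 = 2 + 4 * (d * d) := by
  simp [rankOneUpdate]
  ring

lemma rankOneUpdate_rescaledQ {Q : Matrix (Fin m) (Fin m) ℝ} (hQ : Q.PosDef) (y : Fin m → ℝ) :
    (rankOneUpdate Q (Q *ᵥ y) (qNorm Q y ^ 2)
      ((1 + 3 * eps m) * (1 + 3 * eps m))).exec.1 = rescaledQ Q y := by
  rw [rankOneUpdate_fst, rescaledQ, vecMul_eq_mulVec hQ]
  ext i j
  simp [vecMulVec_apply]
  ring

/-- Because ÂᵀQy = z, the matrix F = ÂᵀQÂ undergoes the same kind of rank one update as `Q`, at cost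
O(n²). `P` and `p` do not depend on `Q`. -/
lemma rescaleC_spec {w : Work ℝ m n} (hQ : w.Q.PosDef) (hW : WorkInv A w) {b : ℝ}
    (hb : b = qNorm w.Q w.y ^ 2) :
    (¬ colRank A ((rescaleUpdate A w.toState).S \ (rescaleUpdate A w.toState).T) <
        colRank A (rescaleUpdate A w.toState).S →
      (rescaleC (fixedData A) w b).exec.1.toState = rescaleUpdate A w.toState ∧
      WorkInv A (rescaleC (fixedData A) w b).exec.1 ∧
      (rescaleC (fixedData A) w b).exec.2 ≤ rescaleCost m n) ∧
    (colRank A ((rescaleUpdate A w.toState).S \ (rescaleUpdate A w.toState).T) <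
        colRank A (rescaleUpdate A w.toState).S →
      (rescaleC (fixedData A) w b).exec.1.toState = remove A (rescaleUpdate A w.toState) ∧
      WorkInv A (rescaleC (fixedData A) w b).exec.1 ∧
      (rescaleC (fixedData A) w b).exec.2 ≤ rescaleCost m n + roundCost m n) := by
  classical
  have hQ' : (rescaledQ w.Q w.y).PosDef := rescaledQ_posDef hQ w.y
  set F' := (rankOneUpdate w.F w.z b ((1 + 3 * eps m) * (1 + 3 * eps m))).exec.1 with hF'def
  have hF' : ∀ i j, F' i j = qInner (rescaledQ w.Q w.y) (unitCol A i) (unitCol A j) := by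
    intro i j
    rw [hF'def, rankOneUpdate_fst, qInner_rescaledQ hQ, hb]
    simp only [of_apply, hW.F_eq, hW.z_eq]
    ring
  have hQeq := rankOneUpdate_rescaledQ hQ w.y
  rw [← hb] at hQeq
  have hT : (longColsC w.S F' (theta A)⁻¹ (List.finRange n) w.T).exec.1 =
      (rescaleUpdate A w.toState).T := by
    ext k
    rw [(longColsC_spec _ _ _ _ _).1, hF']
    simp only [rescaleUpdate, List.mem_finRange, true_and, Finset.mem_union, Finset.mem_filter,
      Finset.mem_sdiff]
    have : (theta A)⁻¹ < qNorm (rescaledQ w.Q w.y) ((unitCols A).col k) ↔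
      (theta A)⁻¹ < √(qInner (rescaledQ w.Q w.y) (unitCol A k) (unitCol A k)) := Iff.rfl
    rw [this]
    tauto
  have hTcost := (longColsC_spec w.S F' (theta A)⁻¹ (List.finRange n) w.T).2
  rw [List.length_finRange] at hTcost
  set T' := (rescaleUpdate A w.toState).T with hT'
  have hz : ((fixedData A).unit.transpose *ᵥ (rescaledQ w.Q w.y *ᵥ w.y)) =
      fun j => qInner (rescaledQ w.Q w.y) (unitCol A j) w.y := rfl
  have hfix : (fixedData A).A = A.map (Int.cast : ℤ → ℝ) := rfl
  have hS : (rescaleUpdate A w.toState).S = w.S := rfl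
  have heps : (fixedData A).eps = eps m := rfl
  have hthr : (fixedData A).threshold = (theta A)⁻¹ := rfl
  have hr1 := rankC_snd_le (n := n)
    (Matrix.of fun i j => if j ∈ w.S \ T' then A.map (Int.cast : ℤ → ℝ) i j else 0)
  have hr2 := rankC_snd_le (n := n)
    (Matrix.of fun i j => if j ∈ w.S then A.map (Int.cast : ℤ → ℝ) i j else 0)
  simp only [rescaleC, exec_bind_fst, exec_bind_snd, natC_fst, natC_snd, mulC_fst, mulC_snd,
    addC_fst, addC_snd, mulVecC_fst, mulVecC_snd, keepCols_fst, keepCols_snd, Nat.cast_one,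
    Nat.cast_ofNat, heps, hthr, rankOneUpdate_snd, hQeq, ← hF'def, hT, hfix, rankC_fst,
    rank_keepCols, hS]
  refine ⟨fun hr => ?_, fun hr => ?_⟩
  · simp only [hr, if_false, exec_pure_fst, exec_pure_snd]
    refine ⟨rfl, ⟨hF', fun j => congrFun hz j, hW.P_eq, hW.p_eq⟩, ?_⟩
    rw [rescaleCost]
    omega
  · obtain ⟨h1, h2, h3⟩ := beginRound_spec (A := A) (w.S \ T') hF'
    simp only [hr, if_true]
    refine ⟨h1, h2, ?_⟩
    rw [rescaleCost]
    omega

/-! ## One iteration -/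

variable {D N : ℕ}

/-- A bound for the cost of an update, including the test whether the algorithm has finished. -/
def dvCost (m n : ℕ) : ℕ := 2 * m + 12 * n + 9

/-- A bound for the cost of a rescaling iteration, including the test whether the algorithm has
finished. -/
def rescaleIterCost (m n : ℕ) : ℕ := 8 * n + 7 + rescaleCost m n

/-- The effect and the cost of an iteration of each kind. -/
inductive Progress (A : Matrix (Fin m) (Fin n) ℤ) (D N : ℕ) (s s' : State ℝ m n) (cost : ℕ) : Prop
  | dv (hI : Inv A (D + 1) N s') (hr : colRank A s'.S = colRank A s.S)
      (hc : cost ≤ dvCost m n)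
  | rescale (hI : Inv A D (N + 1) s') (hr : colRank A s'.S = colRank A s.S)
      (hc : cost ≤ rescaleIterCost m n)
  | remove (hI : Inv A D (N + 1) s') (hr : colRank A s'.S < colRank A s.S)
      (hc : cost ≤ rescaleIterCost m n + roundCost m n)

lemma bodyC_spec (h : Sizes A) {w : Work ℝ m n} (hI : Inv A D N w.toState)
    (hd : ¬ Done A w.toState) (hW : WorkInv A w) :
    Step A w.toState (bodyC (fixedData A) w).exec.1.toState ∧
    WorkInv A (bodyC (fixedData A) w).exec.1 ∧
    Progress A D N w.toState (bodyC (fixedData A) w).exec.1.toState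
      ((finished w).exec.2 + (bodyC (fixedData A) w).exec.2) := by
  classical
  have hQ : w.Q.PosDef := hI.posDef
  have hfin := (finished_spec hW).2
  have hlen : ∀ j, √(w.F j j) = qNorm w.Q (unitCol A j) := fun j => by rw [hW.F_eq]; rfl
  have hq : (fun j => (if 0 < qNorm w.Q (unitCol A j) then
      divC (w.z j) (qNorm w.Q (unitCol A j)) else pure 0 : Comp ℝ ℝ).exec.1) =
      cosine A w.toState := by
    funext j
    have hcos : cosine A w.toState j =
      qInner w.Q (unitCol A j) w.y / qNorm w.Q (unitCol A j) := rfl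
    rw [hcos]
    split_ifs with hj
    · rw [divC_fst, hW.z_eq]
    · rw [le_antisymm (not_lt.1 hj) (qNorm_nonneg _ _), div_zero]
      rfl
  -- As y = ∑ x_j â_j, the norm of `y` is obtained from `z` in O(n) operations, without a
  -- multiplication by `Q`.
  have hysq : w.x ⬝ᵥ w.z = qNorm w.Q w.y ^ 2 := by
    have h1 : w.y = ∑ j, w.x j • unitCol A j := by
      rw [← unitCols_mulVec]
      exact hI.y_eq
    have h2 : qInner w.Q w.y w.y = qInner w.Q (∑ j, w.x j • unitCol A j) w.y := by rw [← h1]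
    rw [qNorm_sq hQ, h2, qInner_sum_left]
    simp only [qInner_smul_left, dotProduct, hW.z_eq]
  have hyl : √(qNorm w.Q w.y ^ 2) = qNorm w.Q w.y := Real.sqrt_sq (qNorm_nonneg _ _)
  have hqcost : ∑ j, (1 + (if 0 < qNorm w.Q (unitCol A j) then
      divC (w.z j) (qNorm w.Q (unitCol A j)) else pure 0 : Comp ℝ ℝ).exec.2) ≤ 2 * n := by
    calc _ ≤ ∑ _j : Fin n, 2 := by
          refine Finset.sum_le_sum fun j _ => ?_
          split_ifs <;> simp
      _ = _ := by simp [mul_comm]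
  have heps : (fixedData A).eps = eps m := rfl
  obtain ⟨ha1, ha2, -, ha4⟩ := argminC_spec w.S (cosine A w.toState) (List.finRange n) none
    (by simp)
  rw [List.length_finRange] at ha4
  simp only [bodyC, exec_bind_fst, exec_bind_snd, natC_fst, natC_snd, tab_fst, tab_snd, sqrtC_fst,
    sqrtC_snd, ltC_fst, ltC_snd, decide_eq_true_eq, dotC_fst, dotC_snd, Nat.cast_zero, hlen, hq,
    hysq, hyl]
  cases hres : (argminC w.S (cosine A w.toState) (List.finRange n) none).exec.1 with
  | none =>
    exact absurd (Or.inl (Finset.eq_empty_of_forall_notMem fun j =>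
      ha2 hres j (List.mem_finRange j))) hd
  | some k =>
    obtain ⟨hkS, -, hkmin⟩ := ha1 k hres
    have hk : IsArgmin A w.toState k :=
      ⟨hkS, fun j hj => hkmin j (List.mem_finRange j) hj⟩
    have hsteep : w.z k < 0 - eps m * qNorm w.Q (unitCol A k) * qNorm w.Q w.y ↔
        IsSteep A w.toState k := by
      rw [hW.z_eq, zero_sub, ← neg_mul, ← neg_mul]
      rfl
    simp only [exec_bind_fst, exec_bind_snd, mulC_fst, mulC_snd, subC_fst, subC_snd, ltC_fst,
      ltC_snd, decide_eq_true_eq, heps, hsteep, Finset.sum_const, Finset.card_univ,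
      Fintype.card_fin, smul_eq_mul, mul_one]
    by_cases hs : IsSteep A w.toState k
    · simp only [hs, if_true]
      obtain ⟨h1, h2, h3⟩ := dvC_spec hQ hW hkS
      rw [h1]
      refine ⟨.dv k hk hs, h2, .dv (hI.dv h hd hk hs) rfl ?_⟩
      rw [dvCost]
      omega
    · simp only [hs, if_false]
      have hP := hI.rescale h hd hk hs
      obtain ⟨h1, h2⟩ := rescaleC_spec (A := A) hQ hW rfl
      by_cases hr : colRank A ((rescaleUpdate A w.toState).S \ (rescaleUpdate A w.toState).T) <
          colRank A (rescaleUpdate A w.toState).S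
      · obtain ⟨e1, e2, e3⟩ := h2 hr
        rw [e1]
        refine ⟨.rescaleRemove k hk hs hr, e2, .remove (hI.remove h hd hP hr) hr ?_⟩
        rw [rescaleIterCost]
        omega
      · obtain ⟨e1, e2, e3⟩ := h1 hr
        rw [e1]
        refine ⟨.rescale k hk hs hr, e2, .rescale ⟨hP, le_antisymm
          (colRank_mono A Finset.sdiff_subset) (not_lt.1 hr)⟩ rfl ?_⟩
        rw [rescaleIterCost]
        omega

end Simulation

/-! # The main loop and the total cost -/

section MainLoop

variable {m n : ℕ} {A : Matrix (Fin m) (Fin n) ℤ}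

lemma outputC_spec {w : Work ℝ m n} (hW : WorkInv A w) :
    (outputC (fixedData A) w).exec.1 = output A w.toState ∧
      (outputC (fixedData A) w).exec.2 ≤ 1 + 2 * n := by
  classical
  have hnorm : (fixedData A).norm = colNorm A := rfl
  simp only [outputC, exec_bind_fst, exec_bind_snd, natC_fst, natC_snd, tab_fst, tab_snd, hnorm,
    Nat.cast_zero]
  constructor
  · funext j
    unfold output
    by_cases hj : j ∈ w.S
    · simp only [hj, if_true, exec_bind_fst, ltC_fst, decide_eq_true_eq, hW.p_eq]
      by_cases h0 : colNorm A j = 0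
      · simp [h0]
      · have : 0 < colNorm A j := lt_of_le_of_ne (colNorm_nonneg A j) (Ne.symm h0)
        simp [h0, this]
    · simp only [hj, if_false, exec_pure_fst]
  · refine Nat.add_le_add_left ?_ 1
    calc _ ≤ ∑ _j : Fin n, 2 := by
          refine Finset.sum_le_sum fun j _ => ?_
          split_ifs
          · simp only [exec_bind_snd, ltC_snd]
            split_ifs <;> simp
          · simp
      _ = 2 * n := by simp [mul_comm]

/-- A bound for the number of iterations. -/
noncomputable def iterBound (A : Matrix (Fin m) (Fin n) ℤ) : ℕ :=
  11133 * (m ^ 2 * fullRank A * encodingLength A) + 12 * (fullRank A * encodingLength A)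

lemma Inv.le_iterBound (h : Sizes A) {D N : ℕ} {s : State ℝ m n} (hI : Inv A D N s) :
    D + N ≤ iterBound A :=
  Nat.add_le_add (hI.count_le h).1 (hI.count_le h).2

/-- The induction runs on the remaining budget `k`, while `K` is the actual number of further
iterations. The cost is amortized: each increase of the counters pays for its iteration, and the
rank of `S` pays for the rounds still to be started. -/
lemma loopC_spec (h : Sizes A) (k : ℕ) : ∀ (D N M : ℕ) (w : Work ℝ m n),
    iterBound A ≤ D + N + k → Run A M w.toState → Inv A D N w.toState → WorkInv A w →
    ∃ K s D' N', Run A (M + K) s ∧ Done A s ∧ Inv A D' N' s ∧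
      (loopC (fixedData A) K w).exec.1 = some (output A s) ∧
      (loopC (fixedData A) K w).exec.2 + dvCost m n * D + rescaleIterCost m n * N ≤
        4 * n + 1 + dvCost m n * D' + rescaleIterCost m n * N' +
          roundCost m n * colRank A w.S := by
  have hdone : ∀ (D N M : ℕ) (w : Work ℝ m n), Done A w.toState → Run A M w.toState →
      Inv A D N w.toState → WorkInv A w →
      ∃ K s D' N', Run A (M + K) s ∧ Done A s ∧ Inv A D' N' s ∧
      (loopC (fixedData A) K w).exec.1 = some (output A s) ∧
      (loopC (fixedData A) K w).exec.2 + dvCost m n * D + rescaleIterCost m n * N ≤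
        4 * n + 1 + dvCost m n * D' + rescaleIterCost m n * N' +
          roundCost m n * colRank A w.S := by
    intro D N M w hd hR hI hW
    obtain ⟨hf1, hf2⟩ := finished_spec hW
    obtain ⟨ho1, ho2⟩ := outputC_spec hW
    refine ⟨0, w.toState, D, N, hR, hd, hI, ?_, ?_⟩
    · simp only [loopC, exec_bind_fst, hf1.2 hd, if_true, ho1, exec_pure_fst]
    · simp only [loopC, exec_bind_snd, hf1.2 hd, if_true, exec_pure_snd]
      omega
  induction k with
  | zero =>
    intro D N M w hk hR hI hW
    by_cases hd : Done A w.toState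
    · exact hdone D N M w hd hR hI hW
    · exfalso
      obtain ⟨s', hs⟩ := exists_step hd
      rcases hI.step h hd hs with h' | h' <;> have := h'.le_iterBound h <;> omega
  | succ k ih =>
    intro D N M w hk hR hI hW
    by_cases hd : Done A w.toState
    · exact hdone D N M w hd hR hI hW
    obtain ⟨hf1, hf2⟩ := finished_spec hW
    have hf : ¬ (finished w).exec.1 = true := fun e => hd (hf1.1 e)
    obtain ⟨hs, hW', hP⟩ := bodyC_spec h hI hd hW
    have hR' := Run.next hR hd hs
    have hloop1 : ∀ K, (loopC (fixedData A) (K + 1) w).exec.1 =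
        (loopC (fixedData A) K (bodyC (fixedData A) w).exec.1).exec.1 := fun K => by
      simp only [loopC, exec_bind_fst, hf, Bool.false_eq_true, if_false]
    have hloop2 : ∀ K, (loopC (fixedData A) (K + 1) w).exec.2 =
        (finished w).exec.2 + (bodyC (fixedData A) w).exec.2 +
        (loopC (fixedData A) K (bodyC (fixedData A) w).exec.1).exec.2 := fun K => by
      simp only [loopC, exec_bind_snd, hf, Bool.false_eq_true, if_false, add_assoc]
    cases hP with
    | dv hI' hr hc =>
      obtain ⟨K, s, D', N', h1, h2, h3, h4, h5⟩ := ih (D + 1) N (M + 1) _ (by omega) hR' hI' hW'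
      refine ⟨K + 1, s, D', N', by rwa [show M + (K + 1) = M + 1 + K by ring], h2, h3,
        by rw [hloop1, h4], ?_⟩
      rw [hloop2]
      rw [hr] at h5
      nlinarith
    | rescale hI' hr hc =>
      obtain ⟨K, s, D', N', h1, h2, h3, h4, h5⟩ := ih D (N + 1) (M + 1) _ (by omega) hR' hI' hW'
      refine ⟨K + 1, s, D', N', by rwa [show M + (K + 1) = M + 1 + K by ring], h2, h3,
        by rw [hloop1, h4], ?_⟩
      rw [hloop2]
      rw [hr] at h5
      nlinarith
    | remove hI' hr hc =>
      obtain ⟨K, s, D', N', h1, h2, h3, h4, h5⟩ := ih D (N + 1) (M + 1) _ (by omega) hR' hI' hW'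
      refine ⟨K + 1, s, D', N', by rwa [show M + (K + 1) = M + 1 + K by ring], h2, h3,
        by rw [hloop1, h4], ?_⟩
      rw [hloop2]
      -- The rank drops by at least one, which releases the cost of one new round.
      have h6 := Nat.mul_le_mul_left (roundCost m n) (Nat.succ_le_of_lt hr)
      rw [Nat.mul_succ] at h6
      nlinarith

/-! ### Summing up the costs -/

lemma rescaleIterCost_le (hm : 1 ≤ m) (hn : 1 ≤ n) :
    rescaleIterCost m n ≤ 40 * (m ^ 2 * n + n ^ 2) := by
  have h1 : n ≤ n * n := Nat.le_mul_of_pos_left n hn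
  have h2 : m ≤ m * m := Nat.le_mul_of_pos_left m hm
  have h3 : m * m ≤ m * m * n := Nat.le_mul_of_pos_right _ hn
  have h4 : m * n ≤ m * m * n := Nat.mul_le_mul_right n h2
  unfold rescaleIterCost rescaleCost
  nlinarith

lemma roundCost_le (hm : 1 ≤ m) (hn : 1 ≤ n) :
    roundCost m n ≤ 34 * (m ^ 2 * n + m * n ^ 2) := by
  have h1 : n ≤ n * n := Nat.le_mul_of_pos_left n hn
  have h2 : m ≤ m * m := Nat.le_mul_of_pos_left m hm
  have h3 : m * m ≤ m * m * n := Nat.le_mul_of_pos_right _ hn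
  have h4 : m * n ≤ m * m * n := Nat.mul_le_mul_right n h2
  have h5 : n * n ≤ m * (n * n) := Nat.le_mul_of_pos_left _ hm
  unfold roundCost
  nlinarith

lemma Sizes.iterBound_le (h : Sizes A) :
    iterBound A ≤ 11145 * ((m ^ 3 * n + m * n ^ 2) * encodingLength A) := by
  have hrn : fullRank A ≤ n := (colRank_le_card A _).trans (by simp)
  set L := encodingLength A
  set r := fullRank A
  have h1 : m ^ 2 * r ≤ m ^ 3 * n + m * n ^ 2 := by
    calc m ^ 2 * r ≤ m ^ 3 * n := Nat.mul_le_mul (Nat.pow_le_pow_right h.hm (by norm_num)) hrn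
      _ ≤ _ := Nat.le_add_right _ _
  have h2 : r ≤ m ^ 2 * r := Nat.le_mul_of_pos_left _ (pow_pos h.hm 2)
  have h3 := Nat.mul_le_mul_right L h1
  have h4 := Nat.mul_le_mul_right L h2
  have : iterBound A = 11133 * (m ^ 2 * r * L) + 12 * (r * L) := rfl
  omega

/-- The updates dominate: (m+n) m² r L ≤ 2 m³ n L by r ≤ n in one summand and r ≤ m in the other.
Rescalings use r ≤ m. The new rounds produce a term m² n², which is at most m n² L because m ≤ L. -/
lemma Sizes.totalCost_le (h : Sizes A) {D N : ℕ}
    (hD : D ≤ 11133 * (m ^ 2 * fullRank A * encodingLength A))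
    (hN : N ≤ 12 * (fullRank A * encodingLength A)) :
    (n * (2 * m + 1) + n + (n * n + n * (n * (6 * m + 3) + (2 * m + 4)) + 4) + 2 * (m * n) + 6) +
      (n * (n * (2 * m + 1)) + 2 + roundCost m n) +
      (4 * n + 1 + dvCost m n * D + rescaleIterCost m n * N + roundCost m n * fullRank A) ≤
    600000 * ((m ^ 3 * n + m * n ^ 2) * encodingLength A) := by
  have hm := h.hm
  have hn := h.hn
  have hrn : fullRank A ≤ n := (colRank_le_card A _).trans (by simp)
  have hrm : fullRank A ≤ m := colRank_le_rows A _
  have hmL := h.rows_le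
  have hL := h.one_le
  have hc2 := rescaleIterCost_le hm hn
  have hc3 := roundCost_le hm hn
  set L := encodingLength A
  set r := fullRank A
  set X := m ^ 3 * n + m * n ^ 2 with hX
  have hc1 : dvCost m n ≤ 23 * (m + n) := by unfold dvCost; omega
  have h2 : dvCost m n * D ≤ 512118 * (X * L) := by
    have e1 : (m + n) * (m ^ 2 * r) ≤ 2 * X := by
      have e2 : m * (m ^ 2 * r) ≤ m ^ 3 * n := by
        calc m * (m ^ 2 * r) = m ^ 3 * r := by ring
          _ ≤ _ := Nat.mul_le_mul_left _ hrn
      have e3 : n * (m ^ 2 * r) ≤ m ^ 3 * n := by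
        calc n * (m ^ 2 * r) ≤ n * (m ^ 2 * m) := by gcongr
          _ = _ := by ring
      have e4 : (m + n) * (m ^ 2 * r) = m * (m ^ 2 * r) + n * (m ^ 2 * r) := by ring
      omega
    calc dvCost m n * D ≤ 23 * (m + n) * (11133 * (m ^ 2 * r * L)) := Nat.mul_le_mul hc1 hD
      _ = 256059 * ((m + n) * (m ^ 2 * r) * L) := by ring
      _ ≤ 256059 * (2 * X * L) := by gcongr
      _ = _ := by ring
  have h3 : rescaleIterCost m n * N ≤ 480 * (X * L) := by
    calc rescaleIterCost m n * N ≤ 40 * (m ^ 2 * n + n ^ 2) * (12 * (r * L)) :=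
          Nat.mul_le_mul hc2 hN
      _ = 480 * ((m ^ 2 * n + n ^ 2) * r * L) := by ring
      _ ≤ 480 * ((m ^ 2 * n + n ^ 2) * m * L) := by gcongr
      _ = _ := by rw [hX]; ring
  have h4 : roundCost m n * r ≤ 34 * (X * L) := by
    calc roundCost m n * r ≤ 34 * (m ^ 2 * n + m * n ^ 2) * m := Nat.mul_le_mul hc3 hrm
      _ = 34 * (m ^ 3 * n * 1 + m * n ^ 2 * m) := by ring
      _ ≤ 34 * (m ^ 3 * n * L + m * n ^ 2 * L) := by gcongr
      _ = _ := by rw [hX]; ring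
  have hXL : X ≤ X * L := Nat.le_mul_of_pos_right _ hL
  have hX1 : m * n ^ 2 ≤ X := Nat.le_add_left _ _
  have hX2 : m ^ 2 * n ≤ X :=
    (Nat.mul_le_mul_right n (Nat.pow_le_pow_right hm (by norm_num))).trans (Nat.le_add_right _ _)
  have h5 : n ≤ n * n := Nat.le_mul_of_pos_left n hn
  have h6 : n * n ≤ m * (n * n) := Nat.le_mul_of_pos_left _ hm
  have h7 : m * n ≤ m * (n * n) := Nat.mul_le_mul_left m h5
  nlinarith

end MainLoop

end KernelAlg

theorem theorem4p6 :
    ∃ C : ℕ, ∀ (m n : ℕ), 1 ≤ m → 1 ≤ n → ∀ A : Matrix (Fin m) (Fin n) ℤ,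
      -- every run of the algorithm, however ties are broken, is short, does not get stuck,
      -- and returns only solutions of maximum support
      (∀ (N : ℕ) (s : KernelAlg.State ℝ m n), KernelAlg.Run A N s →
        N ≤ C * ((m ^ 3 * n + m * n ^ 2) * KernelAlg.encodingLength A) ∧
        (KernelAlg.Done A s ∨ ∃ s', KernelAlg.Step A s s') ∧
        (KernelAlg.Done A s →
          KernelAlg.IsMaxSupportSolution A (KernelAlg.output A s))) ∧
      -- the counted program performs such a run to its end, within the stated number of
      -- arithmetic operations
      (∃ (N : ℕ) (s : KernelAlg.State ℝ m n) (x : Fin n → ℝ),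
        KernelAlg.Run A N s ∧ KernelAlg.Done A s ∧ x = KernelAlg.output A s ∧
        KernelAlg.IsMaxSupportSolution A x ∧
        (KernelAlg.maxSupportKernel (A.map (Int.cast : ℤ → ℝ)) N).exec.1 = some x ∧
        (KernelAlg.maxSupportKernel (A.map (Int.cast : ℤ → ℝ)) N).exec.2 ≤
          C * ((m ^ 3 * n + m * n ^ 2) * KernelAlg.encodingLength A)) := by
  refine ⟨600000, fun m n hm hn A => ?_⟩
  have h : KernelAlg.Sizes A := ⟨hm, hn⟩
  refine ⟨fun N s hR => ?_, ?_⟩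
  · obtain ⟨D, N, rfl, hI⟩ := hR.exists_inv h
    have h1 := hI.le_iterBound h
    have h2 := h.iterBound_le
    refine ⟨by omega, ?_, hI.isMaxSupportSolution⟩
    by_cases hd : KernelAlg.Done A s
    · exact Or.inl hd
    · exact Or.inr (KernelAlg.exists_step hd)
  · obtain ⟨h1, h2, h3⟩ := KernelAlg.firstRound_spec (A := A)
    -- The cutoff given to the program is the exact length `K` of the run that it performs.
    obtain ⟨K, s, D, N, hR, hd, hI, hval, hcost⟩ := KernelAlg.loopC_spec h
      (KernelAlg.iterBound A) 0 0 0 _ (by omega) (h1 ▸ KernelAlg.Run.start)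
      (h1 ▸ KernelAlg.inv_start h) h2
    rw [Nat.zero_add] at hR
    refine ⟨K, s, _, hR, hd, rfl, hI.isMaxSupportSolution hd, ?_, ?_⟩
    · simp only [KernelAlg.maxSupportKernel, KernelAlg.exec_bind_fst, KernelAlg.prepare_fst]
      exact hval
    · simp only [KernelAlg.maxSupportKernel, KernelAlg.exec_bind_snd, KernelAlg.prepare_fst]
      have h4 := KernelAlg.prepare_snd_le (A.map (Int.cast : ℤ → ℝ))
      have h5 := h.totalCost_le (hI.count_le h).1 (hI.count_le h).2
      have h6 : KernelAlg.roundCost m n *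
          KernelAlg.colRank A (KernelAlg.firstRound (KernelAlg.fixedData A)).exec.1.S ≤
          KernelAlg.roundCost m n * KernelAlg.fullRank A :=
        Nat.mul_le_mul_left _ (KernelAlg.colRank_le_fullRank _)
      omega
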